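/- Let $\omega\in C^\infty(\mathbb R)$ satisfy $\omega\ge\omega_*$ on $\mathbb R$ for some constant $\omega_*>0$, let $y_*,p_*,u_*\in\mathbb R$, $\theta_*=u_*^2/(2\omega(y_*))$, $T>0$, $\varepsilon_0>0$, and for $0<\varepsilon<\varepsilon_0$ let $(\phi_\varepsilon,\theta_\varepsilon,y_\varepsilon,p_\varepsilon)$ be the solution on $[0,T]$ of the canonical equations $$\dot\phi_\varepsilon=\frac{\partial E_\varepsilon}{\partial\theta_\varepsilon},\quad \dot\theta_\varepsilon=-\frac{\partial E_\varepsilon}{\partial\phi_\varepsilon},\quad \dot y_\varepsilon=\frac{\partial E_\varepsilon}{\partial p_\varepsilon},\quad \dot p_\varepsilon=-\frac{\partial E_\varepsilon}{\partial y_\varepsilon},$$ $$E_\varepsilon=\tfrac12p_\varepsilon^2+\theta_\varepsilon\omega(y_\varepsilon)+\varepsilon\,\frac{\theta_\varepsilon p_\varepsilon\omega'(y_\varepsilon)}{2\omega(y_\varepsilon)}\sin\frac{2\phi_\varepsilon}{\varepsilon}+\frac{\varepsilon^2}{8}\Big(\frac{\theta_\varepsilon\omega'(y_\varepsilon)}{\omega(y_\varepsilon)}\sin\frac{2\phi_\varepsilon}{\varepsilon}\Big)^2,$$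 with the $\varepsilon$-independent initial values $\phi_\varepsilon(0)=0$, $\theta_\varepsilon(0)=\theta_*$, $y_\varepsilon(0)=y_*$, $p_\varepsilon(0)=p_*$. (This is the action-angle form of the system $\ddot y_\varepsilon=-\varepsilon^{-2}\omega(y_\varepsilon)\omega'(y_\varepsilon)z_\varepsilon^2$, $\ddot z_\varepsilon=-\varepsilon^{-2}\omega^2(y_\varepsilon)z_\varepsilon$.) Let $(\phi_0,y_0,p_0)$ be the solution on $[0,T]$ of $\dot\phi_0=\omega(y_0)$, $\dot y_0=p_0$, $\dot p_0=-\theta_*\omega'(y_0)$ with $\phi_0(0)=0$, $y_0(0)=y_*$, $p_0(0)=p_*$. Put $L=\log\omega$ and $D_yL_0=L'(y_0)$, $D_y^2L_0=L''(y_0)$, $D_tL_0=\frac{d}{dt}L(y_0)$, $D_tD_yL_0=\frac{d}{dt}L'(y_0)$. Define the correctors $$[\theta_1]^\varepsilon=-\frac{\theta_*D_tL_0}{2\omega(y_0)}\sin\frac{2\phi_0}{\varepsilon},\quad [\phi_2]^\varepsilon=-\frac{D_tL_0}{4\omega(y_0)}\cos\frac{2\phi_0}{\varepsilon},\quad [y_2]^\varepsilon=-\frac{\theta_*D_yL_0}{4\omega(y_0)}\cos\frac{2\phi_0}{\varepsilon},\quad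 [p_2]^\varepsilon=\frac{d}{dt}\Big(\frac{\theta_*D_yL_0}{4\omega(y_0)}\Big)\cos\frac{2\phi_0}{\varepsilon},$$ $$[\theta_2]^\varepsilon=-\theta_*D_yL_0[y_2]^\varepsilon-\frac{p_0}{\omega(y_0)}[p_2]^\varepsilon+\frac{\theta_*^2(D_yL_0)^2}{16\omega(y_0)}\cos\frac{4\phi_0}{\varepsilon}-\frac{\theta_*D_tL_0}{\omega(y_0)}\bar\phi_2\cos\frac{2\phi_0}{\varepsilon},$$ and the rescaled residuals $$\theta_1^\varepsilon=\frac{\theta_\varepsilon-\theta_*}{\varepsilon},\quad \phi_2^\varepsilon=\frac{\phi_\varepsilon-\phi_0}{\varepsilon^2},\quad y_2^\varepsilon=\frac{y_\varepsilon-y_0}{\varepsilon^2},\quad p_2^\varepsilon=\frac{p_\varepsilon-p_0}{\varepsilon^2},\quad \theta_2^\varepsilon=\frac{\theta_1^\varepsilon-[\theta_1]^\varepsilon}{\varepsilon}.$$ Then the inhomogeneous linear system $$\frac{d\bar\phi_2}{dt}=\omega'(y_0)\bar y_2+\frac{\theta_*(D_yL_0)^2}{8}-\frac{(D_tL_0)^2}{8\omega(y_0)},\qquad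 \frac{d\bar\theta_2}{dt}=\frac{d}{dt}\,\frac{\theta_*(D_tL_0)^2}{8\omega^2(y_0)},\qquad \frac{d\bar y_2}{dt}=\bar p_2-\frac{\theta_*D_yL_0D_tL_0}{4\omega(y_0)},$$ $$\frac{d\bar p_2}{dt}=-\omega'(y_0)\bar\theta_2-\theta_*\omega''(y_0)\bar y_2-\frac{\theta_*^2D_yL_0D_y^2L_0}{8}+\frac{\theta_*D_tL_0\,D_tD_yL_0}{4\omega(y_0)},$$ with the $\varepsilon$-independent initial values $\bar\phi_2(0)=-[\phi_2]^\varepsilon(0)$, $\bar\theta_2(0)=-[\theta_2]^\varepsilon(0)$, $\bar y_2(0)=-[y_2]^\varepsilon(0)$, $\bar p_2(0)=-[p_2]^\varepsilon(0)$, has a unique solution $(\bar\phi_2,\bar\theta_2,\bar y_2,\bar p_2)$ on $[0,T]$, and, as $\varepsilon\to0$, $$\theta_1^\varepsilon-[\theta_1]^\varepsilon\to0,\quad \phi_2^\varepsilon-[\phi_2]^\varepsilon\to\bar\phi_2,\quad y_2^\varepsilon-[y_2]^\varepsilon\to\bar y_2,\quad p_2^\varepsilon-[p_2]^\varepsilon\to\bar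 p_2,\quad \theta_2^\varepsilon-[\theta_2]^\varepsilon\to\bar\theta_2\quad\text{in }C([0,T]),$$ while, weakly* in $L^\infty((0,T))$, $$\frac{d}{dt}(\theta_1^\varepsilon-[\theta_1]^\varepsilon)\to0,\quad \frac{d}{dt}(\phi_2^\varepsilon-[\phi_2]^\varepsilon)\to\frac{d\bar\phi_2}{dt},\quad \frac{d}{dt}(y_2^\varepsilon-[y_2]^\varepsilon)\to\frac{d\bar y_2}{dt},\quad \frac{d}{dt}(p_2^\varepsilon-[p_2]^\varepsilon)\to\frac{d\bar p_2}{dt}.$$ Consequently, uniformly on $[0,T]$, $$\phi_\varepsilon=\phi_0+\varepsilon^2(\bar\phi_2+[\phi_2]^\varepsilon)+o(\varepsilon^2),\qquad \theta_\varepsilon=\theta_*+\varepsilon[\theta_1]^\varepsilon+\varepsilon^2(\bar\theta_2+[\theta_2]^\varepsilon)+o(\varepsilon^2),$$ $$y_\varepsilon=y_0+\varepsilon^2(\bar y_2+[y_2]^\varepsilon)+o(\varepsilon^2),\qquad p_\varepsilon=p_0+\varepsilon^2(\bar p_2+[p_2]^\varepsilon)+o(\varepsilon^2).$$ -/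

import Mathlib

open Set Filter Topology MeasureTheory

noncomputable section

namespace FastSlow

/-- The initial action `θ_* = u_*² / (2 ω(y_*))`. -/
def thetaStar (ω : ℝ → ℝ) (ystar ustar : ℝ) : ℝ := ustar ^ 2 / (2 * ω ystar)

/-- `(φ, θ, y, p)` solves, on `[0, T]`, the canonical equations of the fast-slow system in
action-angle variables with scale parameter `ε`, with initial values `(0, θ_*, y_*, p_*)`. -/
structure IsActionAngleSolution (ω : ℝ → ℝ) (T ystar pstar ustar ε : ℝ)
    (φ θ y p : ℝ → ℝ) : Prop where
  phi_init : φ 0 = 0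
  theta_init : θ 0 = thetaStar ω ystar ustar
  y_init : y 0 = ystar
  p_init : p 0 = pstar
  phi_eq : ∀ t ∈ Icc 0 T, HasDerivWithinAt φ
    (ω (y t) + ε * (p t * deriv ω (y t) / (2 * ω (y t))) * Real.sin (2 * φ t / ε)
      + ε ^ 2 * (θ t * deriv ω (y t) ^ 2 / (4 * ω (y t) ^ 2)) * Real.sin (2 * φ t / ε) ^ 2)
    (Icc 0 T) t
  theta_eq : ∀ t ∈ Icc 0 T, HasDerivWithinAt θ
    (-(θ t * p t * deriv ω (y t) / ω (y t)) * Real.cos (2 * φ t / ε)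
      - ε * (θ t ^ 2 * deriv ω (y t) ^ 2 / (4 * ω (y t) ^ 2)) * Real.sin (4 * φ t / ε))
    (Icc 0 T) t
  y_eq : ∀ t ∈ Icc 0 T, HasDerivWithinAt y
    (p t + ε * (θ t * deriv ω (y t) / (2 * ω (y t))) * Real.sin (2 * φ t / ε))
    (Icc 0 T) t
  p_eq : ∀ t ∈ Icc 0 T, HasDerivWithinAt p
    (-(θ t * deriv ω (y t))
      + ε * (θ t * p t * deriv ω (y t) ^ 2 / (2 * ω (y t) ^ 2)) * Real.sin (2 * φ t / ε)
      - ε * (θ t * p t * deriv (deriv ω) (y t) / (2 * ω (y t))) * Real.sin (2 * φ t / ε)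
      + ε ^ 2 * (θ t ^ 2 * deriv ω (y t) ^ 3 / (4 * ω (y t) ^ 3)) * Real.sin (2 * φ t / ε) ^ 2
      - ε ^ 2 * (θ t ^ 2 * deriv ω (y t) * deriv (deriv ω) (y t) / (4 * ω (y t) ^ 2))
          * Real.sin (2 * φ t / ε) ^ 2)
    (Icc 0 T) t

/-- `(φ₀, y₀, p₀)` solves, on `[0, T]`, the leading-order system
`φ₀' = ω(y₀)`, `y₀' = p₀`, `p₀' = -θ_* ω'(y₀)` with initial values `(0, y_*, p_*)`
(the leading-order action is the constant `θ_*`). -/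
structure IsLeadingOrder (ω : ℝ → ℝ) (T ystar pstar ustar : ℝ) (φ₀ y₀ p₀ : ℝ → ℝ) : Prop where
  phi_init : φ₀ 0 = 0
  y_init : y₀ 0 = ystar
  p_init : p₀ 0 = pstar
  phi_eq : ∀ t ∈ Icc 0 T, HasDerivWithinAt φ₀ (ω (y₀ t)) (Icc 0 T) t
  y_eq : ∀ t ∈ Icc 0 T, HasDerivWithinAt y₀ (p₀ t) (Icc 0 T) t
  p_eq : ∀ t ∈ Icc 0 T,
    HasDerivWithinAt p₀ (-(thetaStar ω ystar ustar * deriv ω (y₀ t))) (Icc 0 T) t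

/-- Time derivative of a function on `[0, T]` (one-sided at the end points). -/
def ddt (T : ℝ) (f : ℝ → ℝ) (t : ℝ) : ℝ := derivWithin f (Icc 0 T) t

/-- `L(y) = log ω(y)`. -/
def logFreq (ω : ℝ → ℝ) (y : ℝ) : ℝ := Real.log (ω y)

/-- `D_y L₀`, the derivative of `L` along `y₀`. -/
def DyL (ω y₀ : ℝ → ℝ) (t : ℝ) : ℝ := deriv (logFreq ω) (y₀ t)

/-- `D_y² L₀`, the second derivative of `L` along `y₀`. -/
def DyyL (ω y₀ : ℝ → ℝ) (t : ℝ) : ℝ := deriv (deriv (logFreq ω)) (y₀ t)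

/-- `D_t L₀ = d/dt L(y₀(t))`. -/
def DtL (ω : ℝ → ℝ) (T : ℝ) (y₀ : ℝ → ℝ) (t : ℝ) : ℝ := ddt T (fun s => logFreq ω (y₀ s)) t

/-- `D_t D_y L₀ = d/dt L'(y₀(t))`. -/
def DtDyL (ω : ℝ → ℝ) (T : ℝ) (y₀ : ℝ → ℝ) (t : ℝ) : ℝ := ddt T (DyL ω y₀) t

/-- The corrector `[θ₁]^ε`; here and below `θs` stands for `θ_*`. -/
def thetaOsc₁ (ω : ℝ → ℝ) (T θs : ℝ) (φ₀ y₀ : ℝ → ℝ) (ε t : ℝ) : ℝ :=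
  -(θs * DtL ω T y₀ t / (2 * ω (y₀ t))) * Real.sin (2 * φ₀ t / ε)

/-- The corrector `[φ₂]^ε`. -/
def phiOsc₂ (ω : ℝ → ℝ) (T : ℝ) (φ₀ y₀ : ℝ → ℝ) (ε t : ℝ) : ℝ :=
  -(DtL ω T y₀ t / (4 * ω (y₀ t))) * Real.cos (2 * φ₀ t / ε)

/-- The corrector `[y₂]^ε`. -/
def yOsc₂ (ω : ℝ → ℝ) (θs : ℝ) (φ₀ y₀ : ℝ → ℝ) (ε t : ℝ) : ℝ :=
  -(θs * DyL ω y₀ t / (4 * ω (y₀ t))) * Real.cos (2 * φ₀ t / ε)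

/-- The corrector `[p₂]^ε`. -/
def pOsc₂ (ω : ℝ → ℝ) (T θs : ℝ) (φ₀ y₀ : ℝ → ℝ) (ε t : ℝ) : ℝ :=
  ddt T (fun s => θs * DyL ω y₀ s / (4 * ω (y₀ s))) t * Real.cos (2 * φ₀ t / ε)

/-- The corrector `[θ₂]^ε`, which involves the averaged second-order phase `φb`. -/
def thetaOsc₂ (ω : ℝ → ℝ) (T θs : ℝ) (φ₀ y₀ p₀ φb : ℝ → ℝ) (ε t : ℝ) : ℝ :=
  -(θs * DyL ω y₀ t * yOsc₂ ω θs φ₀ y₀ ε t)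
    - p₀ t / ω (y₀ t) * pOsc₂ ω T θs φ₀ y₀ ε t
    + θs ^ 2 * DyL ω y₀ t ^ 2 / (16 * ω (y₀ t)) * Real.cos (4 * φ₀ t / ε)
    - θs * DtL ω T y₀ t / ω (y₀ t) * φb t * Real.cos (2 * φ₀ t / ε)

/-- The rescaled residual `θ₁^ε`. -/
def thetaRes₁ (θs : ℝ) (θ : ℝ → ℝ → ℝ) (ε t : ℝ) : ℝ := (θ ε t - θs) / ε

/-- The rescaled residuals `φ₂^ε`, `y₂^ε`, `p₂^ε`: `(u_ε - u₀) / ε²`. -/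
def res₂ (u : ℝ → ℝ → ℝ) (u₀ : ℝ → ℝ) (ε t : ℝ) : ℝ := (u ε t - u₀ t) / ε ^ 2

/-- The rescaled residual `θ₂^ε = (θ₁^ε - [θ₁]^ε) / ε`. -/
def thetaRes₂ (ω : ℝ → ℝ) (T θs : ℝ) (φ₀ y₀ : ℝ → ℝ) (θ : ℝ → ℝ → ℝ) (ε t : ℝ) : ℝ :=
  (thetaRes₁ θs θ ε t - thetaOsc₁ ω T θs φ₀ y₀ ε t) / ε

/-- `(φb, θb, yb, pb)` is a solution on `[0, T]` of the inhomogeneous linear initial value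
problem for the averaged second-order motion. The initial values are required for every `ε`;
their right-hand sides do not depend on `ε`, because `φ₀(0) = 0`. -/
structure IsSecondOrderSolution (ω : ℝ → ℝ) (T θs : ℝ) (φ₀ y₀ p₀ : ℝ → ℝ)
    (φb θb yb pb : ℝ → ℝ) : Prop where
  phi_init : ∀ ε > 0, φb 0 = -phiOsc₂ ω T φ₀ y₀ ε 0
  theta_init : ∀ ε > 0, θb 0 = -thetaOsc₂ ω T θs φ₀ y₀ p₀ φb ε 0
  y_init : ∀ ε > 0, yb 0 = -yOsc₂ ω θs φ₀ y₀ ε 0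
  p_init : ∀ ε > 0, pb 0 = -pOsc₂ ω T θs φ₀ y₀ ε 0
  phi_eq : ∀ t ∈ Icc 0 T, HasDerivWithinAt φb
    (deriv ω (y₀ t) * yb t + θs * DyL ω y₀ t ^ 2 / 8 - DtL ω T y₀ t ^ 2 / (8 * ω (y₀ t)))
    (Icc 0 T) t
  theta_eq : ∀ t ∈ Icc 0 T, HasDerivWithinAt θb
    (ddt T (fun s => θs * DtL ω T y₀ s ^ 2 / (8 * ω (y₀ s) ^ 2)) t)
    (Icc 0 T) t
  y_eq : ∀ t ∈ Icc 0 T, HasDerivWithinAt yb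
    (pb t - θs * DyL ω y₀ t * DtL ω T y₀ t / (4 * ω (y₀ t)))
    (Icc 0 T) t
  p_eq : ∀ t ∈ Icc 0 T, HasDerivWithinAt pb
    (-(deriv ω (y₀ t) * θb t) - θs * deriv (deriv ω) (y₀ t) * yb t
      - θs ^ 2 * DyL ω y₀ t * DyyL ω y₀ t / 8
      + θs * DtL ω T y₀ t * DtDyL ω T y₀ t / (4 * ω (y₀ t)))
    (Icc 0 T) t

/-- `u_ε → v` in `C([0, T])` as `ε → 0`, for a family indexed by `0 < ε < ε₀`. -/
def TendstoInC (T ε₀ : ℝ) (u : ℝ → ℝ → ℝ) (v : ℝ → ℝ) : Prop :=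
  (∀ ε ∈ Ioo 0 ε₀, ContinuousOn (u ε) (Icc 0 T)) ∧ ContinuousOn v (Icc 0 T) ∧
    TendstoUniformlyOn u v (𝓝[>] 0) (Icc 0 T)

/-- `f_ε ⇀ g` weakly* in `L^∞((0, T))` as `ε → 0`, for a family indexed by `0 < ε < ε₀`:
all functions lie in `L^∞((0, T))`, and the pairings with every `h ∈ L¹((0, T))` converge. -/
def TendstoWeakStar (T ε₀ : ℝ) (f : ℝ → ℝ → ℝ) (g : ℝ → ℝ) : Prop :=
  (∀ ε ∈ Ioo 0 ε₀, MemLp (f ε) ⊤ (volume.restrict (Ioo 0 T))) ∧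
    MemLp g ⊤ (volume.restrict (Ioo 0 T)) ∧
    ∀ h : ℝ → ℝ, MemLp h 1 (volume.restrict (Ioo 0 T)) →
      Tendsto (fun ε => ∫ t in Ioo 0 T, f ε t * h t) (𝓝[>] 0) (𝓝 (∫ t in Ioo 0 T, g t * h t))

/-- `du_ε/dt ⇀ dv/dt` weakly* in `L^∞((0, T))`, where all functions are differentiable on
`[0, T]`. -/
def DerivTendstoWeakStar (T ε₀ : ℝ) (u : ℝ → ℝ → ℝ) (v : ℝ → ℝ) : Prop :=
  (∀ ε ∈ Ioo 0 ε₀, DifferentiableOn ℝ (u ε) (Icc 0 T)) ∧ DifferentiableOn ℝ v (Icc 0 T) ∧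
    TendstoWeakStar T ε₀ (fun ε => ddt T (u ε)) (ddt T v)

end FastSlow

end

open FastSlow

/-! Write `a = ω'/ω`. The Hamiltonian is a square plus a multiple of the action, `E = (p + ε θ a
sin(2φ/ε)/2)²/2 + θ ω`, and `θ` never becomes negative, so conservation of energy bounds `θ`, `y`,
`p` uniformly in `ε`. The same identity eliminates `θ ω` from the equation for `p`: up to terms
carrying a factor `ε`, the slow pair obeys `y' = p`, `p' = -a(y) (E - p²/2)`, and the action with
its order-one oscillating derivative has dropped out.

Averaging rests on `avgO_mul_profile`. The fast phase `2φ/ε` rotates at rate `2ω/ε + O(1)` with `ω >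
0`, so a slowly varying coefficient times a mean-free profile is, up to `O(ε)`, the time derivative
of a quantity of size `O(ε)`. `unifO_of_planar_linear` subtracts such quantities and then applies
Grönwall. A first round gives `y - y₀`, `p - p₀`, `φ - φ₀ = O(ε²)`, and the energy then gives `θ -
θs = O(ε)`.

In the second round the averaged correction and an oscillating corrector, evaluated along the exact
solution, are removed from the residuals. The derivative of the oscillating corrector cancels the
sine of order `ε`. Of the products of sines and cosines left at order `ε²`, the means are exactly
the inhomogeneities of the linear system, and the rest averages to `O(ε³)` (`resY_resP`, `resφ`).
The exact action is expanded algebraically, by comparing the exact energy with the leading energy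
and with its second-order balance `correction_energy` (`θ_expansion_one`, `θ_expansion_two`).
Replacing `φ` by `φ₀` shifts the fast phase by `2 (φ - φ₀)/ε = O(ε)`; in the first-order term of the
action this shift produces the `φb` term of `[θ₂]`.

Dividing by powers of `ε` gives the uniform limits. The residuals also have uniformly bounded
derivatives, and together with uniform convergence and density of smooth functions in `L¹` this
yields the weak* limits. -/

namespace FastSlow

/-! ### Uniform order estimates on `(0, ε₀) × [0, T]` -/

/-- `f = O(ε ^ k)` uniformly for `0 < ε < ε₀` and `t ∈ [0, T]`. -/
def UnifO (ε₀ T : ℝ) (k : ℕ) (f : ℝ → ℝ → ℝ) : Prop :=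
  ∃ K, ∀ ε ∈ Ioo 0 ε₀, ∀ t ∈ Icc 0 T, |f ε t| ≤ K * ε ^ k

/-- Uniform boundedness for `0 < ε < ε₀` and `t ∈ [0, T]`. -/
def UnifBdd (ε₀ T : ℝ) (f : ℝ → ℝ → ℝ) : Prop :=
  ∃ K, ∀ ε ∈ Ioo 0 ε₀, ∀ t ∈ Icc 0 T, |f ε t| ≤ K

variable {ε₀ T : ℝ} {k : ℕ} {f g : ℝ → ℝ → ℝ}

namespace UnifBdd

lemma exists_pos (hf : UnifBdd ε₀ T f) :
    ∃ K, 0 < K ∧ ∀ ε ∈ Ioo 0 ε₀, ∀ t ∈ Icc 0 T, |f ε t| ≤ K := by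
  obtain ⟨K, hK⟩ := hf
  exact ⟨max K 1, by positivity, fun ε hε t ht => (hK ε hε t ht).trans (le_max_left _ _)⟩

lemma congr (hf : UnifBdd ε₀ T f) (h : ∀ ε ∈ Ioo 0 ε₀, ∀ t ∈ Icc 0 T, g ε t = f ε t) :
    UnifBdd ε₀ T g := by
  obtain ⟨K, hK⟩ := hf
  exact ⟨K, fun ε hε t ht => by rw [h ε hε t ht]; exact hK ε hε t ht⟩

lemma const (c : ℝ) : UnifBdd ε₀ T (fun _ _ => c) := ⟨|c|, fun _ _ _ _ => le_rfl⟩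

lemma eps : UnifBdd ε₀ T (fun ε _ => ε) :=
  ⟨ε₀, fun ε hε _ _ => by rw [abs_of_pos hε.1]; exact hε.2.le⟩

lemma add (hf : UnifBdd ε₀ T f) (hg : UnifBdd ε₀ T g) :
    UnifBdd ε₀ T (fun ε t => f ε t + g ε t) := by
  obtain ⟨K, hK⟩ := hf
  obtain ⟨M, hM⟩ := hg
  exact ⟨K + M, fun ε hε t ht =>
    (abs_add_le _ _).trans (add_le_add (hK ε hε t ht) (hM ε hε t ht))⟩

lemma neg (hf : UnifBdd ε₀ T f) : UnifBdd ε₀ T (fun ε t => -f ε t) := by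
  obtain ⟨K, hK⟩ := hf
  exact ⟨K, fun ε hε t ht => by rw [abs_neg]; exact hK ε hε t ht⟩

lemma sub (hf : UnifBdd ε₀ T f) (hg : UnifBdd ε₀ T g) :
    UnifBdd ε₀ T (fun ε t => f ε t - g ε t) := by
  simpa only [sub_eq_add_neg] using hf.add hg.neg

lemma mul (hf : UnifBdd ε₀ T f) (hg : UnifBdd ε₀ T g) :
    UnifBdd ε₀ T (fun ε t => f ε t * g ε t) := by
  obtain ⟨K, hK0, hK⟩ := hf.exists_pos
  obtain ⟨M, hM⟩ := hg
  exact ⟨K * M, fun ε hε t ht => by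
    rw [abs_mul]
    exact mul_le_mul (hK ε hε t ht) (hM ε hε t ht) (abs_nonneg _) hK0.le⟩

lemma div_const (hf : UnifBdd ε₀ T f) (c : ℝ) : UnifBdd ε₀ T (fun ε t => f ε t / c) := by
  simpa only [div_eq_mul_inv] using hf.mul (const c⁻¹)

lemma pow (hf : UnifBdd ε₀ T f) (n : ℕ) : UnifBdd ε₀ T (fun ε t => f ε t ^ n) := by
  obtain ⟨K, hK⟩ := hf
  exact ⟨K ^ n, fun ε hε t ht => by
    rw [abs_pow]; exact pow_le_pow_left₀ (abs_nonneg _) (hK ε hε t ht) n⟩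

lemma sin (x : ℝ → ℝ → ℝ) : UnifBdd ε₀ T (fun ε t => Real.sin (x ε t)) :=
  ⟨1, fun _ _ _ _ => Real.abs_sin_le_one _⟩

lemma cos (x : ℝ → ℝ → ℝ) : UnifBdd ε₀ T (fun ε t => Real.cos (x ε t)) :=
  ⟨1, fun _ _ _ _ => Real.abs_cos_le_one _⟩

lemma of_continuousOn {u : ℝ → ℝ} (hu : ContinuousOn u (Icc 0 T)) :
    UnifBdd ε₀ T (fun _ t => u t) := by
  obtain ⟨K, hK⟩ := isCompact_Icc.exists_bound_of_continuousOn hu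
  exact ⟨K, fun _ _ t ht => hK t ht⟩

lemma comp_continuous {u : ℝ → ℝ} (hu : Continuous u) (hf : UnifBdd ε₀ T f) :
    UnifBdd ε₀ T (fun ε t => u (f ε t)) := by
  obtain ⟨K, hK⟩ := hf
  obtain ⟨M, hM⟩ := (isCompact_Icc (a := -K) (b := K)).exists_bound_of_continuousOn hu.continuousOn
  exact ⟨M, fun ε hε t ht => hM _ (abs_le.1 (hK ε hε t ht))⟩

end UnifBdd

namespace UnifO

lemma congr (hf : UnifO ε₀ T k f) (h : ∀ ε ∈ Ioo 0 ε₀, ∀ t ∈ Icc 0 T, g ε t = f ε t) :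
    UnifO ε₀ T k g := by
  obtain ⟨K, hK⟩ := hf
  exact ⟨K, fun ε hε t ht => by rw [h ε hε t ht]; exact hK ε hε t ht⟩

lemma of_eq_mul (hg : UnifBdd ε₀ T g)
    (h : ∀ ε ∈ Ioo 0 ε₀, ∀ t ∈ Icc 0 T, f ε t = ε ^ k * g ε t) : UnifO ε₀ T k f := by
  obtain ⟨K, hK⟩ := hg
  refine ⟨K, fun ε hε t ht => ?_⟩
  have : 0 < ε := hε.1
  rw [h ε hε t ht, abs_mul, abs_of_pos (by positivity), mul_comm]
  exact mul_le_mul_of_nonneg_right (hK ε hε t ht) (by positivity)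

/-- Turns an estimate into an exact identity with a bounded factor, so that later expansions become
polynomial identities suited to `linear_combination`. -/
lemma exists_eq_mul (hf : UnifO ε₀ T k f) :
    ∃ g, UnifBdd ε₀ T g ∧ ∀ ε ∈ Ioo 0 ε₀, ∀ t ∈ Icc 0 T, f ε t = ε ^ k * g ε t := by
  obtain ⟨K, hK⟩ := hf
  refine ⟨fun ε t => f ε t / ε ^ k, ⟨K, fun ε hε t ht => ?_⟩, fun ε hε t ht => ?_⟩
  · have : 0 < ε := hε.1
    rw [abs_div, abs_of_pos (by positivity : 0 < ε ^ k), div_le_iff₀ (by positivity)]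
    exact hK ε hε t ht
  · have : ε ≠ 0 := hε.1.ne'
    field_simp

lemma add (hf : UnifO ε₀ T k f) (hg : UnifO ε₀ T k g) :
    UnifO ε₀ T k (fun ε t => f ε t + g ε t) := by
  obtain ⟨K, hK⟩ := hf
  obtain ⟨M, hM⟩ := hg
  exact ⟨K + M, fun ε hε t ht => by
    rw [add_mul]
    exact (abs_add_le _ _).trans (add_le_add (hK ε hε t ht) (hM ε hε t ht))⟩

lemma bdd_mul (hf : UnifBdd ε₀ T f) (hg : UnifO ε₀ T k g) :
    UnifO ε₀ T k (fun ε t => f ε t * g ε t) := by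
  obtain ⟨u, hu, h⟩ := hg.exists_eq_mul
  exact of_eq_mul (hf.mul hu) fun ε hε t ht => by rw [h ε hε t ht]; ring

lemma neg (hf : UnifO ε₀ T k f) : UnifO ε₀ T k (fun ε t => -f ε t) := by
  simpa using bdd_mul (UnifBdd.const (-1)) hf

lemma sub (hf : UnifO ε₀ T k f) (hg : UnifO ε₀ T k g) :
    UnifO ε₀ T k (fun ε t => f ε t - g ε t) := by
  simpa only [sub_eq_add_neg] using hf.add hg.neg

lemma eps_mul (j : ℕ) (hg : UnifO ε₀ T k g) :
    UnifO ε₀ T (j + k) (fun ε t => ε ^ j * g ε t) := by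
  obtain ⟨u, hu, h⟩ := hg.exists_eq_mul
  exact of_eq_mul hu fun ε hε t ht => by rw [h ε hε t ht]; ring

end UnifO

/-! ### Forcing terms that integrate to a small quantity -/

/-- `f` is, up to `O(ε ^ k)`, the time derivative of a quantity of size `O(ε ^ k)`. -/
def AvgO (ε₀ T : ℝ) (k : ℕ) (f : ℝ → ℝ → ℝ) : Prop :=
  ∃ H h : ℝ → ℝ → ℝ, UnifO ε₀ T k H ∧
    (∀ ε ∈ Ioo 0 ε₀, ∀ t ∈ Icc 0 T, HasDerivWithinAt (H ε) (h ε t) (Icc 0 T) t) ∧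
    UnifO ε₀ T k (fun ε t => f ε t - h ε t)

namespace AvgO

lemma congr (hf : AvgO ε₀ T k f) (h : ∀ ε ∈ Ioo 0 ε₀, ∀ t ∈ Icc 0 T, g ε t = f ε t) :
    AvgO ε₀ T k g := by
  obtain ⟨H, h', h1, h2, h3⟩ := hf
  exact ⟨H, h', h1, h2, h3.congr fun ε hε t ht => by rw [h ε hε t ht]⟩

lemma of_unifO (hf : UnifO ε₀ T k f) : AvgO ε₀ T k f :=
  ⟨fun _ _ => 0, fun _ _ => 0, ⟨0, by simp⟩, fun _ _ _ _ => hasDerivWithinAt_const _ _ _,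
    by simpa using hf⟩

lemma add (hf : AvgO ε₀ T k f) (hg : AvgO ε₀ T k g) :
    AvgO ε₀ T k (fun ε t => f ε t + g ε t) := by
  obtain ⟨F, f', h1, h2, h3⟩ := hf
  obtain ⟨G, g', k1, k2, k3⟩ := hg
  refine ⟨fun ε t => F ε t + G ε t, fun ε t => f' ε t + g' ε t, h1.add k1,
    fun ε hε t ht => (h2 ε hε t ht).add (k2 ε hε t ht), (h3.add k3).congr fun ε hε t ht => ?_⟩
  ring

lemma eps_mul (j : ℕ) (hf : AvgO ε₀ T k f) :
    AvgO ε₀ T (j + k) (fun ε t => ε ^ j * f ε t) := by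
  obtain ⟨F, f', h1, h2, h3⟩ := hf
  refine ⟨fun ε t => ε ^ j * F ε t, fun ε t => ε ^ j * f' ε t, h1.eps_mul j,
    fun ε hε t ht => (h2 ε hε t ht).const_mul _, (h3.eps_mul j).congr fun ε hε t ht => ?_⟩
  ring

end AvgO

/-! ### Grönwall estimates for planar linear systems -/

/-- Grönwall's inequality for a pair of functions on `[0, T]`, with constants depending only on
the Lipschitz constant and on `T`. -/
lemma abs_le_of_planar_deriv_le {T K δ : ℝ} (hK : 0 < K) {u v u' v' : ℝ → ℝ}
    (hu : ∀ t ∈ Icc 0 T, HasDerivWithinAt u (u' t) (Icc 0 T) t)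
    (hv : ∀ t ∈ Icc 0 T, HasDerivWithinAt v (v' t) (Icc 0 T) t)
    (hu0 : |u 0| ≤ δ) (hv0 : |v 0| ≤ δ)
    (hu' : ∀ t ∈ Icc 0 T, |u' t| ≤ K * (|u t| + |v t|) + δ)
    (hv' : ∀ t ∈ Icc 0 T, |v' t| ≤ K * (|u t| + |v t|) + δ) :
    ∀ t ∈ Icc 0 T, |u t| ≤ (1 + 1 / (2 * K)) * Real.exp (2 * K * T) * δ ∧
      |v t| ≤ (1 + 1 / (2 * K)) * Real.exp (2 * K * T) * δ := by
  intro t ht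
  have hδ : 0 ≤ δ := (abs_nonneg _).trans hu0
  -- The product carries the sup norm, and `|u| + |v| ≤ 2 max |u| |v|`; hence the constant `2 * K`.
  -- The single `δ` bounds both the initial data and the forcing.
  have key := norm_le_gronwallBound_of_norm_deriv_right_le (f := fun s => (u s, v s))
    (f' := fun s => (u' s, v' s)) (δ := δ) (K := 2 * K) (ε := δ) (a := 0) (b := T)
    (fun s hs => ((hu s hs).continuousWithinAt.prodMk (hv s hs).continuousWithinAt))
    (fun s hs => ?_) ?_ ?_ t ht
  · rw [gronwallBound_of_K_ne_0 (by positivity), sub_zero, Prod.norm_def, max_le_iff,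
      Real.norm_eq_abs, Real.norm_eq_abs] at key
    have he : Real.exp (2 * K * t) ≤ Real.exp (2 * K * T) := by
      gcongr
      exact ht.2
    have hb : δ * Real.exp (2 * K * t) + δ / (2 * K) * (Real.exp (2 * K * t) - 1) ≤
        (1 + 1 / (2 * K)) * Real.exp (2 * K * T) * δ := by
      have h1 : δ / (2 * K) * (Real.exp (2 * K * t) - 1) ≤
          δ / (2 * K) * Real.exp (2 * K * T) := by
        gcongr
        linarith
      have h2 : δ * Real.exp (2 * K * t) ≤ δ * Real.exp (2 * K * T) := by gcongr
      calc _ ≤ δ * Real.exp (2 * K * T) + δ / (2 * K) * Real.exp (2 * K * T) := add_le_add h2 h1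
        _ = _ := by ring
    exact ⟨key.1.trans hb, key.2.trans hb⟩
  · have hn : Icc 0 T ∈ 𝓝[≥] s := by
      filter_upwards [Ico_mem_nhdsGE hs.2] with x hx using ⟨hs.1.trans hx.1, hx.2.le⟩
    exact ((hu s (Ico_subset_Icc_self hs)).prodMk (hv s (Ico_subset_Icc_self hs))).mono_of_mem_nhdsWithin hn
  · simpa [Prod.norm_def] using ⟨hu0, hv0⟩
  · intro s hs
    have hs := Ico_subset_Icc_self hs
    have h1 : |u s| ≤ max |u s| |v s| := le_max_left _ _
    have h2 : |v s| ≤ max |u s| |v s| := le_max_right _ _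
    have h3 : K * (|u s| + |v s|) ≤ 2 * K * max |u s| |v s| := by nlinarith
    simp only [Prod.norm_def, Real.norm_eq_abs]
    exact max_le ((hu' s hs).trans (by linarith)) ((hv' s hs).trans (by linarith))

/-- A planar linear system with bounded coefficients, zero initial data and forcing which
averages to `O(ε ^ k)` has solutions of size `O(ε ^ k)`. -/
lemma unifO_of_planar_linear {u v u' v' c₁ c₂ c₃ c₄ : ℝ → ℝ → ℝ} (hT : 0 ≤ T)
    (hu : ∀ ε ∈ Ioo 0 ε₀, ∀ t ∈ Icc 0 T, HasDerivWithinAt (u ε) (u' ε t) (Icc 0 T) t)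
    (hv : ∀ ε ∈ Ioo 0 ε₀, ∀ t ∈ Icc 0 T, HasDerivWithinAt (v ε) (v' ε t) (Icc 0 T) t)
    (hu0 : ∀ ε ∈ Ioo 0 ε₀, u ε 0 = 0) (hv0 : ∀ ε ∈ Ioo 0 ε₀, v ε 0 = 0)
    (h₁ : UnifBdd ε₀ T c₁) (h₂ : UnifBdd ε₀ T c₂) (h₃ : UnifBdd ε₀ T c₃) (h₄ : UnifBdd ε₀ T c₄)
    (hu' : AvgO ε₀ T k (fun ε t => u' ε t - c₁ ε t * u ε t - c₂ ε t * v ε t))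
    (hv' : AvgO ε₀ T k (fun ε t => v' ε t - c₃ ε t * u ε t - c₄ ε t * v ε t)) :
    UnifO ε₀ T k u ∧ UnifO ε₀ T k v := by
  obtain ⟨F, f, ⟨KF, hF⟩, hFd, ⟨Kf, hf⟩⟩ := hu'
  obtain ⟨G, g, ⟨KG, hG⟩, hGd, ⟨Kg, hg⟩⟩ := hv'
  obtain ⟨K1, p1, h₁⟩ := h₁.exists_pos
  obtain ⟨K2, p2, h₂⟩ := h₂.exists_pos
  obtain ⟨K3, p3, h₃⟩ := h₃.exists_pos
  obtain ⟨K4, p4, h₄⟩ := h₄.exists_pos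
  set K := K1 + K2 + K3 + K4 with hKdef
  have hK : 0 < K := by positivity
  -- Grönwall is applied to `u - F` and `v - G`, whose forcing is no longer oscillatory. In `D`, the
  -- first term pays for replacing `u`, `v` by these differences in the linear part, `|Kf| + |Kg|`
  -- for the remainders, and `|KF| + |KG|` for the initial values `-F ε 0`, `-G ε 0`.
  set D := K * (|KF| + |KG|) + |Kf| + |Kg| + |KF| + |KG| with hD
  have main : ∀ ε ∈ Ioo 0 ε₀, ∀ t ∈ Icc 0 T,
      |u ε t - F ε t| ≤ (1 + 1 / (2 * K)) * Real.exp (2 * K * T) * (D * ε ^ k) ∧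
      |v ε t - G ε t| ≤ (1 + 1 / (2 * K)) * Real.exp (2 * K * T) * (D * ε ^ k) := by
    intro ε hε
    have hεk : 0 < ε ^ k := pow_pos hε.1 k
    have bF : ∀ t ∈ Icc 0 T, |F ε t| ≤ |KF| * ε ^ k := fun t ht =>
      (hF ε hε t ht).trans (by gcongr; exact le_abs_self _)
    have bG : ∀ t ∈ Icc 0 T, |G ε t| ≤ |KG| * ε ^ k := fun t ht =>
      (hG ε hε t ht).trans (by gcongr; exact le_abs_self _)
    have bf : ∀ t ∈ Icc 0 T, _ ≤ |Kf| * ε ^ k := fun t ht =>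
      (hf ε hε t ht).trans (by gcongr; exact le_abs_self _)
    have bg : ∀ t ∈ Icc 0 T, _ ≤ |Kg| * ε ^ k := fun t ht =>
      (hg ε hε t ht).trans (by gcongr; exact le_abs_self _)
    have h0 : (0 : ℝ) ∈ Icc 0 T := ⟨le_rfl, hT⟩
    have aux : ∀ a b x y X Y e M N : ℝ, |a| ≤ K → |b| ≤ K → |X| ≤ M → |Y| ≤ N →
        |a * x + b * y + e| ≤ K * (|x - X| + |y - Y|) + K * (M + N) + |e| := by
      intro a b x y X Y e M N ha hb hX hY
      have e1 : |x| ≤ |x - X| + M := by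
        have := abs_add_le (x - X) X
        rw [sub_add_cancel] at this; linarith
      have e2 : |y| ≤ |y - Y| + N := by
        have := abs_add_le (y - Y) Y
        rw [sub_add_cancel] at this; linarith
      calc |a * x + b * y + e| ≤ |a * x| + |b * y| + |e| := abs_add_three _ _ _
        _ ≤ K * (|x - X| + M) + K * (|y - Y| + N) + |e| := by
          rw [abs_mul, abs_mul]; gcongr
        _ = _ := by ring
    have hle : K * (|KF| * ε ^ k + |KG| * ε ^ k) + (|Kf| + |Kg| + |KF| + |KG|) * ε ^ k
        = D * ε ^ k := by rw [hD]; ring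
    have q1 : 0 ≤ K * (|KF| * ε ^ k + |KG| * ε ^ k) := by positivity
    have n1 : 0 ≤ |Kf| * ε ^ k := by positivity
    have n2 : 0 ≤ |Kg| * ε ^ k := by positivity
    have n3 : 0 ≤ |KF| * ε ^ k := by positivity
    have n4 : 0 ≤ |KG| * ε ^ k := by positivity
    refine abs_le_of_planar_deriv_le hK (u' := fun t => u' ε t - f ε t)
      (v' := fun t => v' ε t - g ε t)
      (fun t ht => (hu ε hε t ht).sub (hFd ε hε t ht))
      (fun t ht => (hv ε hε t ht).sub (hGd ε hε t ht)) ?_ ?_ ?_ ?_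
    · rw [hu0 ε hε, zero_sub, abs_neg]
      linarith [bF 0 h0]
    · rw [hv0 ε hε, zero_sub, abs_neg]
      linarith [bG 0 h0]
    · intro t ht
      have := aux (c₁ ε t) (c₂ ε t) (u ε t) (v ε t) (F ε t) (G ε t)
        (u' ε t - c₁ ε t * u ε t - c₂ ε t * v ε t - f ε t) _ _
        ((h₁ ε hε t ht).trans (by linarith)) ((h₂ ε hε t ht).trans (by linarith)) (bF t ht) (bG t ht)
      rw [show u' ε t - f ε t = c₁ ε t * u ε t + c₂ ε t * v ε t +
        (u' ε t - c₁ ε t * u ε t - c₂ ε t * v ε t - f ε t) by ring]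
      linarith [bf t ht]
    · intro t ht
      have := aux (c₃ ε t) (c₄ ε t) (u ε t) (v ε t) (F ε t) (G ε t)
        (v' ε t - c₃ ε t * u ε t - c₄ ε t * v ε t - g ε t) _ _
        ((h₃ ε hε t ht).trans (by linarith)) ((h₄ ε hε t ht).trans (by linarith)) (bF t ht) (bG t ht)
      rw [show v' ε t - g ε t = c₃ ε t * u ε t + c₄ ε t * v ε t +
        (v' ε t - c₃ ε t * u ε t - c₄ ε t * v ε t - g ε t) by ring]
      linarith [bg t ht]
  have hu : UnifO ε₀ T k (fun ε t => u ε t - F ε t) :=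
    ⟨(1 + 1 / (2 * K)) * Real.exp (2 * K * T) * D, fun ε hε t ht =>
      ((main ε hε t ht).1).trans_eq (by ring)⟩
  have hv : UnifO ε₀ T k (fun ε t => v ε t - G ε t) :=
    ⟨(1 + 1 / (2 * K)) * Real.exp (2 * K * T) * D, fun ε hε t ht =>
      ((main ε hε t ht).2).trans_eq (by ring)⟩
  exact ⟨(hu.add ⟨KF, hF⟩).congr fun _ _ _ _ => by ring,
    (hv.add ⟨KG, hG⟩).congr fun _ _ _ _ => by ring⟩

/-- Integration of a forcing which averages to `O(ε ^ k)`. -/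
lemma unifO_of_deriv_avgO {u u' : ℝ → ℝ → ℝ} (hT : 0 ≤ T)
    (hu : ∀ ε ∈ Ioo 0 ε₀, ∀ t ∈ Icc 0 T, HasDerivWithinAt (u ε) (u' ε t) (Icc 0 T) t)
    (hu0 : ∀ ε ∈ Ioo 0 ε₀, u ε 0 = 0) (hu' : AvgO ε₀ T k u') : UnifO ε₀ T k u := by
  have h0 : UnifBdd ε₀ T (fun _ _ => 0) := UnifBdd.const 0
  exact (unifO_of_planar_linear hT hu hu hu0 hu0 h0 h0 h0 h0 (by simpa using hu')
    (by simpa using hu')).1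

/-! ### Composition with smooth functions -/

/-- Lipschitz estimate in quotient form. -/
lemma UnifBdd.exists_sub_eq_mul {u : ℝ → ℝ} (hu : ContDiff ℝ 1 u) (hf : UnifBdd ε₀ T f)
    (hg : UnifBdd ε₀ T g) :
    ∃ q, UnifBdd ε₀ T q ∧ ∀ ε t, u (f ε t) - u (g ε t) = q ε t * (f ε t - g ε t) := by
  obtain ⟨K, -, hK⟩ := hf.exists_pos
  obtain ⟨M, -, hM⟩ := hg.exists_pos
  obtain ⟨B, hB⟩ := (isCompact_Icc (a := -max K M) (b := max K M)).exists_bound_of_continuousOn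
    (hu.continuous_deriv le_rfl).continuousOn
  -- Where `f ε t = g ε t` the quotient is `0` by convention and both sides of the identity vanish.
  refine ⟨fun ε t => (u (f ε t) - u (g ε t)) / (f ε t - g ε t), ⟨B, fun ε hε t ht => ?_⟩,
    fun ε t => ?_⟩
  · have h1 : f ε t ∈ Icc (-max K M) (max K M) := by
      have := abs_le.1 ((hK ε hε t ht).trans (le_max_left K M)); exact this
    have h2 : g ε t ∈ Icc (-max K M) (max K M) := by
      have := abs_le.1 ((hM ε hε t ht).trans (le_max_right K M)); exact this
    have hB0 : 0 ≤ B := (norm_nonneg _).trans (hB _ h1)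
    have := (convex_Icc (-max K M) (max K M)).norm_image_sub_le_of_norm_deriv_le
      (fun x _ => (hu.differentiable one_ne_zero) x) hB h2 h1
    rw [abs_div]
    exact div_le_of_le_mul₀ (abs_nonneg _) hB0 this
  · rcases eq_or_ne (f ε t) (g ε t) with h | h
    · simp [h]
    · have := sub_ne_zero.2 h
      field_simp

/-- First-order Taylor estimate in quotient form. -/
lemma UnifBdd.exists_taylor {u : ℝ → ℝ} (hu : ContDiff ℝ 2 u) (hf : UnifBdd ε₀ T f)
    (hg : UnifBdd ε₀ T g) :
    ∃ q, UnifBdd ε₀ T q ∧ ∀ ε t, u (f ε t) - u (g ε t) =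
      deriv u (g ε t) * (f ε t - g ε t) + q ε t * (f ε t - g ε t) ^ 2 := by
  obtain ⟨K, -, hK⟩ := hf.exists_pos
  obtain ⟨M, -, hM⟩ := hg.exists_pos
  have hu1 : ContDiff ℝ 1 (deriv u) := (contDiff_succ_iff_deriv.1 hu).2.2
  obtain ⟨B, hB⟩ := (isCompact_Icc (a := -max K M) (b := max K M)).exists_bound_of_continuousOn
    (hu1.continuous_deriv le_rfl).continuousOn
  refine ⟨fun ε t => (u (f ε t) - u (g ε t) - deriv u (g ε t) * (f ε t - g ε t))
    / (f ε t - g ε t) ^ 2, ⟨B, fun ε hε t ht => ?_⟩, fun ε t => ?_⟩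
  · set x := f ε t
    set y := g ε t
    have h1 : x ∈ Icc (-max K M) (max K M) := by
      have := abs_le.1 ((hK ε hε t ht).trans (le_max_left K M)); exact this
    have h2 : y ∈ Icc (-max K M) (max K M) := by
      have := abs_le.1 ((hM ε hε t ht).trans (le_max_right K M)); exact this
    have hB0 : 0 ≤ B := (norm_nonneg _).trans (hB _ h1)
    have hsub : uIcc y x ⊆ Icc (-max K M) (max K M) := uIcc_subset_Icc h2 h1
    have hd : ∀ s ∈ uIcc y x, ‖deriv u s - deriv u y‖ ≤ B * |x - y| := fun s hs => by
      have := (convex_Icc (-max K M) (max K M)).norm_image_sub_le_of_norm_deriv_le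
        (fun z _ => (hu1.differentiable one_ne_zero) z) hB h2 (hsub hs)
      refine this.trans ?_
      gcongr
      exact abs_sub_left_of_mem_uIcc hs
    -- The mean value inequality is applied to `u` minus its linear part at `y`, whose derivative on
    -- the segment is at most `B * |x - y|`.
    have hder : ∀ s ∈ uIcc y x, HasDerivWithinAt (fun s => u s - deriv u y * s)
        (deriv u s - deriv u y) (uIcc y x) s := fun s _ => by
      refine HasDerivAt.hasDerivWithinAt ?_
      convert! ((hu.differentiable two_ne_zero) s).hasDerivAt.sub
        ((hasDerivAt_id s).const_mul (deriv u y)) using 1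
      rw [mul_one]
    have key := (convex_uIcc y x).norm_image_sub_le_of_norm_hasDerivWithin_le hder hd
      left_mem_uIcc right_mem_uIcc
    rw [abs_div, abs_of_nonneg (sq_nonneg (x - y))]
    refine div_le_of_le_mul₀ (sq_nonneg _) hB0 ?_
    have e : u x - u y - deriv u y * (x - y) = u x - deriv u y * x - (u y - deriv u y * y) := by
      ring
    rw [e]
    refine key.trans_eq ?_
    rw [Real.norm_eq_abs, mul_assoc, ← sq, sq_abs]
  · rcases eq_or_ne (f ε t) (g ε t) with h | h
    · simp [h]
    · have := sub_ne_zero.2 h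
      field_simp
      ring

end FastSlow

namespace FastSlow

variable {ε₀ T : ℝ}

/-! ### Global solvability of planar linear systems -/

/-- Clamping the unknowns to `[-R, R]` makes a linear vector field bounded, so that one application
of Picard–Lindelöf covers the whole of `[0, T]`. -/
lemma abs_clamp_le {R : ℝ} (hR : 0 ≤ R) (x : ℝ) : |max (-R) (min x R)| ≤ |x| := by
  rcases le_total x R with h | h <;> rcases le_total (-R) x with h' | h' <;>
    simp only [h, h', min_eq_left, min_eq_right, max_eq_left, max_eq_right] <;>
    grind

lemma abs_clamp_le_radius {R : ℝ} (hR : 0 ≤ R) (x : ℝ) : |max (-R) (min x R)| ≤ R :=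
  abs_le.2 ⟨le_max_left _ _, max_le (by linarith) (min_le_right _ _)⟩

lemma abs_clamp_sub_clamp_le (R x y : ℝ) :
    |max (-R) (min x R) - max (-R) (min y R)| ≤ |x - y| := by
  refine (abs_max_sub_max_le_max _ _ _ _).trans ?_
  rw [sub_self, abs_zero, max_eq_right (abs_nonneg _)]
  refine (abs_min_sub_min_le_max _ _ _ _).trans ?_
  rw [sub_self, abs_zero, max_eq_left (abs_nonneg _)]

/-- A planar linear system with continuous coefficients on `[0, T]` is globally solvable. -/
lemma exists_planar_linear_solution (hT : 0 ≤ T) {c₁ c₂ c₃ c₄ f₁ f₂ : ℝ → ℝ}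
    (h₁ : ContinuousOn c₁ (Icc 0 T)) (h₂ : ContinuousOn c₂ (Icc 0 T))
    (h₃ : ContinuousOn c₃ (Icc 0 T)) (h₄ : ContinuousOn c₄ (Icc 0 T))
    (hf₁ : ContinuousOn f₁ (Icc 0 T)) (hf₂ : ContinuousOn f₂ (Icc 0 T)) (x₀ y₀ : ℝ) :
    ∃ x y : ℝ → ℝ, x 0 = x₀ ∧ y 0 = y₀ ∧
      (∀ t ∈ Icc 0 T, HasDerivWithinAt x (c₁ t * x t + c₂ t * y t + f₁ t) (Icc 0 T) t) ∧
      (∀ t ∈ Icc 0 T, HasDerivWithinAt y (c₃ t * x t + c₄ t * y t + f₂ t) (Icc 0 T) t) := by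
  have bd : ∀ {u : ℝ → ℝ}, ContinuousOn u (Icc 0 T) → ∃ K > 0, ∀ t ∈ Icc 0 T, |u t| ≤ K := by
    intro u hu
    obtain ⟨K, hK⟩ := isCompact_Icc.exists_bound_of_continuousOn hu
    exact ⟨max K 1, by positivity, fun t ht => (hK t ht).trans (le_max_left _ _)⟩
  obtain ⟨K1, p1, b1⟩ := bd h₁
  obtain ⟨K2, p2, b2⟩ := bd h₂
  obtain ⟨K3, p3, b3⟩ := bd h₃
  obtain ⟨K4, p4, b4⟩ := bd h₄
  obtain ⟨F1, q1, g1⟩ := bd hf₁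
  obtain ⟨F2, q2, g2⟩ := bd hf₂
  set K := K1 + K2 + K3 + K4 with hKdef
  have hK : 0 < K := by positivity
  set δ := F1 + F2 + |x₀| + |y₀| with hδdef
  -- `R` is the a priori Grönwall bound for the unclamped system, so the clamp will turn out to be
  -- inactive.
  set R := (1 + 1 / (2 * K)) * Real.exp (2 * K * T) * δ with hRdef
  have hR : 0 ≤ R := by positivity
  set cl : ℝ → ℝ := fun x => max (-R) (min x R) with hcl
  set V : ℝ → ℝ × ℝ → ℝ × ℝ := fun t z =>
    (c₁ t * cl z.1 + c₂ t * cl z.2 + f₁ t, c₃ t * cl z.1 + c₄ t * cl z.2 + f₂ t) with hV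
  have aux : ∀ a b x y e, |a| ≤ K → |b| ≤ K →
      |a * x + b * y + e| ≤ K * (|x| + |y|) + |e| := by
    intro a b x y e ha hb
    calc |a * x + b * y + e| ≤ |a * x| + |b * y| + |e| := abs_add_three _ _ _
      _ ≤ K * |x| + K * |y| + |e| := by rw [abs_mul, abs_mul]; gcongr
      _ = _ := by ring
  -- The clamped field is bounded by `2 * K * R + δ`; with this speed a solution stays for time `T`
  -- in the ball of radius `(2 * K * R + δ) * T`.
  have hPL : IsPicardLindelof V (tmin := 0) (tmax := T) ⟨0, le_rfl, hT⟩ (x₀, y₀)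
      (Real.toNNReal ((2 * K * R + δ) * T)) 0 (Real.toNNReal (2 * K * R + δ))
      (Real.toNNReal (2 * K)) := by
    constructor
    · intro t ht
      refine (LipschitzWith.of_dist_le_mul fun z w => ?_).lipschitzOnWith
      rw [Real.coe_toNNReal _ (by positivity)]
      have e1 : |cl z.1 - cl w.1| ≤ dist z w :=
        (abs_clamp_sub_clamp_le R _ _).trans (le_max_left _ _)
      have e2 : |cl z.2 - cl w.2| ≤ dist z w :=
        (abs_clamp_sub_clamp_le R _ _).trans (le_max_right _ _)
      rw [Prod.dist_eq (x := V t z)]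
      refine max_le ?_ ?_
      · have := aux (c₁ t) (c₂ t) (cl z.1 - cl w.1) (cl z.2 - cl w.2) 0
          ((b1 t ht).trans (by linarith)) ((b2 t ht).trans (by linarith))
        rw [abs_zero] at this
        rw [Real.dist_eq]
        simp only [hV]
        rw [show c₁ t * cl z.1 + c₂ t * cl z.2 + f₁ t - (c₁ t * cl w.1 + c₂ t * cl w.2 + f₁ t)
          = c₁ t * (cl z.1 - cl w.1) + c₂ t * (cl z.2 - cl w.2) + 0 by ring]
        nlinarith
      · have := aux (c₃ t) (c₄ t) (cl z.1 - cl w.1) (cl z.2 - cl w.2) 0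
          ((b3 t ht).trans (by linarith)) ((b4 t ht).trans (by linarith))
        rw [abs_zero] at this
        rw [Real.dist_eq]
        simp only [hV]
        rw [show c₃ t * cl z.1 + c₄ t * cl z.2 + f₂ t - (c₃ t * cl w.1 + c₄ t * cl w.2 + f₂ t)
          = c₃ t * (cl z.1 - cl w.1) + c₄ t * (cl z.2 - cl w.2) + 0 by ring]
        nlinarith
    · intro z _
      simp only [hV]
      fun_prop
    · intro t ht z _
      rw [Real.coe_toNNReal _ (by positivity), Prod.norm_def, Real.norm_eq_abs, Real.norm_eq_abs]
      have e1 := abs_clamp_le_radius hR z.1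
      have e2 := abs_clamp_le_radius hR z.2
      have n1 := abs_nonneg x₀
      have n2 := abs_nonneg y₀
      refine max_le ?_ ?_
      · have := aux (c₁ t) (c₂ t) (cl z.1) (cl z.2) (f₁ t)
          ((b1 t ht).trans (by linarith)) ((b2 t ht).trans (by linarith))
        nlinarith [g1 t ht]
      · have := aux (c₃ t) (c₄ t) (cl z.1) (cl z.2) (f₂ t)
          ((b3 t ht).trans (by linarith)) ((b4 t ht).trans (by linarith))
        nlinarith [g2 t ht]
    · rw [Real.coe_toNNReal _ (by positivity), Real.coe_toNNReal _ (by positivity)]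
      simp [hT]
  obtain ⟨α, hα0, hα⟩ := hPL.exists_eq_forall_mem_Icc_hasDerivWithinAt₀
  have hx : ∀ t ∈ Icc 0 T, HasDerivWithinAt (fun t => (α t).1) (V t (α t)).1 (Icc 0 T) t :=
    fun t ht => (hα t ht).fst
  have hy : ∀ t ∈ Icc 0 T, HasDerivWithinAt (fun t => (α t).2) (V t (α t)).2 (Icc 0 T) t :=
    fun t ht => (hα t ht).snd
  have n1 := abs_nonneg x₀
  have n2 := abs_nonneg y₀
  have hα0 : α 0 = (x₀, y₀) := hα0
  -- Clamping does not increase absolute values, so the clamped solution satisfies the same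
  -- differential inequality and never exceeds `R`.
  have key := abs_le_of_planar_deriv_le (δ := δ) hK hx hy
    (by simp only [hα0]; linarith) (by simp only [hα0]; linarith)
    (fun t ht => by
      have := aux (c₁ t) (c₂ t) (cl (α t).1) (cl (α t).2) (f₁ t)
          ((b1 t ht).trans (by linarith)) ((b2 t ht).trans (by linarith))
      simp only [hV]
      have e1 := abs_clamp_le hR (α t).1
      have e2 := abs_clamp_le hR (α t).2
      nlinarith [g1 t ht])
    (fun t ht => by
      have := aux (c₃ t) (c₄ t) (cl (α t).1) (cl (α t).2) (f₂ t)
          ((b3 t ht).trans (by linarith)) ((b4 t ht).trans (by linarith))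
      simp only [hV]
      have e1 := abs_clamp_le hR (α t).1
      have e2 := abs_clamp_le hR (α t).2
      nlinarith [g2 t ht])
  have hcl_eq : ∀ s, |s| ≤ R → cl s = s := fun s hs => by
    have := abs_le.1 hs
    simp only [hcl]
    rw [min_eq_left this.2, max_eq_right this.1]
  refine ⟨fun t => (α t).1, fun t => (α t).2, by simp only [hα0], by simp only [hα0],
    fun t ht => ?_,
    fun t ht => ?_⟩
  · have := hx t ht
    simp only [hV] at this
    rwa [hcl_eq _ (key t ht).1, hcl_eq _ (key t ht).2] at this
  · have := hy t ht
    simp only [hV] at this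
    rwa [hcl_eq _ (key t ht).1, hcl_eq _ (key t ht).2] at this

/-- A continuous function on `[0, T]` has a primitive with prescribed initial value. -/
lemma exists_primitive (hT : 0 ≤ T) {f : ℝ → ℝ} (hf : ContinuousOn f (Icc 0 T)) (x₀ : ℝ) :
    ∃ x : ℝ → ℝ, x 0 = x₀ ∧ ∀ t ∈ Icc 0 T, HasDerivWithinAt x (f t) (Icc 0 T) t := by
  have h0 : ContinuousOn (fun _ : ℝ => (0 : ℝ)) (Icc 0 T) := continuousOn_const
  obtain ⟨x, _, hx0, -, hx, -⟩ := exists_planar_linear_solution hT h0 h0 h0 h0 hf h0 x₀ 0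
  exact ⟨x, hx0, fun t ht => by simpa using hx t ht⟩

/-- Two functions on `[0, T]` with the same derivative and the same initial value agree. -/
lemma eqOn_of_deriv_eq {f g f' : ℝ → ℝ}
    (hf : ∀ t ∈ Icc 0 T, HasDerivWithinAt f (f' t) (Icc 0 T) t)
    (hg : ∀ t ∈ Icc 0 T, HasDerivWithinAt g (f' t) (Icc 0 T) t) (h0 : f 0 = g 0) :
    EqOn f g (Icc 0 T) := by
  intro t ht
  have hd : ∀ t ∈ Icc 0 T, HasDerivWithinAt (fun t => f t - g t) 0 (Icc 0 T) t := fun t ht => by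
    have := (hf t ht).sub (hg t ht)
    rw [sub_self] at this
    exact this
  have := (abs_le_of_planar_deriv_le (δ := 0) one_pos hd hd (by simp [h0]) (by simp [h0])
    (fun t _ => by simp) (fun t _ => by simp) t ht).1
  rw [mul_zero, abs_nonpos_iff, sub_eq_zero] at this
  exact this

/-! ### Convergence criteria -/

lemma ddt_eq (hT : 0 < T) {f : ℝ → ℝ} {f' t : ℝ} (ht : t ∈ Icc 0 T)
    (h : HasDerivWithinAt f f' (Icc 0 T) t) : ddt T f t = f' :=
  h.derivWithin (uniqueDiffOn_Icc hT t ht)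

lemma tendstoInC_of_unifO {u : ℝ → ℝ → ℝ} {v : ℝ → ℝ} (hε₀ : 0 < ε₀)
    (hu : ∀ ε ∈ Ioo 0 ε₀, ContinuousOn (u ε) (Icc 0 T)) (hv : ContinuousOn v (Icc 0 T))
    (huv : UnifO ε₀ T 1 (fun ε t => u ε t - v t)) : TendstoInC T ε₀ u v := by
  refine ⟨hu, hv, ?_⟩
  obtain ⟨K, hK⟩ := huv
  rw [Metric.tendstoUniformlyOn_iff]
  intro η hη
  have h1 : Tendsto (fun ε : ℝ => K * ε ^ 1) (𝓝[>] 0) (𝓝 0) := by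
    have : Continuous (fun ε : ℝ => K * ε ^ 1) := by fun_prop
    simpa using (this.tendsto 0).mono_left nhdsWithin_le_nhds
  filter_upwards [h1.eventually (gt_mem_nhds hη), Ioo_mem_nhdsGT hε₀] with ε h2 hε t ht
  rw [dist_comm, Real.dist_eq]
  exact (hK ε hε t ht).trans_lt h2

lemma memLp_top_ddt (hT : 0 < T) {u u' : ℝ → ℝ} {K : ℝ}
    (hu : ∀ t ∈ Icc 0 T, HasDerivWithinAt u (u' t) (Icc 0 T) t)
    (hK : ∀ t ∈ Icc 0 T, |u' t| ≤ K) :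
    MemLp (ddt T u) ⊤ (volume.restrict (Ioo 0 T)) := by
  have hm : AEStronglyMeasurable (ddt T u) (volume.restrict (Ioo 0 T)) := by
    -- In the open interval the derivative within `[0, T]` is `deriv u`, which is measurable for
    -- every `u`.
    refine (measurable_deriv u).aestronglyMeasurable.congr ?_
    filter_upwards [ae_restrict_mem measurableSet_Ioo] with t ht
    exact (derivWithin_of_mem_nhds (Icc_mem_nhds ht.1 ht.2)).symm
  refine memLp_top_of_bound hm K ?_
  filter_upwards [ae_restrict_mem measurableSet_Ioo] with t ht
  rw [ddt_eq hT (Ioo_subset_Icc_self ht) (hu t (Ioo_subset_Icc_self ht))]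
  exact hK t (Ioo_subset_Icc_self ht)

/-- Pairing a derivative with a `C¹` function, estimated by integration by parts. -/
lemma abs_integral_ddt_mul_le (hT : 0 < T) {w w' g : ℝ → ℝ} {K δ M M' : ℝ}
    (hw : ∀ t ∈ Icc 0 T, HasDerivWithinAt w (w' t) (Icc 0 T) t)
    (hK : ∀ t ∈ Icc 0 T, |w' t| ≤ K) (hδ : ∀ t ∈ Icc 0 T, |w t| ≤ δ)
    (hg : ContDiff ℝ 1 g) (hM : ∀ t ∈ Icc 0 T, |g t| ≤ M)
    (hM' : ∀ t ∈ Icc 0 T, |deriv g t| ≤ M') :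
    |∫ t in Ioo 0 T, ddt T w t * g t| ≤ (2 * M + T * M') * δ := by
  have h0 : (0 : ℝ) ∈ Icc 0 T := ⟨le_rfl, hT.le⟩
  have h1 : T ∈ Icc 0 T := ⟨hT.le, le_rfl⟩
  rw [← integral_Ioc_eq_integral_Ioo, ← intervalIntegral.integral_of_le hT.le]
  have hI : IntervalIntegrable (ddt T w) volume 0 T := by
    rw [intervalIntegrable_iff_integrableOn_Ioo_of_le hT.le]
    exact (memLp_top_ddt hT hw hK).integrable le_top
  have hw2 : ∀ t ∈ Icc 0 T, HasDerivWithinAt w (ddt T w t) (Icc 0 T) t := fun t ht => by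
    rw [ddt_eq hT ht (hw t ht)]; exact hw t ht
  have ibp := intervalIntegral.integral_mul_deriv_eq_deriv_mul_of_hasDerivWithinAt
    (a := 0) (b := T) (u := g) (u' := deriv g) (v := w) (v' := ddt T w)
    (fun t _ => ((hg.differentiable one_ne_zero) t).hasDerivAt.hasDerivWithinAt)
    (by rw [uIcc_of_le hT.le]; exact hw2)
    ((hg.continuous_deriv le_rfl).intervalIntegrable _ _) hI
  have e : ∫ t in (0 : ℝ)..T, ddt T w t * g t = ∫ t in (0 : ℝ)..T, g t * ddt T w t := by
    simp only [mul_comm]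
  rw [e, ibp]
  have e3 : ‖∫ t in (0 : ℝ)..T, deriv g t * w t‖ ≤ M' * δ * |T - 0| := by
    refine intervalIntegral.norm_integral_le_of_norm_le_const fun t ht => ?_
    rw [uIoc_of_le hT.le] at ht
    have ht := Ioc_subset_Icc_self ht
    rw [Real.norm_eq_abs, abs_mul]
    exact mul_le_mul (hM' t ht) (hδ t ht) (abs_nonneg _) ((abs_nonneg _).trans (hM' t ht))
  rw [sub_zero, abs_of_pos hT, Real.norm_eq_abs] at e3
  have e1 : |g T * w T| ≤ M * δ := by
    rw [abs_mul]
    exact mul_le_mul (hM T h1) (hδ T h1) (abs_nonneg _) ((abs_nonneg _).trans (hM T h1))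
  have e2 : |g 0 * w 0| ≤ M * δ := by
    rw [abs_mul]
    exact mul_le_mul (hM 0 h0) (hδ 0 h0) (abs_nonneg _) ((abs_nonneg _).trans (hM 0 h0))
  have e4 := abs_sub (g T * w T - g 0 * w 0) (∫ t in (0 : ℝ)..T, deriv g t * w t)
  have e5 := abs_sub (g T * w T) (g 0 * w 0)
  linarith

/-- Uniform convergence together with uniformly bounded derivatives gives weak* convergence of the
derivatives. -/
lemma derivTendstoWeakStar_of_unifO {u u' : ℝ → ℝ → ℝ} {v v' : ℝ → ℝ} (hT : 0 < T) (hε₀ : 0 < ε₀)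
    (hu : ∀ ε ∈ Ioo 0 ε₀, ∀ t ∈ Icc 0 T, HasDerivWithinAt (u ε) (u' ε t) (Icc 0 T) t)
    (hv : ∀ t ∈ Icc 0 T, HasDerivWithinAt v (v' t) (Icc 0 T) t)
    (hu' : UnifBdd ε₀ T u') (hv' : UnifBdd ε₀ T (fun _ t => v' t))
    (huv : UnifO ε₀ T 1 (fun ε t => u ε t - v t)) : DerivTendstoWeakStar T ε₀ u v := by
  obtain ⟨Ku, hKu0, hKu⟩ := hu'.exists_pos
  obtain ⟨Kv, hKv0, hKv⟩ := hv'.exists_pos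
  -- The bound does not involve `ε`; any admissible value extracts it.
  have hKv : ∀ t ∈ Icc 0 T, |v' t| ≤ Kv := hKv (ε₀ / 2) ⟨by linarith, by linarith⟩
  obtain ⟨D, hD⟩ := huv
  have mu : ∀ ε ∈ Ioo 0 ε₀, MemLp (ddt T (u ε)) ⊤ (volume.restrict (Ioo 0 T)) := fun ε hε =>
    memLp_top_ddt hT (hu ε hε) (hKu ε hε)
  have mv : MemLp (ddt T v) ⊤ (volume.restrict (Ioo 0 T)) := memLp_top_ddt hT hv hKv
  refine ⟨fun ε hε t ht => (hu ε hε t ht).differentiableWithinAt,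
    fun t ht => (hv t ht).differentiableWithinAt, mu, mv, fun h hh => ?_⟩
  rw [Metric.tendsto_nhds]
  intro η hη
  set K := Ku + Kv with hKdef
  have hK : 0 < K := by positivity
  have hη' : 0 < η / (2 * K) := by positivity
  -- The test function is replaced by a smooth `g`. The derivatives of `u ε - v` are bounded by `K`,
  -- so an `L¹` error of `η / (2 * K)` costs at most `η / 2`. Since `g` need not vanish at `0` and
  -- `T`, the integration by parts keeps boundary terms.
  obtain ⟨g, hgc, hgs, hgn⟩ := hh.exist_eLpNorm_sub_le ENNReal.one_ne_top le_rfl hη'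
  have hg1 : ContDiff ℝ 1 g := hgs.of_le (by exact_mod_cast le_top)
  obtain ⟨M, hM⟩ := (isCompact_Icc (a := (0 : ℝ)) (b := T)).exists_bound_of_continuousOn
    hgs.continuous.continuousOn
  obtain ⟨M', hM'⟩ := (isCompact_Icc (a := (0 : ℝ)) (b := T)).exists_bound_of_continuousOn
    (hg1.continuous_deriv le_rfl).continuousOn
  have hgL : MemLp g 1 (volume.restrict (Ioo 0 T)) := hgs.continuous.memLp_of_hasCompactSupport hgc
  have hlim : Tendsto (fun ε : ℝ => (2 * M + T * M') * (D * ε ^ 1)) (𝓝[>] 0) (𝓝 0) := by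
    have : Continuous (fun ε : ℝ => (2 * M + T * M') * (D * ε ^ 1)) := by fun_prop
    simpa using (this.tendsto 0).mono_left nhdsWithin_le_nhds
  filter_upwards [hlim.eventually (gt_mem_nhds (half_pos hη)), Ioo_mem_nhdsGT hε₀] with ε h2 hε
  have hw : ∀ t ∈ Icc 0 T, HasDerivWithinAt (fun t => u ε t - v t) (u' ε t - v' t) (Icc 0 T) t :=
    fun t ht => (hu ε hε t ht).sub (hv t ht)
  have hwK : ∀ t ∈ Icc 0 T, |u' ε t - v' t| ≤ K := fun t ht =>
    (abs_sub _ _).trans (add_le_add (hKu ε hε t ht) (hKv t ht))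
  have mw := memLp_top_ddt hT hw hwK
  have hwsub : ∀ t ∈ Icc 0 T, ddt T (fun t => u ε t - v t) t = ddt T (u ε) t - ddt T v t :=
    fun t ht => by
      rw [ddt_eq hT ht (hw t ht), ddt_eq hT ht (hu ε hε t ht), ddt_eq hT ht (hv t ht)]
  have Iu : Integrable (fun t => ddt T (u ε) t * h t) (volume.restrict (Ioo 0 T)) :=
    memLp_one_iff_integrable.1 (hh.mul (mu ε hε))
  have Iv : Integrable (fun t => ddt T v t * h t) (volume.restrict (Ioo 0 T)) :=
    memLp_one_iff_integrable.1 (hh.mul mv)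
  have Ig : Integrable (fun t => ddt T (fun t => u ε t - v t) t * g t)
      (volume.restrict (Ioo 0 T)) := memLp_one_iff_integrable.1 (hgL.mul mw)
  have Ihg : Integrable (fun t => ddt T (fun t => u ε t - v t) t * (h - g) t)
      (volume.restrict (Ioo 0 T)) := memLp_one_iff_integrable.1 ((hh.sub hgL).mul mw)
  have split : (∫ t in Ioo 0 T, ddt T (u ε) t * h t) - ∫ t in Ioo 0 T, ddt T v t * h t =
      (∫ t in Ioo 0 T, ddt T (fun t => u ε t - v t) t * g t) +
        ∫ t in Ioo 0 T, ddt T (fun t => u ε t - v t) t * (h - g) t := by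
    rw [← integral_sub Iu Iv, ← integral_add Ig Ihg]
    refine setIntegral_congr_fun measurableSet_Ioo fun t ht => ?_
    simp only [hwsub t (Ioo_subset_Icc_self ht), Pi.sub_apply]
    ring
  have b1 := abs_integral_ddt_mul_le hT hw hwK (fun t ht => hD ε hε t ht) hg1 hM hM'
  have b2 : |∫ t in Ioo 0 T, ddt T (fun t => u ε t - v t) t * (h - g) t| ≤ η / 2 := by
    have i1 : ∫ t in Ioo 0 T, ‖(h - g) t‖ ≤ η / (2 * K) := by
      have := (hh.sub hgL)
      rw [eLpNorm_one_eq_lintegral_enorm] at hgn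
      rw [integral_norm_eq_lintegral_enorm this.aestronglyMeasurable]
      exact ENNReal.toReal_le_of_le_ofReal hη'.le hgn
    have i2 : ‖∫ t in Ioo 0 T, ddt T (fun t => u ε t - v t) t * (h - g) t‖ ≤
        ∫ t in Ioo 0 T, K * ‖(h - g) t‖ := by
      refine norm_integral_le_of_norm_le
        ((memLp_one_iff_integrable.1 (hh.sub hgL)).norm.const_mul K) ?_
      filter_upwards [ae_restrict_mem measurableSet_Ioo] with t ht
      have ht := Ioo_subset_Icc_self ht
      rw [norm_mul, ddt_eq hT ht (hw t ht)]
      exact mul_le_mul_of_nonneg_right (hwK t ht) (norm_nonneg _)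
    rw [integral_const_mul] at i2
    rw [← Real.norm_eq_abs]
    refine i2.trans ((mul_le_mul_of_nonneg_left i1 hK.le).trans_eq ?_)
    field_simp
  rw [Real.dist_eq, split]
  exact (abs_add_le _ _).trans_lt (by linarith)

end FastSlow

namespace FastSlow

variable {ε₀ T : ℝ}

/-! ### The frequency and its logarithmic derivative -/

/-- `ω` is a smooth positive function and `a` is its logarithmic derivative. -/
structure IsFrequency (ω a : ℝ → ℝ) : Prop where
  pos : ∀ x, 0 < ω x
  contDiff : ContDiff ℝ (⊤ : ℕ∞) ω
  contDiff_log : ContDiff ℝ (⊤ : ℕ∞) a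
  deriv_eq : ∀ x, deriv ω x = ω x * a x

namespace IsFrequency

variable {ω a : ℝ → ℝ}

lemma of_contDiff (hω : ContDiff ℝ (⊤ : ℕ∞) ω) (hpos : ∀ x, 0 < ω x) :
    IsFrequency ω (deriv (logFreq ω)) := by
  have hL : ContDiff ℝ (⊤ : ℕ∞) (logFreq ω) := hω.log fun x => (hpos x).ne'
  refine ⟨hpos, hω, ?_, fun x => ?_⟩
  · exact (contDiff_infty_iff_deriv.1 hL).2
  · have h := ((hω.differentiable (by simp)) x).hasDerivAt.log (hpos x).ne'
    have h' : deriv (logFreq ω) x = deriv ω x / ω x := h.deriv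
    have := (hpos x).ne'
    rw [h']
    field_simp

lemma contDiff_deriv (h : IsFrequency ω a) : ContDiff ℝ (⊤ : ℕ∞) (deriv a) :=
  (contDiff_infty_iff_deriv.1 h.contDiff_log).2

lemma hasDerivAt (h : IsFrequency ω a) (x : ℝ) : HasDerivAt ω (ω x * a x) x := by
  rw [← h.deriv_eq]
  exact ((h.contDiff.differentiable (by simp)) x).hasDerivAt

lemma hasDerivAt_log (h : IsFrequency ω a) (x : ℝ) : HasDerivAt a (deriv a x) x :=
  ((h.contDiff_log.differentiable (by simp)) x).hasDerivAt

lemma hasDerivAt_inv (h : IsFrequency ω a) (x : ℝ) :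
    HasDerivAt (fun x => (ω x)⁻¹) (-(a x * (ω x)⁻¹)) x := by
  have hx := (h.pos x).ne'
  convert! (h.hasDerivAt x).inv hx using 1
  field_simp

lemma contDiff_inv (h : IsFrequency ω a) : ContDiff ℝ (⊤ : ℕ∞) (fun x => (ω x)⁻¹) :=
  h.contDiff.inv fun x => (h.pos x).ne'

lemma inv_mul (h : IsFrequency ω a) (x : ℝ) : (ω x)⁻¹ * ω x = 1 := inv_mul_cancel₀ (h.pos x).ne'

lemma deriv_deriv_eq (h : IsFrequency ω a) (x : ℝ) :
    deriv (deriv ω) x = ω x * (deriv a x + a x ^ 2) := by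
  have : deriv ω = fun x => ω x * a x := funext h.deriv_eq
  rw [this]
  refine ((h.hasDerivAt x).mul (h.hasDerivAt_log x)).deriv.trans ?_
  ring

end IsFrequency

/-! ### The fast phase -/

/-- `sin (2 φ / ε)`. -/
noncomputable def fastSin (φ : ℝ → ℝ → ℝ) (ε t : ℝ) : ℝ := Real.sin (2 * φ ε t / ε)

/-- `cos (2 φ / ε)`. -/
noncomputable def fastCos (φ : ℝ → ℝ → ℝ) (ε t : ℝ) : ℝ := Real.cos (2 * φ ε t / ε)

variable {φ θ y p : ℝ → ℝ → ℝ}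

lemma fastSin_bdd (φ : ℝ → ℝ → ℝ) : UnifBdd ε₀ T (fastSin φ) := UnifBdd.sin _

lemma fastCos_bdd (φ : ℝ → ℝ → ℝ) : UnifBdd ε₀ T (fastCos φ) := UnifBdd.cos _

lemma fastSin_sq_add (φ : ℝ → ℝ → ℝ) (ε t : ℝ) : fastSin φ ε t ^ 2 + fastCos φ ε t ^ 2 = 1 :=
  Real.sin_sq_add_cos_sq _

lemma hasDerivWithinAt_fastSin {ε t d : ℝ} {s : Set ℝ} (h : HasDerivWithinAt (φ ε) d s t) :
    HasDerivWithinAt (fastSin φ ε) (2 * d / ε * fastCos φ ε t) s t := by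
  have := ((h.const_mul 2).div_const ε).sin
  rw [mul_comm] at this
  exact this

lemma hasDerivWithinAt_fastCos {ε t d : ℝ} {s : Set ℝ} (h : HasDerivWithinAt (φ ε) d s t) :
    HasDerivWithinAt (fastCos φ ε) (-(2 * d / ε * fastSin φ ε t)) s t := by
  have := ((h.const_mul 2).div_const ε).cos
  rw [neg_mul, mul_comm] at this
  exact this

/-! ### The system in reduced form -/

/-- A family of solutions of the canonical equations, written with the logarithmic derivative `a`
of the frequency, with energy `E` and uniform bounds, and the leading-order motion. -/
structure IsFamily (ω a : ℝ → ℝ) (ε₀ T E θs : ℝ) (φ θ y p : ℝ → ℝ → ℝ) (φ₀ y₀ p₀ : ℝ → ℝ) :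
    Prop where
  freq : IsFrequency ω a
  T_pos : 0 < T
  ε₀_pos : 0 < ε₀
  φ_init : ∀ ε ∈ Ioo 0 ε₀, φ ε 0 = 0
  θ_init : ∀ ε ∈ Ioo 0 ε₀, θ ε 0 = θs
  y_init : ∀ ε ∈ Ioo 0 ε₀, y ε 0 = y₀ 0
  p_init : ∀ ε ∈ Ioo 0 ε₀, p ε 0 = p₀ 0
  φ₀_init : φ₀ 0 = 0
  θ_bdd : UnifBdd ε₀ T θ
  y_bdd : UnifBdd ε₀ T y
  p_bdd : UnifBdd ε₀ T p
  φ_deriv : ∀ ε ∈ Ioo 0 ε₀, ∀ t ∈ Icc 0 T, HasDerivWithinAt (φ ε)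
    (ω (y ε t) + ε * (p ε t * a (y ε t) / 2 * fastSin φ ε t
      + ε * (θ ε t * a (y ε t) ^ 2 / 4 * fastSin φ ε t ^ 2))) (Icc 0 T) t
  θ_deriv : ∀ ε ∈ Ioo 0 ε₀, ∀ t ∈ Icc 0 T, HasDerivWithinAt (θ ε)
    (-(θ ε t * p ε t * a (y ε t) * fastCos φ ε t)
      - ε * (θ ε t ^ 2 * a (y ε t) ^ 2 / 2 * fastSin φ ε t * fastCos φ ε t)) (Icc 0 T) t
  y_deriv : ∀ ε ∈ Ioo 0 ε₀, ∀ t ∈ Icc 0 T, HasDerivWithinAt (y ε)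
    (p ε t + ε * (θ ε t * a (y ε t) / 2 * fastSin φ ε t)) (Icc 0 T) t
  p_deriv : ∀ ε ∈ Ioo 0 ε₀, ∀ t ∈ Icc 0 T, HasDerivWithinAt (p ε)
    (-(a (y ε t) * (E - p ε t ^ 2 / 2))
      + ε * (p ε t * θ ε t * (a (y ε t) ^ 2 - deriv a (y ε t)) / 2 * fastSin φ ε t)
      + ε ^ 2 * (θ ε t ^ 2 * (a (y ε t) ^ 3 / 8 - a (y ε t) * deriv a (y ε t) / 4)
        * fastSin φ ε t ^ 2)) (Icc 0 T) t
  energy : ∀ ε ∈ Ioo 0 ε₀, ∀ t ∈ Icc 0 T,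
    (p ε t + ε * θ ε t * a (y ε t) * fastSin φ ε t / 2) ^ 2 / 2 + θ ε t * ω (y ε t) = E
  φ₀_deriv : ∀ t ∈ Icc 0 T, HasDerivWithinAt φ₀ (ω (y₀ t)) (Icc 0 T) t
  y₀_deriv : ∀ t ∈ Icc 0 T, HasDerivWithinAt y₀ (p₀ t) (Icc 0 T) t
  p₀_deriv : ∀ t ∈ Icc 0 T, HasDerivWithinAt p₀ (-(θs * ω (y₀ t) * a (y₀ t))) (Icc 0 T) t
  energy₀ : ∀ t ∈ Icc 0 T, p₀ t ^ 2 / 2 + θs * ω (y₀ t) = E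

/-! ### Conservation of energy and uniform bounds -/

section Construction

variable {ω a : ℝ → ℝ} {ystar pstar ustar ε : ℝ} {Φ Θ Y P : ℝ → ℝ}

/-- The canonical equations in terms of the logarithmic derivative of the frequency. -/
lemma IsActionAngleSolution.reduced (hf : IsFrequency ω a)
    (h : IsActionAngleSolution ω T ystar pstar ustar ε Φ Θ Y P) :
    (∀ t ∈ Icc 0 T, HasDerivWithinAt Φ
      (ω (Y t) + ε * (P t * a (Y t) / 2 * Real.sin (2 * Φ t / ε)
        + ε * (Θ t * a (Y t) ^ 2 / 4 * Real.sin (2 * Φ t / ε) ^ 2))) (Icc 0 T) t) ∧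
    (∀ t ∈ Icc 0 T, HasDerivWithinAt Θ
      (-(Θ t * P t * a (Y t) * Real.cos (2 * Φ t / ε))
        - ε * (Θ t ^ 2 * a (Y t) ^ 2 / 2 * Real.sin (2 * Φ t / ε) * Real.cos (2 * Φ t / ε)))
      (Icc 0 T) t) ∧
    (∀ t ∈ Icc 0 T, HasDerivWithinAt Y
      (P t + ε * (Θ t * a (Y t) / 2 * Real.sin (2 * Φ t / ε))) (Icc 0 T) t) ∧
    (∀ t ∈ Icc 0 T, HasDerivWithinAt P
      (-(Θ t * ω (Y t) * a (Y t)) - ε * (Θ t * P t * deriv a (Y t) / 2 * Real.sin (2 * Φ t / ε))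
        - ε ^ 2 * (Θ t ^ 2 * a (Y t) * deriv a (Y t) / 4 * Real.sin (2 * Φ t / ε) ^ 2))
      (Icc 0 T) t) := by
  refine ⟨fun t ht => ?_, fun t ht => ?_, fun t ht => ?_, fun t ht => ?_⟩
  · have hω := (hf.pos (Y t)).ne'
    convert! h.phi_eq t ht using 1
    rw [hf.deriv_eq]
    field_simp
    ring
  · have hω := (hf.pos (Y t)).ne'
    convert! h.theta_eq t ht using 1
    rw [hf.deriv_eq, show 4 * Φ t / ε = 2 * (2 * Φ t / ε) by ring, Real.sin_two_mul]
    field_simp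
    ring
  · have hω := (hf.pos (Y t)).ne'
    convert! h.y_eq t ht using 1
    rw [hf.deriv_eq]
    field_simp
  · have hω := (hf.pos (Y t)).ne'
    convert! h.p_eq t ht using 1
    rw [hf.deriv_deriv_eq, hf.deriv_eq]
    field_simp
    ring

/-- Conservation of energy. -/
lemma IsActionAngleSolution.energy (hε : ε ≠ 0) (hf : IsFrequency ω a)
    (h : IsActionAngleSolution ω T ystar pstar ustar ε Φ Θ Y P) :
    ∀ t ∈ Icc 0 T,
      (P t + ε * Θ t * a (Y t) * Real.sin (2 * Φ t / ε) / 2) ^ 2 / 2 + Θ t * ω (Y t) =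
        pstar ^ 2 / 2 + thetaStar ω ystar ustar * ω ystar := by
  obtain ⟨h1, h2, h3, h4⟩ := h.reduced hf
  -- This is the Hamiltonian after completing the square in `p`.
  have hd : ∀ t ∈ Icc 0 T, HasDerivWithinAt (fun t =>
      (P t + ε * Θ t * a (Y t) * Real.sin (2 * Φ t / ε) / 2) ^ 2 / 2 + Θ t * ω (Y t)) 0
      (Icc 0 T) t := by
    intro t ht
    have hS := (((h1 t ht).const_mul 2).div_const ε).sin
    have ha := (hf.hasDerivAt_log (Y t)).comp_hasDerivWithinAt t (h3 t ht)
    have hω := (hf.hasDerivAt (Y t)).comp_hasDerivWithinAt t (h3 t ht)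
    convert! ((((h4 t ht).add (((((h2 t ht).const_mul ε).mul ha).mul hS).div_const 2)).pow 2
      ).div_const 2).add ((h2 t ht).mul hω) using 1
    simp only [Pi.mul_apply, Pi.add_apply, Function.comp_apply]
    field_simp
    ring
  intro t ht
  refine (eqOn_of_deriv_eq hd (fun t _ => hasDerivWithinAt_const t (Icc 0 T) _) ?_ ht)
  simp [h.phi_init, h.theta_init, h.y_init, h.p_init]

/-- The equation has the form `Θ' = m Θ` with `m` continuous, so an integrating factor shows that
`Θ` keeps the sign of its initial value. This makes both summands of the energy nonnegative. -/
lemma IsActionAngleSolution.theta_nonneg (hT : 0 < T) (hf : IsFrequency ω a)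
    (h : IsActionAngleSolution ω T ystar pstar ustar ε Φ Θ Y P) :
    ∀ t ∈ Icc 0 T, 0 ≤ Θ t := by
  obtain ⟨h1, h2, h3, h4⟩ := h.reduced hf
  have c1 : ContinuousOn Φ (Icc 0 T) := fun t ht => (h1 t ht).continuousWithinAt
  have c2 : ContinuousOn Θ (Icc 0 T) := fun t ht => (h2 t ht).continuousWithinAt
  have c3 : ContinuousOn Y (Icc 0 T) := fun t ht => (h3 t ht).continuousWithinAt
  have c4 : ContinuousOn P (Icc 0 T) := fun t ht => (h4 t ht).continuousWithinAt
  have ca : Continuous a := hf.contDiff_log.continuous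
  have cm : ContinuousOn (fun t => -(P t * a (Y t) * Real.cos (2 * Φ t / ε))
      - ε * (Θ t * a (Y t) ^ 2 / 2 * Real.sin (2 * Φ t / ε) * Real.cos (2 * Φ t / ε)))
      (Icc 0 T) := by
    simp only [div_eq_mul_inv]
    fun_prop
  obtain ⟨M, hM0, hM⟩ := exists_primitive hT.le cm 0
  have hd : ∀ t ∈ Icc 0 T, HasDerivWithinAt (fun t => Θ t * Real.exp (-M t)) 0 (Icc 0 T) t := by
    intro t ht
    convert! (h2 t ht).mul (hM t ht).neg.exp using 1
    ring
  intro t ht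
  have := eqOn_of_deriv_eq hd
    (fun t _ => hasDerivWithinAt_const t (Icc 0 T) (thetaStar ω ystar ustar))
    (by simp [h.theta_init, hM0]) ht
  have hs : 0 ≤ thetaStar ω ystar ustar := by
    have := hf.pos ystar
    unfold thetaStar
    positivity
  have hpos := Real.exp_pos (-M t)
  have this : Θ t * Real.exp (-M t) = thetaStar ω ystar ustar := this
  exact nonneg_of_mul_nonneg_left (this ▸ hs) hpos

/-- The solutions of the canonical equations form a uniformly bounded family. -/
lemma IsFamily.of_solutions {ωstar θs : ℝ} {φ₀ y₀ p₀ : ℝ → ℝ} (hf : IsFrequency ω a)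
    (hωstar : 0 < ωstar) (hωpos : ∀ x, ωstar ≤ ω x) (hT : 0 < T) (hε₀ : 0 < ε₀)
    (hsol : ∀ ε ∈ Ioo 0 ε₀,
      IsActionAngleSolution ω T ystar pstar ustar ε (φ ε) (θ ε) (y ε) (p ε))
    (hlead : IsLeadingOrder ω T ystar pstar ustar φ₀ y₀ p₀)
    (hθs : θs = thetaStar ω ystar ustar) :
    IsFamily ω a ε₀ T (pstar ^ 2 / 2 + θs * ω ystar) θs φ θ y p φ₀ y₀ p₀ := by
  set E := pstar ^ 2 / 2 + θs * ω ystar with hE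
  have h0 : (0 : ℝ) ∈ Icc 0 T := ⟨le_rfl, hT.le⟩
  have hθs0 : 0 ≤ θs := by
    have := hf.pos ystar
    rw [hθs]; unfold thetaStar
    positivity
  have energy : ∀ ε ∈ Ioo 0 ε₀, ∀ t ∈ Icc 0 T,
      (p ε t + ε * θ ε t * a (y ε t) * fastSin φ ε t / 2) ^ 2 / 2 + θ ε t * ω (y ε t) = E :=
    fun ε hε t ht => by
      rw [hE, hθs]
      exact (hsol ε hε).energy hε.1.ne' hf t ht
  have nonneg : ∀ ε ∈ Ioo 0 ε₀, ∀ t ∈ Icc 0 T, 0 ≤ θ ε t :=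
    fun ε hε t ht => (hsol ε hε).theta_nonneg hT hf t ht
  have θ_bdd : UnifBdd ε₀ T θ := ⟨E / ωstar, fun ε hε t ht => by
    rw [abs_of_nonneg (nonneg ε hε t ht), le_div_iff₀ hωstar]
    have := energy ε hε t ht
    have := mul_le_mul_of_nonneg_left (hωpos (y ε t)) (nonneg ε hε t ht)
    nlinarith [sq_nonneg (p ε t + ε * θ ε t * a (y ε t) * fastSin φ ε t / 2)]⟩
  -- Here `x² ≤ 2 E` for the shifted momentum `x`, and `2 |x| ≤ x² + 1`.
  have P_le : ∀ ε ∈ Ioo 0 ε₀, ∀ t ∈ Icc 0 T,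
      |p ε t + ε * θ ε t * a (y ε t) * fastSin φ ε t / 2| ≤ E + 1 := by
    intro ε hε t ht
    have h1 := energy ε hε t ht
    have h2 := mul_nonneg (nonneg ε hε t ht) (hf.pos (y ε t)).le
    set x := p ε t + ε * θ ε t * a (y ε t) * fastSin φ ε t / 2
    rw [abs_le]
    constructor <;> nlinarith [sq_nonneg (x - 1), sq_nonneg (x + 1)]
  have y_deriv : ∀ ε ∈ Ioo 0 ε₀, ∀ t ∈ Icc 0 T, HasDerivWithinAt (y ε)
      (p ε t + ε * (θ ε t * a (y ε t) / 2 * fastSin φ ε t)) (Icc 0 T) t :=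
    fun ε hε => ((hsol ε hε).reduced hf).2.2.1
  -- The velocity `y'` is exactly the shifted momentum just bounded. So `y` is controlled before
  -- `p`; the bound on `p` then needs that of `a (y)`.
  have y_bdd : UnifBdd ε₀ T y := ⟨|ystar| + (E + 1) * T, fun ε hε t ht => by
    have := (convex_Icc (0 : ℝ) T).norm_image_sub_le_of_norm_hasDerivWithin_le (C := E + 1)
      (y_deriv ε hε) (fun s hs => by
        refine le_trans (le_of_eq ?_) (P_le ε hε s hs)
        rw [Real.norm_eq_abs]
        congr 1
        ring) h0 ht
    rw [(hsol ε hε).y_init, sub_zero, Real.norm_eq_abs, Real.norm_eq_abs, abs_of_nonneg ht.1] at this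
    have h1 : (E + 1) * t ≤ (E + 1) * T := by
      have : 0 ≤ E := by have := hf.pos ystar; rw [hE]; positivity
      gcongr
      exact ht.2
    have h2 := abs_add_le (y ε t - ystar) ystar
    rw [sub_add_cancel] at h2
    linarith⟩
  have a_bdd : UnifBdd ε₀ T (fun ε t => a (y ε t)) :=
    UnifBdd.comp_continuous hf.contDiff_log.continuous y_bdd
  have p_bdd : UnifBdd ε₀ T p := by
    have h1 : UnifBdd ε₀ T (fun ε t => p ε t + ε * θ ε t * a (y ε t) * fastSin φ ε t / 2) :=
      ⟨E + 1, P_le⟩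
    exact (h1.sub ((((UnifBdd.eps.mul θ_bdd).mul a_bdd).mul (fastSin_bdd φ)).div_const 2)).congr
      fun ε _ t _ => by ring
  have hp₀ : ∀ t ∈ Icc 0 T, HasDerivWithinAt p₀ (-(θs * ω (y₀ t) * a (y₀ t))) (Icc 0 T) t :=
    fun t ht => by
      convert! hlead.p_eq t ht using 1
      rw [hf.deriv_eq, hθs, mul_assoc]
  refine ⟨hf, hT, hε₀, fun ε hε => (hsol ε hε).phi_init,
    fun ε hε => (hsol ε hε).theta_init.trans hθs.symm,
    fun ε hε => (hsol ε hε).y_init.trans hlead.y_init.symm,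
    fun ε hε => (hsol ε hε).p_init.trans hlead.p_init.symm, hlead.phi_init, θ_bdd, y_bdd, p_bdd,
    fun ε hε => ((hsol ε hε).reduced hf).1, fun ε hε => ((hsol ε hε).reduced hf).2.1, y_deriv,
    fun ε hε t ht => ?_, energy, hlead.phi_eq, hlead.y_eq, hp₀, fun t ht => ?_⟩
  -- The energy identity, multiplied by `a`, trades `θ ω a` for terms in which `θ` always carries a
  -- factor `ε`.
  · convert! ((hsol ε hε).reduced hf).2.2.2 t ht using 1
    have := energy ε hε t ht
    unfold fastSin at *
    linear_combination (a (y ε t)) * this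
  · have hd : ∀ t ∈ Icc 0 T, HasDerivWithinAt (fun t => p₀ t ^ 2 / 2 + θs * ω (y₀ t)) 0
        (Icc 0 T) t := fun t ht => by
      convert! (((hp₀ t ht).pow 2).div_const 2).add
        (((hf.hasDerivAt (y₀ t)).comp_hasDerivWithinAt t (hlead.y_eq t ht)).const_mul θs) using 1
      ring
    refine eqOn_of_deriv_eq hd (fun t _ => hasDerivWithinAt_const t (Icc 0 T) E) ?_ ht
    simp [hlead.y_init, hlead.p_init, hE]

end Construction

end FastSlow

namespace FastSlow

/-! ### Products of estimates -/

variable {ε₀ T : ℝ} {k : ℕ} {f g f₀ g₀ : ℝ → ℝ → ℝ}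

lemma UnifBdd.unifO (h : UnifBdd ε₀ T f) : UnifO ε₀ T 0 f :=
  UnifO.of_eq_mul h fun _ _ _ _ => by ring

lemma UnifO.of_add (j : ℕ) (h : UnifO ε₀ T (k + j) f) : UnifO ε₀ T k f := by
  obtain ⟨u, hu, h⟩ := h.exists_eq_mul
  exact of_eq_mul ((UnifBdd.eps.pow j).mul hu) fun ε hε t ht => by rw [h ε hε t ht]; ring

/-- Telescoping: `f g - f₀ g₀ = f (g - g₀) + g₀ (f - f₀)`. Iterated, it replaces every factor of a
product by its leading-order counterpart. -/
lemma UnifO.mul_sub_mul (hf : UnifO ε₀ T k (fun ε t => f ε t - f₀ ε t))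
    (hg : UnifO ε₀ T k (fun ε t => g ε t - g₀ ε t)) (bf : UnifBdd ε₀ T f)
    (bg : UnifBdd ε₀ T g₀) : UnifO ε₀ T k (fun ε t => f ε t * g ε t - f₀ ε t * g₀ ε t) :=
  ((bdd_mul bf hg).add (bdd_mul bg hf)).congr fun ε _ t _ => by ring

/-! ### Functions with uniformly bounded time derivative -/

/-- `g` is uniformly bounded and has a uniformly bounded time derivative. -/
def UnifC1 (ε₀ T : ℝ) (g : ℝ → ℝ → ℝ) : Prop :=
  UnifBdd ε₀ T g ∧ ∃ g', UnifBdd ε₀ T g' ∧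
    ∀ ε ∈ Ioo 0 ε₀, ∀ t ∈ Icc 0 T, HasDerivWithinAt (g ε) (g' ε t) (Icc 0 T) t

namespace UnifC1

lemma const (c : ℝ) : UnifC1 ε₀ T (fun _ _ => c) :=
  ⟨UnifBdd.const c, _, UnifBdd.const 0, fun _ _ _ _ => hasDerivWithinAt_const _ _ _⟩

lemma add (hf : UnifC1 ε₀ T f) (hg : UnifC1 ε₀ T g) : UnifC1 ε₀ T (fun ε t => f ε t + g ε t) := by
  obtain ⟨hf, f', hf', hfd⟩ := hf
  obtain ⟨hg, g', hg', hgd⟩ := hg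
  exact ⟨hf.add hg, _, hf'.add hg', fun ε hε t ht => (hfd ε hε t ht).add (hgd ε hε t ht)⟩

lemma mul (hf : UnifC1 ε₀ T f) (hg : UnifC1 ε₀ T g) : UnifC1 ε₀ T (fun ε t => f ε t * g ε t) := by
  obtain ⟨hf, f', hf', hfd⟩ := hf
  obtain ⟨hg, g', hg', hgd⟩ := hg
  exact ⟨hf.mul hg, _, (hf'.mul hg).add (hf.mul hg'),
    fun ε hε t ht => (hfd ε hε t ht).mul (hgd ε hε t ht)⟩

lemma neg (hf : UnifC1 ε₀ T f) : UnifC1 ε₀ T (fun ε t => -f ε t) := by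
  simpa using (const (-1)).mul hf

lemma sub (hf : UnifC1 ε₀ T f) (hg : UnifC1 ε₀ T g) : UnifC1 ε₀ T (fun ε t => f ε t - g ε t) := by
  simpa only [sub_eq_add_neg] using hf.add hg.neg

lemma div_const (hf : UnifC1 ε₀ T f) (c : ℝ) : UnifC1 ε₀ T (fun ε t => f ε t / c) := by
  simpa only [div_eq_mul_inv] using hf.mul (const c⁻¹)

lemma pow (hf : UnifC1 ε₀ T f) (n : ℕ) : UnifC1 ε₀ T (fun ε t => f ε t ^ n) := by
  induction n with
  | zero => simpa using const 1
  | succ n ih => simpa only [pow_succ] using ih.mul hf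

lemma comp {u : ℝ → ℝ} (hu : ContDiff ℝ (⊤ : ℕ∞) u) (hf : UnifC1 ε₀ T f) :
    UnifC1 ε₀ T (fun ε t => u (f ε t)) := by
  obtain ⟨hf, f', hf', hfd⟩ := hf
  exact ⟨hf.comp_continuous hu.continuous, _,
    (hf.comp_continuous (hu.continuous_deriv (by simp))).mul hf', fun ε hε t ht =>
      ((hu.differentiable (by simp)) (f ε t)).hasDerivAt.comp_hasDerivWithinAt t (hfd ε hε t ht)⟩

lemma of_deriv {u u' : ℝ → ℝ} (h : ∀ t ∈ Icc 0 T, HasDerivWithinAt u (u' t) (Icc 0 T) t)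
    (hu' : ContinuousOn u' (Icc 0 T)) : UnifC1 ε₀ T (fun _ t => u t) :=
  ⟨UnifBdd.of_continuousOn fun t ht => (h t ht).continuousWithinAt, _,
    UnifBdd.of_continuousOn hu', fun _ _ => h⟩

end UnifC1

namespace IsFamily

variable {ω a : ℝ → ℝ} {E θs : ℝ} {φ θ y p : ℝ → ℝ → ℝ} {φ₀ y₀ p₀ : ℝ → ℝ}

lemma comp_y_bdd (F : IsFamily ω a ε₀ T E θs φ θ y p φ₀ y₀ p₀) {u : ℝ → ℝ} (hu : Continuous u) :
    UnifBdd ε₀ T (fun ε t => u (y ε t)) :=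
  F.y_bdd.comp_continuous hu

lemma continuousOn_y₀ (F : IsFamily ω a ε₀ T E θs φ θ y p φ₀ y₀ p₀) :
    ContinuousOn y₀ (Icc 0 T) := fun t ht => (F.y₀_deriv t ht).continuousWithinAt

lemma continuousOn_p₀ (F : IsFamily ω a ε₀ T E θs φ θ y p φ₀ y₀ p₀) :
    ContinuousOn p₀ (Icc 0 T) := fun t ht => (F.p₀_deriv t ht).continuousWithinAt

lemma y₀_bdd (F : IsFamily ω a ε₀ T E θs φ θ y p φ₀ y₀ p₀) : UnifBdd ε₀ T (fun _ t => y₀ t) :=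
  UnifBdd.of_continuousOn F.continuousOn_y₀

lemma p₀_bdd (F : IsFamily ω a ε₀ T E θs φ θ y p φ₀ y₀ p₀) : UnifBdd ε₀ T (fun _ t => p₀ t) :=
  UnifBdd.of_continuousOn F.continuousOn_p₀

lemma comp_y₀_bdd (F : IsFamily ω a ε₀ T E θs φ θ y p φ₀ y₀ p₀) {u : ℝ → ℝ} (hu : Continuous u) :
    UnifBdd ε₀ T (fun _ t => u (y₀ t)) :=
  F.y₀_bdd.comp_continuous hu

lemma y_C1 (F : IsFamily ω a ε₀ T E θs φ θ y p φ₀ y₀ p₀) : UnifC1 ε₀ T y := by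
  have ha := F.comp_y_bdd F.freq.contDiff_log.continuous
  have hS : UnifBdd ε₀ T (fastSin φ) := fastSin_bdd φ
  have hθ := F.θ_bdd
  have hp := F.p_bdd
  refine ⟨F.y_bdd, _, ?_, F.y_deriv⟩
  repeat' with_reducible first
      | assumption | apply UnifBdd.const | apply UnifBdd.eps | apply UnifBdd.add
      | apply UnifBdd.sub | apply UnifBdd.neg | apply UnifBdd.mul | apply UnifBdd.pow
      | apply UnifBdd.div_const

lemma θ_C1 (F : IsFamily ω a ε₀ T E θs φ θ y p φ₀ y₀ p₀) : UnifC1 ε₀ T θ := by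
  have ha := F.comp_y_bdd F.freq.contDiff_log.continuous
  have hS : UnifBdd ε₀ T (fastSin φ) := fastSin_bdd φ
  have hC : UnifBdd ε₀ T (fastCos φ) := fastCos_bdd φ
  have hθ := F.θ_bdd
  have hp := F.p_bdd
  refine ⟨F.θ_bdd, _, ?_, F.θ_deriv⟩
  repeat' with_reducible first
      | assumption | apply UnifBdd.const | apply UnifBdd.eps | apply UnifBdd.add
      | apply UnifBdd.sub | apply UnifBdd.neg | apply UnifBdd.mul | apply UnifBdd.pow
      | apply UnifBdd.div_const

lemma p_C1 (F : IsFamily ω a ε₀ T E θs φ θ y p φ₀ y₀ p₀) : UnifC1 ε₀ T p := by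
  have ha := F.comp_y_bdd F.freq.contDiff_log.continuous
  have ha1 := F.comp_y_bdd F.freq.contDiff_deriv.continuous
  have hS : UnifBdd ε₀ T (fastSin φ) := fastSin_bdd φ
  have hθ := F.θ_bdd
  have hp := F.p_bdd
  refine ⟨F.p_bdd, _, ?_, F.p_deriv⟩
  repeat' with_reducible first
      | assumption | apply UnifBdd.const | apply UnifBdd.eps | apply UnifBdd.add
      | apply UnifBdd.sub | apply UnifBdd.neg | apply UnifBdd.mul | apply UnifBdd.pow
      | apply UnifBdd.div_const

lemma y₀_C1 (F : IsFamily ω a ε₀ T E θs φ θ y p φ₀ y₀ p₀) : UnifC1 ε₀ T (fun _ t => y₀ t) :=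
  UnifC1.of_deriv F.y₀_deriv F.continuousOn_p₀

lemma p₀_C1 (F : IsFamily ω a ε₀ T E θs φ θ y p φ₀ y₀ p₀) : UnifC1 ε₀ T (fun _ t => p₀ t) :=
  UnifC1.of_deriv F.p₀_deriv (((continuousOn_const.mul
    (F.freq.contDiff.continuous.comp_continuousOn F.continuousOn_y₀)).mul
    (F.freq.contDiff_log.continuous.comp_continuousOn F.continuousOn_y₀)).neg)

/-! ### Averaging of oscillating terms -/

/-- The fast phase rotates with angular velocity `ω (y) + O(ε)`. -/
lemma exists_φ_rate (F : IsFamily ω a ε₀ T E θs φ θ y p φ₀ y₀ p₀) :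
    ∃ ψ, UnifBdd ε₀ T ψ ∧ ∀ ε ∈ Ioo 0 ε₀, ∀ t ∈ Icc 0 T,
      HasDerivWithinAt (φ ε) (ω (y ε t) + ε * ψ ε t) (Icc 0 T) t := by
  have ha := F.comp_y_bdd F.freq.contDiff_log.continuous
  have hS : UnifBdd ε₀ T (fastSin φ) := fastSin_bdd φ
  have hθ := F.θ_bdd
  have hp := F.p_bdd
  refine ⟨_, ?_, F.φ_deriv⟩
  repeat' with_reducible first
      | assumption | apply UnifBdd.const | apply UnifBdd.eps | apply UnifBdd.add
      | apply UnifBdd.sub | apply UnifBdd.neg | apply UnifBdd.mul | apply UnifBdd.pow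
      | apply UnifBdd.div_const

/-- If the periodic profile `W` is the `φ`-derivative of `V`, then `g W` averages out. -/
lemma avgO_mul_profile (F : IsFamily ω a ε₀ T E θs φ θ y p φ₀ y₀ p₀) {V W : ℝ → ℝ → ℝ}
    (hV : UnifBdd ε₀ T V) (hW : UnifBdd ε₀ T W)
    (hVW : ∀ ε ∈ Ioo 0 ε₀, ∀ t ∈ Icc 0 T, ∀ d, HasDerivWithinAt (φ ε) d (Icc 0 T) t →
      HasDerivWithinAt (V ε) (2 * d / ε * W ε t) (Icc 0 T) t)
    (hg : UnifC1 ε₀ T g) : AvgO ε₀ T 1 (fun ε t => g ε t * W ε t) := by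
  obtain ⟨ψ, hψ, hφ⟩ := F.exists_φ_rate
  have hG : UnifC1 ε₀ T (fun ε t => g ε t * (ω (y ε t))⁻¹ / 2) :=
    (hg.mul (F.y_C1.comp F.freq.contDiff_inv)).div_const 2
  obtain ⟨bG, G', bG', hG'⟩ := hG
  have hw := F.comp_y_bdd F.freq.contDiff_inv.continuous
  -- Since `V' = (2/ε) (ω + ε ψ) W`, the derivative of `ε g V / (2 ω)` is `g W + O(ε)`.
  refine ⟨fun ε t => ε * (g ε t * (ω (y ε t))⁻¹ / 2 * V ε t), _, ?_, fun ε hε t ht =>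
    ((hG' ε hε t ht).mul (hVW ε hε t ht _ (hφ ε hε t ht))).const_mul ε, ?_⟩
  · exact UnifO.of_eq_mul (bG.mul hV) fun ε _ t _ => by ring
  · refine UnifO.of_eq_mul (g := fun ε t => -(G' ε t * V ε t) -
      g ε t * (ω (y ε t))⁻¹ * ψ ε t * W ε t) ?_ fun ε hε t ht => ?_
    · exact (bG'.mul hV).neg.sub (((hg.1.mul hw).mul hψ).mul hW)
    · have h1 := hε.1.ne'
      have h2 := (F.freq.pos (y ε t)).ne'
      field_simp
      ring

lemma avgO_mul_cos (F : IsFamily ω a ε₀ T E θs φ θ y p φ₀ y₀ p₀) (hg : UnifC1 ε₀ T g) :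
    AvgO ε₀ T 1 (fun ε t => g ε t * fastCos φ ε t) :=
  F.avgO_mul_profile (fastSin_bdd φ) (fastCos_bdd φ)
    (fun _ _ _ _ _ h => hasDerivWithinAt_fastSin h) hg

lemma avgO_mul_sin (F : IsFamily ω a ε₀ T E θs φ θ y p φ₀ y₀ p₀) (hg : UnifC1 ε₀ T g) :
    AvgO ε₀ T 1 (fun ε t => g ε t * fastSin φ ε t) := by
  refine F.avgO_mul_profile (fastCos_bdd φ).neg (fastSin_bdd φ) (fun ε _ t _ d h => ?_) hg
  have := (hasDerivWithinAt_fastCos h).neg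
  rwa [neg_neg] at this

/-- Handles quadratic fast terms: `sin² = 1/2 - (cos² - sin²)/2` splits into its mean and this
mean-free profile, which is the derivative of `sin * cos` with respect to the fast angle. -/
lemma avgO_mul_cos_two (F : IsFamily ω a ε₀ T E θs φ θ y p φ₀ y₀ p₀) (hg : UnifC1 ε₀ T g) :
    AvgO ε₀ T 1 (fun ε t => g ε t * (fastCos φ ε t ^ 2 - fastSin φ ε t ^ 2)) := by
  refine F.avgO_mul_profile ((fastSin_bdd φ).mul (fastCos_bdd φ))
    (((fastCos_bdd φ).pow 2).sub ((fastSin_bdd φ).pow 2)) (fun ε _ t _ d h => ?_) hg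
  convert! (hasDerivWithinAt_fastSin h).mul (hasDerivWithinAt_fastCos h) using 1
  ring

/-! ### First estimates -/

/-- With `θ ω` eliminated by the energy, the pair is closed at order zero, and the only forcing of
order `ε` is a sine, which averages to `O(ε²)`. No prior estimate of `θ - θs` is needed. -/
lemma y_p_sub (F : IsFamily ω a ε₀ T E θs φ θ y p φ₀ y₀ p₀) :
    UnifO ε₀ T 2 (fun ε t => y ε t - y₀ t) ∧ UnifO ε₀ T 2 (fun ε t => p ε t - p₀ t) := by
  obtain ⟨q, hq, hqe⟩ := UnifBdd.exists_sub_eq_mul (F.freq.contDiff_log.of_le (by simp)) F.y_bdd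
    F.y₀_bdd
  have ha := F.comp_y_bdd F.freq.contDiff_log.continuous
  have ha1 := F.comp_y_bdd F.freq.contDiff_deriv.continuous
  have ha0 := F.comp_y₀_bdd F.freq.contDiff_log.continuous
  have hS : UnifBdd ε₀ T (fastSin φ) := fastSin_bdd φ
  have hθ := F.θ_bdd
  have hp := F.p_bdd
  have hp0 := F.p₀_bdd
  have cθ := F.θ_C1
  have cp := F.p_C1
  have ca := F.y_C1.comp F.freq.contDiff_log
  have ca1 := F.y_C1.comp F.freq.contDiff_deriv
  -- The coefficients come from splitting `a(y₀)(E - p₀²/2) - a(y)(E - p²/2)` as `-(a(y) - a(y₀))(E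
  -- - p²/2) + a(y₀)(p² - p₀²)/2`.
  refine unifO_of_planar_linear F.T_pos.le
    (c₁ := fun _ _ => 0) (c₂ := fun _ _ => 1)
    (c₃ := fun ε t => q ε t * (-E + p ε t ^ 2 / 2)) (c₄ := fun ε t => a (y₀ t) * (p ε t + p₀ t) / 2)
    (fun ε hε t ht => (F.y_deriv ε hε t ht).sub (F.y₀_deriv t ht))
    (fun ε hε t ht => (F.p_deriv ε hε t ht).sub (F.p₀_deriv t ht))
    (fun ε hε => sub_eq_zero.2 (F.y_init ε hε)) (fun ε hε => sub_eq_zero.2 (F.p_init ε hε))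
    (UnifBdd.const _) (UnifBdd.const _) ?_ ?_ ?_ ?_
  · repeat' with_reducible first
      | assumption | apply UnifBdd.const | apply UnifBdd.eps | apply UnifBdd.add
      | apply UnifBdd.sub | apply UnifBdd.neg | apply UnifBdd.mul | apply UnifBdd.pow
      | apply UnifBdd.div_const
  · repeat' with_reducible first
      | assumption | apply UnifBdd.const | apply UnifBdd.eps | apply UnifBdd.add
      | apply UnifBdd.sub | apply UnifBdd.neg | apply UnifBdd.mul | apply UnifBdd.pow
      | apply UnifBdd.div_const
  · have : UnifC1 ε₀ T (fun ε t => θ ε t * a (y ε t) / 2) := (cθ.mul ca).div_const 2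
    exact ((F.avgO_mul_sin this).eps_mul 1).congr fun ε _ t _ => by ring
  · have h1 : UnifC1 ε₀ T (fun ε t => p ε t * θ ε t * (a (y ε t) ^ 2 - deriv a (y ε t)) / 2) :=
      ((cp.mul cθ).mul ((ca.pow 2).sub ca1)).div_const 2
    have h2 : UnifBdd ε₀ T (fun ε t => θ ε t ^ 2 * (a (y ε t) ^ 3 / 8
        - a (y ε t) * deriv a (y ε t) / 4) * fastSin φ ε t ^ 2) := by
      repeat' with_reducible first
      | assumption | apply UnifBdd.const | apply UnifBdd.eps | apply UnifBdd.add
      | apply UnifBdd.sub | apply UnifBdd.neg | apply UnifBdd.mul | apply UnifBdd.pow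
      | apply UnifBdd.div_const
    refine (((F.avgO_mul_sin h1).eps_mul 1).add (AvgO.of_unifO (h2.unifO.eps_mul 2))).congr
      fun ε hε t ht => ?_
    have e1 := F.energy₀ t ht
    have e2 := hqe ε t
    linear_combination (a (y₀ t)) * e1 - (E - p ε t ^ 2 / 2) * e2

lemma comp_y_sub (F : IsFamily ω a ε₀ T E θs φ θ y p φ₀ y₀ p₀) {u : ℝ → ℝ}
    (hu : ContDiff ℝ (⊤ : ℕ∞) u) : UnifO ε₀ T 2 (fun ε t => u (y ε t) - u (y₀ t)) := by
  obtain ⟨q, hq, hqe⟩ := UnifBdd.exists_sub_eq_mul (hu.of_le (by simp)) F.y_bdd F.y₀_bdd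
  exact (UnifO.bdd_mul hq F.y_p_sub.1).congr fun ε _ t _ => hqe ε t

lemma comp_y_taylor (F : IsFamily ω a ε₀ T E θs φ θ y p φ₀ y₀ p₀) {u : ℝ → ℝ}
    (hu : ContDiff ℝ (⊤ : ℕ∞) u) : ∃ q, UnifBdd ε₀ T q ∧ ∀ ε ∈ Ioo 0 ε₀, ∀ t ∈ Icc 0 T,
      u (y ε t) - u (y₀ t) = deriv u (y₀ t) * (y ε t - y₀ t) + ε ^ 4 * q ε t := by
  obtain ⟨q, hq, hqe⟩ := UnifBdd.exists_taylor (hu.of_le (by exact WithTop.coe_le_coe.2 le_top)) F.y_bdd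
    F.y₀_bdd
  obtain ⟨r, hr, hre⟩ := F.y_p_sub.1.exists_eq_mul
  refine ⟨fun ε t => q ε t * r ε t ^ 2, hq.mul (hr.pow 2), fun ε hε t ht => ?_⟩
  have h2 := hre ε hε t ht
  rw [hqe, h2]
  ring

/-- The order `ε²` is what makes the fast phases `2φ/ε` and `2φ₀/ε` agree up to `O(ε)`. -/
lemma φ_sub (F : IsFamily ω a ε₀ T E θs φ θ y p φ₀ y₀ p₀) :
    UnifO ε₀ T 2 (fun ε t => φ ε t - φ₀ t) := by
  have ha := F.comp_y_bdd F.freq.contDiff_log.continuous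
  have hS : UnifBdd ε₀ T (fastSin φ) := fastSin_bdd φ
  have hθ := F.θ_bdd
  refine unifO_of_deriv_avgO F.T_pos.le
    (fun ε hε t ht => (F.φ_deriv ε hε t ht).sub (F.φ₀_deriv t ht))
    (fun ε hε => sub_eq_zero.2 ((F.φ_init ε hε).trans F.φ₀_init.symm)) ?_
  have h1 : UnifC1 ε₀ T (fun ε t => p ε t * a (y ε t) / 2) :=
    (F.p_C1.mul (F.y_C1.comp F.freq.contDiff_log)).div_const 2
  have h2 : UnifBdd ε₀ T (fun ε t => θ ε t * a (y ε t) ^ 2 / 4 * fastSin φ ε t ^ 2) := by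
    repeat' with_reducible first
      | assumption | apply UnifBdd.const | apply UnifBdd.eps | apply UnifBdd.add
      | apply UnifBdd.sub | apply UnifBdd.neg | apply UnifBdd.mul | apply UnifBdd.pow
      | apply UnifBdd.div_const
  exact (((AvgO.of_unifO (F.comp_y_sub F.freq.contDiff)).add
    ((F.avgO_mul_sin h1).eps_mul 1)).add (AvgO.of_unifO (h2.unifO.eps_mul 2))).congr
      fun ε hε t ht => by ring

/-- Obtained by subtracting the two energy identities and dividing by `ω (y)`, without integrating
the equation for `θ`. -/
lemma θ_sub (F : IsFamily ω a ε₀ T E θs φ θ y p φ₀ y₀ p₀) :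
    UnifO ε₀ T 1 (fun ε t => θ ε t - θs) := by
  obtain ⟨Y, hY, hYe⟩ := (F.comp_y_sub F.freq.contDiff).exists_eq_mul
  obtain ⟨P, hP, hPe⟩ := F.y_p_sub.2.exists_eq_mul
  have ha := F.comp_y_bdd F.freq.contDiff_log.continuous
  have hw := F.comp_y_bdd F.freq.contDiff_inv.continuous
  have hS : UnifBdd ε₀ T (fastSin φ) := fastSin_bdd φ
  have hθ := F.θ_bdd
  have hp := F.p_bdd
  have hp0 := F.p₀_bdd
  refine UnifO.of_eq_mul (g := fun ε t => (ω (y ε t))⁻¹ * (-(ε * (P ε t * (p ε t + p₀ t)) / 2)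
    - p ε t * θ ε t * a (y ε t) * fastSin φ ε t / 2
    - ε * (θ ε t ^ 2 * a (y ε t) ^ 2 * fastSin φ ε t ^ 2) / 8 - θs * (ε * Y ε t))) ?_
    fun ε hε t ht => ?_
  · repeat' with_reducible first
      | assumption | apply UnifBdd.const | apply UnifBdd.eps | apply UnifBdd.add
      | apply UnifBdd.sub | apply UnifBdd.neg | apply UnifBdd.mul | apply UnifBdd.pow
      | apply UnifBdd.div_const
  · have e1 := F.energy ε hε t ht
    have e2 := F.energy₀ t ht
    have e3 := hYe ε hε t ht
    have e4 := hPe ε hε t ht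
    have e5 := F.freq.inv_mul (y ε t)
    linear_combination (ω (y ε t))⁻¹ * e1 - (ω (y ε t))⁻¹ * e2 - (ω (y ε t))⁻¹ * θs * e3
      - (ω (y ε t))⁻¹ * (p ε t + p₀ t) / 2 * e4 - (θ ε t - θs) * e5

end IsFamily

end FastSlow

namespace FastSlow

variable {ε₀ T : ℝ}

/-! ### The averaged second-order motion in reduced form -/

/-- `ω' / (4 ω²) = a / (4 ω)`. -/
noncomputable def corrY (ω a : ℝ → ℝ) (x : ℝ) : ℝ := a x * (ω x)⁻¹ / 4

/-- `-(a / (4 ω))' = (a² - a') / (4 ω)`. -/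
noncomputable def corrP (ω a : ℝ → ℝ) (x : ℝ) : ℝ := (a x ^ 2 - deriv a x) * (ω x)⁻¹ / 4

namespace IsFrequency

variable {ω a : ℝ → ℝ}

lemma contDiff_corrY (h : IsFrequency ω a) : ContDiff ℝ (⊤ : ℕ∞) (corrY ω a) :=
  (h.contDiff_log.mul h.contDiff_inv).div_const 4

lemma contDiff_corrP (h : IsFrequency ω a) : ContDiff ℝ (⊤ : ℕ∞) (corrP ω a) :=
  (((h.contDiff_log.pow 2).sub h.contDiff_deriv).mul h.contDiff_inv).div_const 4

/-- This and `corrP_mul` are division-free forms of the definitions. They encode the cancellation of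
the order-`ε` sines by the derivatives of the cosine correctors. -/
lemma corrY_mul (h : IsFrequency ω a) (x : ℝ) : 4 * corrY ω a x * ω x = a x := by
  have := (h.pos x).ne'
  unfold corrY
  field_simp

lemma corrP_mul (h : IsFrequency ω a) (x : ℝ) : 4 * corrP ω a x * ω x = a x ^ 2 - deriv a x := by
  have := (h.pos x).ne'
  unfold corrP
  field_simp

lemma hasDerivAt_corrY (h : IsFrequency ω a) (x : ℝ) :
    HasDerivAt (corrY ω a) (-corrP ω a x) x := by
  convert! ((h.hasDerivAt_log x).mul (h.hasDerivAt_inv x)).div_const 4 using 1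
  unfold corrP
  ring

lemma hasDerivAt_corrP (h : IsFrequency ω a) (x : ℝ) :
    HasDerivAt (corrP ω a) (deriv (corrP ω a) x) x :=
  ((h.contDiff_corrP.differentiable (by simp)) x).hasDerivAt

end IsFrequency

/-- The averaged second-order motion, in terms of the logarithmic derivative of the frequency. -/
structure IsCorrection (ω a : ℝ → ℝ) (T θs : ℝ) (y₀ p₀ φb θb yb pb : ℝ → ℝ) : Prop where
  φ_init : φb 0 = p₀ 0 * corrY ω a (y₀ 0)
  y_init : yb 0 = θs * corrY ω a (y₀ 0)
  p_init : pb 0 = p₀ 0 * θs * corrP ω a (y₀ 0)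
  -- Given the other initial values, this is `θb 0 = -[θ₂](0)` multiplied by `ω (y₀ 0)`; in this
  -- form it is the second-order energy balance at time zero.
  θ_init : ω (y₀ 0) * θb 0 + p₀ 0 * pb 0 + θs * ω (y₀ 0) * a (y₀ 0) * yb 0
    + θs ^ 2 * a (y₀ 0) ^ 2 / 16 - θs * p₀ 0 ^ 2 * a (y₀ 0) * corrY ω a (y₀ 0) = 0
  φ_deriv : ∀ t ∈ Icc 0 T, HasDerivWithinAt φb (ω (y₀ t) * a (y₀ t) * yb t
    + θs * a (y₀ t) ^ 2 / 8 - p₀ t ^ 2 * a (y₀ t) * corrY ω a (y₀ t) / 2) (Icc 0 T) t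
  θ_deriv : ∀ t ∈ Icc 0 T, HasDerivWithinAt θb (4 * θs * p₀ t * corrY ω a (y₀ t) *
    (-(θs * ω (y₀ t) * a (y₀ t) * corrY ω a (y₀ t)) - p₀ t ^ 2 * corrP ω a (y₀ t))) (Icc 0 T) t
  y_deriv : ∀ t ∈ Icc 0 T, HasDerivWithinAt yb
    (pb t - θs * a (y₀ t) * p₀ t * corrY ω a (y₀ t)) (Icc 0 T) t
  p_deriv : ∀ t ∈ Icc 0 T, HasDerivWithinAt pb (-(ω (y₀ t) * a (y₀ t) * θb t)
    - θs * ω (y₀ t) * (deriv a (y₀ t) + a (y₀ t) ^ 2) * yb t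
    - θs ^ 2 * a (y₀ t) * deriv a (y₀ t) / 8
    + θs * p₀ t ^ 2 * deriv a (y₀ t) * corrY ω a (y₀ t)) (Icc 0 T) t

namespace IsFamily

variable {ω a : ℝ → ℝ} {E θs : ℝ} {φ θ y p : ℝ → ℝ → ℝ} {φ₀ y₀ p₀ φb θb yb pb : ℝ → ℝ}

/-- Energy balance at second order. -/
lemma correction_energy (F : IsFamily ω a ε₀ T E θs φ θ y p φ₀ y₀ p₀)
    (G : IsCorrection ω a T θs y₀ p₀ φb θb yb pb) : ∀ t ∈ Icc 0 T,
      ω (y₀ t) * θb t + p₀ t * pb t + θs * ω (y₀ t) * a (y₀ t) * yb t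
        + θs ^ 2 * a (y₀ t) ^ 2 / 16 - θs * p₀ t ^ 2 * a (y₀ t) * corrY ω a (y₀ t) = 0 := by
  have hd : ∀ t ∈ Icc 0 T, HasDerivWithinAt (fun t =>
      ω (y₀ t) * θb t + p₀ t * pb t + θs * ω (y₀ t) * a (y₀ t) * yb t
        + θs ^ 2 * a (y₀ t) ^ 2 / 16 - θs * p₀ t ^ 2 * a (y₀ t) * corrY ω a (y₀ t)) 0
        (Icc 0 T) t := by
    intro t ht
    have h1 := F.y₀_deriv t ht
    have h2 := F.p₀_deriv t ht
    have hω := (F.freq.hasDerivAt (y₀ t)).comp_hasDerivWithinAt t h1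
    have ha := (F.freq.hasDerivAt_log (y₀ t)).comp_hasDerivWithinAt t h1
    have hα := (F.freq.hasDerivAt_corrY (y₀ t)).comp_hasDerivWithinAt t h1
    convert! ((((hω.mul (G.θ_deriv t ht)).add (h2.mul (G.p_deriv t ht))).add
      (((hω.const_mul θs).mul ha).mul (G.y_deriv t ht))).add
      (((ha.pow 2).const_mul (θs ^ 2)).div_const 16)).sub
      ((((h2.pow 2).const_mul θs).mul ha).mul hα) using 1
    simp only [Function.comp_apply, Pi.mul_apply, Pi.pow_apply]
    have e1 := F.freq.corrY_mul (y₀ t)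
    have e2 := F.freq.corrP_mul (y₀ t)
    -- Expressing `a` and its derivative through `corrY`, `corrP` and `ω` leaves a polynomial
    -- identity.
    rw [show deriv a (y₀ t) = a (y₀ t) ^ 2 - 4 * corrP ω a (y₀ t) * ω (y₀ t) by linarith, ← e1]
    ring
  intro t ht
  exact eqOn_of_deriv_eq hd (fun t _ => hasDerivWithinAt_const t (Icc 0 T) 0) G.θ_init ht

lemma continuousOn_comp_y₀ (F : IsFamily ω a ε₀ T E θs φ θ y p φ₀ y₀ p₀) {u : ℝ → ℝ}
    (hu : ContDiff ℝ (⊤ : ℕ∞) u) : ContinuousOn (fun t => u (y₀ t)) (Icc 0 T) :=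
  hu.continuous.comp_continuousOn F.continuousOn_y₀

lemma yb_C1 (F : IsFamily ω a ε₀ T E θs φ θ y p φ₀ y₀ p₀)
    (G : IsCorrection ω a T θs y₀ p₀ φb θb yb pb) : UnifC1 ε₀ T (fun _ t => yb t) := by
  have h1 : ContinuousOn pb (Icc 0 T) := fun t ht => (G.p_deriv t ht).continuousWithinAt
  have h2 := F.continuousOn_comp_y₀ F.freq.contDiff_log
  have h3 := F.continuousOn_comp_y₀ F.freq.contDiff_corrY
  exact UnifC1.of_deriv G.y_deriv
    (h1.sub (((continuousOn_const.mul h2).mul F.continuousOn_p₀).mul h3))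

/-- The position residual, corrected by its oscillating part along the exact solution. -/
lemma hasDerivWithinAt_resY (F : IsFamily ω a ε₀ T E θs φ θ y p φ₀ y₀ p₀)
    (G : IsCorrection ω a T θs y₀ p₀ φb θb yb pb) :
    ∀ ε ∈ Ioo 0 ε₀, ∀ t ∈ Icc 0 T, HasDerivWithinAt
      (fun t => y ε t - y₀ t - ε ^ 2 * yb t
        + ε ^ 2 * (θ ε t * corrY ω a (y ε t) * fastCos φ ε t))
      (p ε t + ε * (θ ε t * a (y ε t) / 2 * fastSin φ ε t) - p₀ t
        - ε ^ 2 * (pb t - θs * a (y₀ t) * p₀ t * corrY ω a (y₀ t))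
        + ε ^ 2 * ((-(θ ε t * p ε t * a (y ε t) * fastCos φ ε t)
          - ε * (θ ε t ^ 2 * a (y ε t) ^ 2 / 2 * fastSin φ ε t * fastCos φ ε t))
            * corrY ω a (y ε t)
          - θ ε t * corrP ω a (y ε t) * (p ε t + ε * (θ ε t * a (y ε t) / 2 * fastSin φ ε t)))
          * fastCos φ ε t
        - ε * (2 * (θ ε t * corrY ω a (y ε t)) * fastSin φ ε t *
          (ω (y ε t) + ε * (p ε t * a (y ε t) / 2 * fastSin φ ε t
            + ε * (θ ε t * a (y ε t) ^ 2 / 4 * fastSin φ ε t ^ 2))))) (Icc 0 T) t := by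
  intro ε hε t ht
  have h1 := F.y_deriv ε hε t ht
  have hα := (F.freq.hasDerivAt_corrY (y ε t)).comp_hasDerivWithinAt t h1
  convert! ((h1.sub (F.y₀_deriv t ht)).sub ((G.y_deriv t ht).const_mul (ε ^ 2))).add
    ((((F.θ_deriv ε hε t ht).mul hα).mul
      (hasDerivWithinAt_fastCos (F.φ_deriv ε hε t ht))).const_mul (ε ^ 2)) using 1
  have := hε.1.ne'
  simp only [Function.comp_apply, Pi.mul_apply]
  field_simp
  ring

/-- The momentum residual, corrected by its oscillating part along the exact solution. -/
lemma hasDerivWithinAt_resP (F : IsFamily ω a ε₀ T E θs φ θ y p φ₀ y₀ p₀)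
    (G : IsCorrection ω a T θs y₀ p₀ φb θb yb pb) :
    ∀ ε ∈ Ioo 0 ε₀, ∀ t ∈ Icc 0 T, HasDerivWithinAt
      (fun t => p ε t - p₀ t - ε ^ 2 * pb t
        + ε ^ 2 * (p ε t * θ ε t * corrP ω a (y ε t) * fastCos φ ε t))
      ((-(a (y ε t) * (E - p ε t ^ 2 / 2))
        + ε * (p ε t * θ ε t * (a (y ε t) ^ 2 - deriv a (y ε t)) / 2 * fastSin φ ε t)
        + ε ^ 2 * (θ ε t ^ 2 * (a (y ε t) ^ 3 / 8 - a (y ε t) * deriv a (y ε t) / 4)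
          * fastSin φ ε t ^ 2)) + θs * ω (y₀ t) * a (y₀ t)
        - ε ^ 2 * (-(ω (y₀ t) * a (y₀ t) * θb t)
          - θs * ω (y₀ t) * (deriv a (y₀ t) + a (y₀ t) ^ 2) * yb t
          - θs ^ 2 * a (y₀ t) * deriv a (y₀ t) / 8
          + θs * p₀ t ^ 2 * deriv a (y₀ t) * corrY ω a (y₀ t))
        + ε ^ 2 * ((-(a (y ε t) * (E - p ε t ^ 2 / 2))
        + ε * (p ε t * θ ε t * (a (y ε t) ^ 2 - deriv a (y ε t)) / 2 * fastSin φ ε t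
        + ε * (θ ε t ^ 2 * (a (y ε t) ^ 3 / 8 - a (y ε t) * deriv a (y ε t) / 4)
          * fastSin φ ε t ^ 2))) * θ ε t * corrP ω a (y ε t)
          + p ε t * (-(θ ε t * p ε t * a (y ε t) * fastCos φ ε t)
          - ε * (θ ε t ^ 2 * a (y ε t) ^ 2 / 2 * fastSin φ ε t * fastCos φ ε t))
            * corrP ω a (y ε t)
          + p ε t * θ ε t * (deriv (corrP ω a) (y ε t) *
            (p ε t + ε * (θ ε t * a (y ε t) / 2 * fastSin φ ε t)))) * fastCos φ ε t
        - ε * (2 * (p ε t * θ ε t * corrP ω a (y ε t)) * fastSin φ ε t *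
          (ω (y ε t) + ε * (p ε t * a (y ε t) / 2 * fastSin φ ε t
            + ε * (θ ε t * a (y ε t) ^ 2 / 4 * fastSin φ ε t ^ 2))))) (Icc 0 T) t := by
  intro ε hε t ht
  have h1 := F.y_deriv ε hε t ht
  have hb := (F.freq.hasDerivAt_corrP (y ε t)).comp_hasDerivWithinAt t h1
  convert! (((F.p_deriv ε hε t ht).sub (F.p₀_deriv t ht)).sub
    ((G.p_deriv t ht).const_mul (ε ^ 2))).add
    (((((F.p_deriv ε hε t ht).mul (F.θ_deriv ε hε t ht)).mul hb).mul
      (hasDerivWithinAt_fastCos (F.φ_deriv ε hε t ht))).const_mul (ε ^ 2)) using 1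
  have := hε.1.ne'
  simp only [Function.comp_apply, Pi.mul_apply]
  field_simp
  ring

/-- The phase residual, corrected by its oscillating part along the exact solution. -/
lemma hasDerivWithinAt_resφ (F : IsFamily ω a ε₀ T E θs φ θ y p φ₀ y₀ p₀)
    (G : IsCorrection ω a T θs y₀ p₀ φb θb yb pb) :
    ∀ ε ∈ Ioo 0 ε₀, ∀ t ∈ Icc 0 T, HasDerivWithinAt
      (fun t => φ ε t - φ₀ t - ε ^ 2 * φb t
        + ε ^ 2 * (p ε t * corrY ω a (y ε t) * fastCos φ ε t))
      ((ω (y ε t) + ε * (p ε t * a (y ε t) / 2 * fastSin φ ε t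
            + ε * (θ ε t * a (y ε t) ^ 2 / 4 * fastSin φ ε t ^ 2))) - ω (y₀ t)
        - ε ^ 2 * (ω (y₀ t) * a (y₀ t) * yb t
          + θs * a (y₀ t) ^ 2 / 8 - p₀ t ^ 2 * a (y₀ t) * corrY ω a (y₀ t) / 2)
        + ε ^ 2 * ((-(a (y ε t) * (E - p ε t ^ 2 / 2))
        + ε * (p ε t * θ ε t * (a (y ε t) ^ 2 - deriv a (y ε t)) / 2 * fastSin φ ε t
        + ε * (θ ε t ^ 2 * (a (y ε t) ^ 3 / 8 - a (y ε t) * deriv a (y ε t) / 4)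
          * fastSin φ ε t ^ 2))) * corrY ω a (y ε t)
          - p ε t * corrP ω a (y ε t) * (p ε t + ε * (θ ε t * a (y ε t) / 2 * fastSin φ ε t)))
          * fastCos φ ε t
        - ε * (2 * (p ε t * corrY ω a (y ε t)) * fastSin φ ε t *
          (ω (y ε t) + ε * (p ε t * a (y ε t) / 2 * fastSin φ ε t
            + ε * (θ ε t * a (y ε t) ^ 2 / 4 * fastSin φ ε t ^ 2))))) (Icc 0 T) t := by
  intro ε hε t ht
  have h1 := F.y_deriv ε hε t ht
  have hα := (F.freq.hasDerivAt_corrY (y ε t)).comp_hasDerivWithinAt t h1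
  convert! (((F.φ_deriv ε hε t ht).sub (F.φ₀_deriv t ht)).sub
    ((G.φ_deriv t ht).const_mul (ε ^ 2))).add
    ((((F.p_deriv ε hε t ht).mul hα).mul
      (hasDerivWithinAt_fastCos (F.φ_deriv ε hε t ht))).const_mul (ε ^ 2)) using 1
  have := hε.1.ne'
  simp only [Function.comp_apply, Pi.mul_apply]
  field_simp
  ring

end IsFamily

end FastSlow

namespace FastSlow

/-! ### Residuals up to third order in `ε` -/

namespace IsFamily

variable {ε₀ T : ℝ} {ω a : ℝ → ℝ} {E θs : ℝ} {φ θ y p : ℝ → ℝ → ℝ}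
  {φ₀ y₀ p₀ φb θb yb pb : ℝ → ℝ}

lemma fastCos_init (F : IsFamily ω a ε₀ T E θs φ θ y p φ₀ y₀ p₀) {ε : ℝ} (hε : ε ∈ Ioo 0 ε₀) :
    fastCos φ ε 0 = 1 := by
  simp [fastCos, F.φ_init ε hε]

lemma θ_sub' (F : IsFamily ω a ε₀ T E θs φ θ y p φ₀ y₀ p₀) :
    UnifO ε₀ T 1 (fun ε t => θ ε t - (fun _ _ => θs) ε t) := F.θ_sub

lemma p_sub_one (F : IsFamily ω a ε₀ T E θs φ θ y p φ₀ y₀ p₀) :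
    UnifO ε₀ T 1 (fun ε t => p ε t - (fun _ t => p₀ t) ε t) := UnifO.of_add 1 F.y_p_sub.2

lemma comp_y_sub_one (F : IsFamily ω a ε₀ T E θs φ θ y p φ₀ y₀ p₀) {u : ℝ → ℝ}
    (hu : ContDiff ℝ (⊤ : ℕ∞) u) :
    UnifO ε₀ T 1 (fun ε t => (fun ε t => u (y ε t)) ε t - (fun _ t => u (y₀ t)) ε t) :=
  UnifO.of_add 1 (F.comp_y_sub hu)

/-- Position and momentum up to `O(ε³)`. -/
lemma resY_resP (F : IsFamily ω a ε₀ T E θs φ θ y p φ₀ y₀ p₀)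
    (G : IsCorrection ω a T θs y₀ p₀ φb θb yb pb) :
    UnifO ε₀ T 3 (fun ε t => y ε t - y₀ t - ε ^ 2 * yb t
        + ε ^ 2 * (θ ε t * corrY ω a (y ε t) * fastCos φ ε t)) ∧
    UnifO ε₀ T 3 (fun ε t => p ε t - p₀ t - ε ^ 2 * pb t
        + ε ^ 2 * (p ε t * θ ε t * corrP ω a (y ε t) * fastCos φ ε t)) := by
  have hf := F.freq
  have hC : UnifBdd ε₀ T (fastCos φ) := fastCos_bdd φ
  have hS : UnifBdd ε₀ T (fastSin φ) := fastSin_bdd φ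
  have hθ := F.θ_bdd
  have hp := F.p_bdd
  have hp0 := F.p₀_bdd
  have ha := F.comp_y_bdd hf.contDiff_log.continuous
  have ha1 := F.comp_y_bdd hf.contDiff_deriv.continuous
  have hα := F.comp_y_bdd hf.contDiff_corrY.continuous
  have hb := F.comp_y_bdd hf.contDiff_corrP.continuous
  have hb1 := F.comp_y_bdd (hf.contDiff_corrP.continuous_deriv (by simp))
  have ha0 := F.comp_y₀_bdd hf.contDiff_log.continuous
  have ha10 := F.comp_y₀_bdd hf.contDiff_deriv.continuous
  have hα0 := F.comp_y₀_bdd hf.contDiff_corrY.continuous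
  have hb0 := F.comp_y₀_bdd hf.contDiff_corrP.continuous
  have cθ := F.θ_C1
  have cp := F.p_C1
  have cp0 := F.p₀_C1
  have ca := F.y_C1.comp hf.contDiff_log
  have ca1 := F.y_C1.comp hf.contDiff_deriv
  have cα := F.y_C1.comp hf.contDiff_corrY
  have cb := F.y_C1.comp hf.contDiff_corrP
  have cb1 := F.y_C1.comp (contDiff_infty_iff_deriv.1 hf.contDiff_corrP).2
  have ca0 := F.y₀_C1.comp hf.contDiff_log
  have ca10 := F.y₀_C1.comp hf.contDiff_deriv
  have hθs : UnifBdd ε₀ T (fun _ _ => θs) := UnifBdd.const θs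
  have dθ := F.θ_sub'
  have dp := F.p_sub_one
  have da := F.comp_y_sub_one hf.contDiff_log
  have da1 := F.comp_y_sub_one hf.contDiff_deriv
  have dα := F.comp_y_sub_one hf.contDiff_corrY
  have db := F.comp_y_sub_one hf.contDiff_corrP
  -- The coefficients are the linearization at `(y₀, p₀)` of the fixed-energy flow `y' = p`, `p' =
  -- -a(y) (E - p²/2)`.
  refine unifO_of_planar_linear F.T_pos.le
    (c₁ := fun _ _ => 0) (c₂ := fun _ _ => 1)
    (c₃ := fun ε t => -(deriv a (y₀ t) * (E - p₀ t ^ 2 / 2))) (c₄ := fun ε t => a (y₀ t) * p₀ t)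
    (F.hasDerivWithinAt_resY G) (F.hasDerivWithinAt_resP G)
    (fun ε hε => ?_) (fun ε hε => ?_)
    (UnifBdd.const _) (UnifBdd.const _) ?_ ?_ ?_ ?_
  · rw [F.fastCos_init hε, F.y_init ε hε, F.θ_init ε hε, G.y_init]
    ring
  · rw [F.fastCos_init hε, F.y_init ε hε, F.θ_init ε hε, F.p_init ε hε, G.p_init]
    ring
  · repeat' with_reducible first
      | assumption | apply UnifBdd.const | apply UnifBdd.eps | apply UnifBdd.add
      | apply UnifBdd.sub | apply UnifBdd.neg | apply UnifBdd.mul | apply UnifBdd.pow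
      | apply UnifBdd.div_const
  · exact ha0.mul hp0
  · have osc := (F.avgO_mul_cos (((cp.mul cθ).mul cb).mul (UnifC1.const (-2)))).eps_mul 2
    -- A `cos²` from `θ'` and a `sin²` from `φ'` occur with equal coefficients, so they add up to
    -- the drift `-θ p a corrY` of `yb` without leaving an oscillating part.
    have mean : UnifO ε₀ T 1 (fun ε t => θ ε t * p ε t * a (y ε t) * corrY ω a (y ε t)
        - θs * p₀ t * a (y₀ t) * corrY ω a (y₀ t)) :=
      ((dθ.mul_sub_mul dp hθ hp0).mul_sub_mul da (hθ.mul hp) ha0).mul_sub_mul dα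
        ((hθ.mul hp).mul ha) hα0
    have rem : UnifBdd ε₀ T (fun ε t => -(2 * θ ε t * corrY ω a (y ε t) * (θ ε t * a (y ε t) ^ 2 / 4
          * fastSin φ ε t ^ 2) * fastSin φ ε t)
        - θ ε t ^ 2 * a (y ε t) ^ 2 / 2 * fastSin φ ε t * fastCos φ ε t * corrY ω a (y ε t)
          * fastCos φ ε t
        - θ ε t * corrP ω a (y ε t) * (θ ε t * a (y ε t) / 2 * fastSin φ ε t) * fastCos φ ε t) := by
      repeat' with_reducible first
      | assumption | apply UnifBdd.const | apply UnifBdd.eps | apply UnifBdd.add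
      | apply UnifBdd.sub | apply UnifBdd.neg | apply UnifBdd.mul | apply UnifBdd.pow
      | apply UnifBdd.div_const
    refine ((osc.add (AvgO.of_unifO (mean.neg.eps_mul 2))).add
      (AvgO.of_unifO (rem.unifO.eps_mul 3))).congr fun ε hε t ht => ?_
    -- `e1` cancels the sine of order `ε`; `e2` merges the two squares.
    have e1 := hf.corrY_mul (y ε t)
    have e2 := fastSin_sq_add φ ε t
    linear_combination -(ε * θ ε t * fastSin φ ε t / 2) * e1 -
      ε ^ 2 * (θ ε t * p ε t * a (y ε t) * corrY ω a (y ε t)) * e2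
  · obtain ⟨q, hq, hqe⟩ := F.comp_y_taylor hf.contDiff_log
    obtain ⟨A, hA, hAe⟩ := (F.comp_y_sub hf.contDiff_log).exists_eq_mul
    obtain ⟨P, hP, hPe⟩ := F.y_p_sub.2.exists_eq_mul
    have osc₁ := (F.avgO_mul_cos (g := fun ε t =>
      deriv a (y₀ t) * (E - p₀ t ^ 2 / 2) * (θ ε t * corrY ω a (y ε t))
      - a (y₀ t) * p₀ t * (p ε t * θ ε t * corrP ω a (y ε t))
      - a (y ε t) * (E - p ε t ^ 2 / 2) * θ ε t * corrP ω a (y ε t)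
      + p ε t ^ 2 * θ ε t * deriv (corrP ω a) (y ε t)) (by
        repeat' with_reducible first
        | assumption | apply UnifC1.const | apply UnifC1.add
        | apply UnifC1.sub | apply UnifC1.neg | apply UnifC1.mul | apply UnifC1.pow
        | apply UnifC1.div_const)).eps_mul 2
    have osc₂ := (F.avgO_mul_cos_two (g := fun ε t =>
      -(θ ε t ^ 2 * (a (y ε t) ^ 3 / 8 - a (y ε t) * deriv a (y ε t) / 4) / 2)) (by
        repeat' with_reducible first
        | assumption | apply UnifC1.const | apply UnifC1.add
        | apply UnifC1.sub | apply UnifC1.neg | apply UnifC1.mul | apply UnifC1.pow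
        | apply UnifC1.div_const)).eps_mul 2
    have mean₁ : UnifO ε₀ T 1 (fun ε t => p ε t * p ε t * θ ε t * a (y ε t) * corrP ω a (y ε t)
        - p₀ t * p₀ t * θs * a (y₀ t) * corrP ω a (y₀ t)) :=
      (((dp.mul_sub_mul dp hp hp0).mul_sub_mul dθ (hp.mul hp) hθs).mul_sub_mul da
        ((hp.mul hp).mul hθ) ha0).mul_sub_mul db (((hp.mul hp).mul hθ).mul ha) hb0
    have dθθ := dθ.mul_sub_mul dθ hθ hθs
    have mean₂ : UnifO ε₀ T 1 (fun ε t => θ ε t * θ ε t * a (y ε t) * a (y ε t) * a (y ε t)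
        - θs * θs * a (y₀ t) * a (y₀ t) * a (y₀ t)) :=
      ((dθθ.mul_sub_mul da (hθ.mul hθ) ha0).mul_sub_mul da
        ((hθ.mul hθ).mul ha) ha0).mul_sub_mul da (((hθ.mul hθ).mul ha).mul ha) ha0
    have mean₃ : UnifO ε₀ T 1 (fun ε t => θ ε t * θ ε t * a (y ε t) * deriv a (y ε t)
        - θs * θs * a (y₀ t) * deriv a (y₀ t)) :=
      (dθθ.mul_sub_mul da (hθ.mul hθ) ha0).mul_sub_mul da1
        ((hθ.mul hθ).mul ha) ha10
    have mean := (mean₁.neg.add (UnifO.bdd_mul (UnifBdd.const (1 / 16)) mean₂)).sub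
      (UnifO.bdd_mul (UnifBdd.const (1 / 8)) mean₃)
    have rem₁ : UnifBdd ε₀ T (fun ε t =>
        (p ε t * θ ε t * (a (y ε t) ^ 2 - deriv a (y ε t)) / 2 * fastSin φ ε t
          + ε * (θ ε t ^ 2 * (a (y ε t) ^ 3 / 8 - a (y ε t) * deriv a (y ε t) / 4)
          * fastSin φ ε t ^ 2)) * θ ε t * corrP ω a (y ε t) * fastCos φ ε t
        - p ε t * (θ ε t ^ 2 * a (y ε t) ^ 2 / 2 * fastSin φ ε t * fastCos φ ε t)
            * corrP ω a (y ε t) * fastCos φ ε t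
        + p ε t * θ ε t * (deriv (corrP ω a) (y ε t) *
            (θ ε t * a (y ε t) / 2 * fastSin φ ε t)) * fastCos φ ε t
        - 2 * (p ε t * θ ε t * corrP ω a (y ε t)) * fastSin φ ε t *
          (θ ε t * a (y ε t) ^ 2 / 4 * fastSin φ ε t ^ 2)) := by
      repeat' with_reducible first
      | assumption | apply UnifBdd.const | apply UnifBdd.eps | apply UnifBdd.add
      | apply UnifBdd.sub | apply UnifBdd.neg | apply UnifBdd.mul | apply UnifBdd.pow
      | apply UnifBdd.div_const
    have rem₂ : UnifBdd ε₀ T (fun ε t => ε * (-(q ε t * (E - p₀ t ^ 2 / 2)) + A ε t * p₀ t * P ε t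
        + a (y ε t) * P ε t ^ 2 / 2)) := by
      repeat' with_reducible first
      | assumption | apply UnifBdd.const | apply UnifBdd.eps | apply UnifBdd.add
      | apply UnifBdd.sub | apply UnifBdd.neg | apply UnifBdd.mul | apply UnifBdd.pow
      | apply UnifBdd.div_const
    refine (((osc₁.add osc₂).add (AvgO.of_unifO (mean.eps_mul 2))).add
      (AvgO.of_unifO ((rem₁.add rem₂).unifO.eps_mul 3))).congr fun ε hε t ht => ?_
    have e1 := hf.corrP_mul (y ε t)
    have e2 := fastSin_sq_add φ ε t
    -- `e3` removes `θb` from the equation of `pb`, just as the exact energy removed `θ`; what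
    -- remains is linear in `yb`, `pb` with the coefficients `c₃`, `c₄`.
    have e3 := F.correction_energy G t ht
    have e4 := F.energy₀ t ht
    have e5 := hqe ε hε t ht
    have e6 := hAe ε hε t ht
    have e7 := hPe ε hε t ht
    have e8 := hf.corrY_mul (y₀ t)
    have e9 := hf.corrP_mul (y₀ t)
    linear_combination (a (y₀ t) + ε ^ 2 * deriv a (y₀ t) * yb t) * e4 - (E - p₀ t ^ 2 / 2) * e5
      + p₀ t * (p ε t - p₀ t) * e6 + p₀ t * ε ^ 2 * A ε t * e7
      + a (y ε t) / 2 * (p ε t - p₀ t + ε ^ 2 * P ε t) * e7 + ε ^ 2 * a (y₀ t) * e3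
      + ε ^ 2 * θs * p₀ t ^ 2 * (corrP ω a (y₀ t) * e8 - corrY ω a (y₀ t) * e9)
      - ε * p ε t * θ ε t * fastSin φ ε t / 2 * e1
      + ε ^ 2 * (θ ε t ^ 2 * (a (y ε t) ^ 3 / 8 - a (y ε t) * deriv a (y ε t) / 4) / 2
        - p ε t ^ 2 * θ ε t * a (y ε t) * corrP ω a (y ε t)) * e2

/-- The phase up to `O(ε³)`. -/
lemma resφ (F : IsFamily ω a ε₀ T E θs φ θ y p φ₀ y₀ p₀)
    (G : IsCorrection ω a T θs y₀ p₀ φb θb yb pb) :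
    UnifO ε₀ T 3 (fun ε t => φ ε t - φ₀ t - ε ^ 2 * φb t
        + ε ^ 2 * (p ε t * corrY ω a (y ε t) * fastCos φ ε t)) := by
  have hf := F.freq
  have hC : UnifBdd ε₀ T (fastCos φ) := fastCos_bdd φ
  have hS : UnifBdd ε₀ T (fastSin φ) := fastSin_bdd φ
  have hθ := F.θ_bdd
  have hp := F.p_bdd
  have hp0 := F.p₀_bdd
  have ha := F.comp_y_bdd hf.contDiff_log.continuous
  have ha1 := F.comp_y_bdd hf.contDiff_deriv.continuous
  have hα := F.comp_y_bdd hf.contDiff_corrY.continuous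
  have hb := F.comp_y_bdd hf.contDiff_corrP.continuous
  have ha0 := F.comp_y₀_bdd hf.contDiff_log.continuous
  have hα0 := F.comp_y₀_bdd hf.contDiff_corrY.continuous
  have hω0 := F.comp_y₀_bdd hf.contDiff.continuous
  have cθ := F.θ_C1
  have cp := F.p_C1
  have ca := F.y_C1.comp hf.contDiff_log
  have cα := F.y_C1.comp hf.contDiff_corrY
  have cb := F.y_C1.comp hf.contDiff_corrP
  have ca0 := F.y₀_C1.comp hf.contDiff_log
  have cω0 := F.y₀_C1.comp hf.contDiff
  have dp := F.p_sub_one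
  have da := F.comp_y_sub_one hf.contDiff_log
  have dα := F.comp_y_sub_one hf.contDiff_corrY
  obtain ⟨q, hq, hqe⟩ := F.comp_y_taylor hf.contDiff
  -- With the position known up to `O(ε³)`, the increment `ω(y) - ω(y₀)` is known to the same order,
  -- and the phase follows by integration alone.
  obtain ⟨U, hU, hUe⟩ := (F.resY_resP G).1.exists_eq_mul
  refine unifO_of_deriv_avgO F.T_pos.le (F.hasDerivWithinAt_resφ G) (fun ε hε => ?_) ?_
  · rw [F.fastCos_init hε, F.y_init ε hε, F.p_init ε hε, F.φ_init ε hε, F.φ₀_init, G.φ_init]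
    ring
  have osc₁ := (F.avgO_mul_cos (g := fun ε t =>
      -(ω (y₀ t) * a (y₀ t) * (θ ε t * corrY ω a (y ε t)))
      - a (y ε t) * (E - p ε t ^ 2 / 2) * corrY ω a (y ε t)
      - p ε t ^ 2 * corrP ω a (y ε t)) (by
        repeat' with_reducible first
        | assumption | apply UnifC1.const | apply UnifC1.add
        | apply UnifC1.sub | apply UnifC1.neg | apply UnifC1.mul | apply UnifC1.pow
        | apply UnifC1.div_const)).eps_mul 2
  have osc₂ := (F.avgO_mul_cos_two (g := fun ε t =>
      p ε t ^ 2 * a (y ε t) * corrY ω a (y ε t) / 2 - θ ε t * a (y ε t) ^ 2 / 8) (by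
        repeat' with_reducible first
        | assumption | apply UnifC1.const | apply UnifC1.add
        | apply UnifC1.sub | apply UnifC1.neg | apply UnifC1.mul | apply UnifC1.pow
        | apply UnifC1.div_const)).eps_mul 2
  have mean₁ : UnifO ε₀ T 1 (fun ε t => p ε t * p ε t * a (y ε t) * corrY ω a (y ε t)
      - p₀ t * p₀ t * a (y₀ t) * corrY ω a (y₀ t)) :=
    ((dp.mul_sub_mul dp hp hp0).mul_sub_mul da (hp.mul hp) ha0).mul_sub_mul dα
      ((hp.mul hp).mul ha) hα0
  have mean₂ : UnifO ε₀ T 1 (fun ε t => θ ε t * a (y ε t) * a (y ε t)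
      - θs * a (y₀ t) * a (y₀ t)) :=
    (F.θ_sub'.mul_sub_mul da hθ ha0).mul_sub_mul da (hθ.mul ha) ha0
  have mean := (UnifO.bdd_mul (UnifBdd.const (1 / 8)) mean₂).sub
    (UnifO.bdd_mul (UnifBdd.const (1 / 2)) mean₁)
  have rem : UnifBdd ε₀ T (fun ε t => ε * q ε t + ω (y₀ t) * a (y₀ t) * U ε t
      + (p ε t * θ ε t * (a (y ε t) ^ 2 - deriv a (y ε t)) / 2 * fastSin φ ε t
        + ε * (θ ε t ^ 2 * (a (y ε t) ^ 3 / 8 - a (y ε t) * deriv a (y ε t) / 4)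
          * fastSin φ ε t ^ 2)) * corrY ω a (y ε t) * fastCos φ ε t
      - p ε t * corrP ω a (y ε t) * (θ ε t * a (y ε t) / 2 * fastSin φ ε t) * fastCos φ ε t
      - 2 * (p ε t * corrY ω a (y ε t)) * fastSin φ ε t *
          (θ ε t * a (y ε t) ^ 2 / 4 * fastSin φ ε t ^ 2)) := by
    repeat' with_reducible first
      | assumption | apply UnifBdd.const | apply UnifBdd.eps | apply UnifBdd.add
      | apply UnifBdd.sub | apply UnifBdd.neg | apply UnifBdd.mul | apply UnifBdd.pow
      | apply UnifBdd.div_const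
  refine (((osc₁.add osc₂).add (AvgO.of_unifO (mean.eps_mul 2))).add
    (AvgO.of_unifO (rem.unifO.eps_mul 3))).congr fun ε hε t ht => ?_
  have e1 := hf.corrY_mul (y ε t)
  have e2 := fastSin_sq_add φ ε t
  have e3 := hqe ε hε t ht
  have e4 := hUe ε hε t ht
  rw [hf.deriv_eq] at e3
  linear_combination e3 + ω (y₀ t) * a (y₀ t) * e4 - ε * p ε t * fastSin φ ε t / 2 * e1
    + ε ^ 2 * (θ ε t * a (y ε t) ^ 2 / 8 - p ε t ^ 2 * a (y ε t) * corrY ω a (y ε t) / 2) * e2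

end IsFamily

end FastSlow

namespace FastSlow

namespace IsFamily

variable {ε₀ T : ℝ} {ω a : ℝ → ℝ} {E θs : ℝ} {φ θ y p : ℝ → ℝ → ℝ}
  {φ₀ y₀ p₀ φb θb yb pb : ℝ → ℝ}

/-! ### Passing to the leading-order phase -/

/-- The fast phase shifts by `2 ε Φ` with `Φ` bounded. The sine is expanded one order further than
the cosine because it enters the energy with only one factor `ε`. -/
lemma fast_taylor (F : IsFamily ω a ε₀ T E θs φ θ y p φ₀ y₀ p₀) :
    ∃ q r Φ, UnifBdd ε₀ T q ∧ UnifBdd ε₀ T r ∧ UnifBdd ε₀ T Φ ∧ ∀ ε ∈ Ioo 0 ε₀, ∀ t ∈ Icc 0 T,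
      φ ε t - φ₀ t = ε ^ 2 * Φ ε t ∧
      fastSin φ ε t = fastSin (fun _ => φ₀) ε t + 2 * ε * Φ ε t * fastCos (fun _ => φ₀) ε t
        + ε ^ 2 * q ε t ∧
      fastCos φ ε t = fastCos (fun _ => φ₀) ε t + ε * r ε t := by
  obtain ⟨Φ, hΦ, hΦe⟩ := F.φ_sub.exists_eq_mul
  have hh : UnifBdd ε₀ T (fun ε t => 2 * ε * Φ ε t) :=
    ((UnifBdd.const 2).mul UnifBdd.eps).mul hΦ
  have h0 : UnifBdd ε₀ T (fun _ _ => 0) := UnifBdd.const 0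
  obtain ⟨s, hs, hse⟩ := UnifBdd.exists_taylor Real.contDiff_sin hh h0
  obtain ⟨c, hc, hce⟩ := UnifBdd.exists_taylor Real.contDiff_cos hh h0
  have hS : UnifBdd ε₀ T (fastSin (fun _ => φ₀)) := fastSin_bdd _
  have hC : UnifBdd ε₀ T (fastCos (fun _ => φ₀)) := fastCos_bdd _
  refine ⟨fun ε t => 4 * Φ ε t ^ 2 * (fastSin (fun _ => φ₀) ε t * c ε t
      + fastCos (fun _ => φ₀) ε t * s ε t),
    fun ε t => 4 * ε * Φ ε t ^ 2 * (fastCos (fun _ => φ₀) ε t * c ε t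
      - fastSin (fun _ => φ₀) ε t * s ε t) - 2 * Φ ε t * fastSin (fun _ => φ₀) ε t, Φ, ?_, ?_, hΦ,
    fun ε hε t ht => ?_⟩
  · repeat' with_reducible first
      | assumption | apply UnifBdd.const | apply UnifBdd.eps | apply UnifBdd.add
      | apply UnifBdd.sub | apply UnifBdd.neg | apply UnifBdd.mul | apply UnifBdd.pow
  · repeat' with_reducible first
      | assumption | apply UnifBdd.const | apply UnifBdd.eps | apply UnifBdd.add
      | apply UnifBdd.sub | apply UnifBdd.neg | apply UnifBdd.mul | apply UnifBdd.pow
  · have e := hΦe ε hε t ht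
    have arg : 2 * φ ε t / ε = 2 * φ₀ t / ε + 2 * ε * Φ ε t := by
      rw [show φ ε t = φ₀ t + ε ^ 2 * Φ ε t by linarith]
      field_simp
    have e1 := hse ε t
    have e2 := hce ε t
    simp only [Real.sin_zero, Real.cos_zero, Real.deriv_sin, Real.deriv_cos', neg_zero] at e1 e2
    refine ⟨e, ?_, ?_⟩
    · unfold fastSin fastCos
      rw [arg, Real.sin_add]
      linear_combination Real.sin (2 * φ₀ t / ε) * e2 + Real.cos (2 * φ₀ t / ε) * e1
    · unfold fastSin fastCos
      rw [arg, Real.cos_add]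
      linear_combination Real.cos (2 * φ₀ t / ε) * e2 - Real.sin (2 * φ₀ t / ε) * e1

lemma fastSin_sub (F : IsFamily ω a ε₀ T E θs φ θ y p φ₀ y₀ p₀) :
    UnifO ε₀ T 1 (fun ε t => fastSin φ ε t - fastSin (fun _ => φ₀) ε t) := by
  obtain ⟨q, r, Φ, hq, hr, hΦ, h⟩ := F.fast_taylor
  refine UnifO.of_eq_mul (g := fun ε t => 2 * Φ ε t * fastCos (fun _ => φ₀) ε t + ε * q ε t)
    ((((UnifBdd.const 2).mul hΦ).mul (fastCos_bdd _)).add (UnifBdd.eps.mul hq))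
    fun ε hε t ht => ?_
  linear_combination (h ε hε t ht).2.1

lemma fastCos_sub (F : IsFamily ω a ε₀ T E θs φ θ y p φ₀ y₀ p₀) :
    UnifO ε₀ T 1 (fun ε t => fastCos φ ε t - fastCos (fun _ => φ₀) ε t) := by
  obtain ⟨q, r, Φ, hq, hr, hΦ, h⟩ := F.fast_taylor
  exact UnifO.of_eq_mul hr fun ε hε t ht => by linear_combination (h ε hε t ht).2.2

/-! ### Second-order expansions -/

/-- The corrector already carries `ε²`, so replacing the exact motion in it by the leading-order
motion costs only `O(ε³)`. The same holds for `p` and `φ`. -/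
lemma y_expansion (F : IsFamily ω a ε₀ T E θs φ θ y p φ₀ y₀ p₀)
    (G : IsCorrection ω a T θs y₀ p₀ φb θb yb pb) :
    UnifO ε₀ T 3 (fun ε t => y ε t - y₀ t
      - ε ^ 2 * (yb t - θs * corrY ω a (y₀ t) * fastCos (fun _ => φ₀) ε t)) := by
  have hα := F.comp_y_bdd F.freq.contDiff_corrY.continuous
  have hα0 := F.comp_y₀_bdd F.freq.contDiff_corrY.continuous
  have d := (F.θ_sub'.mul_sub_mul (F.comp_y_sub_one F.freq.contDiff_corrY) F.θ_bdd
    hα0).mul_sub_mul F.fastCos_sub (F.θ_bdd.mul hα) (fastCos_bdd _)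
  exact ((F.resY_resP G).1.sub (d.eps_mul 2)).congr fun ε _ t _ => by ring

lemma p_expansion (F : IsFamily ω a ε₀ T E θs φ θ y p φ₀ y₀ p₀)
    (G : IsCorrection ω a T θs y₀ p₀ φb θb yb pb) :
    UnifO ε₀ T 3 (fun ε t => p ε t - p₀ t
      - ε ^ 2 * (pb t - p₀ t * θs * corrP ω a (y₀ t) * fastCos (fun _ => φ₀) ε t)) := by
  have hb := F.comp_y_bdd F.freq.contDiff_corrP.continuous
  have hb0 := F.comp_y₀_bdd F.freq.contDiff_corrP.continuous
  have d := ((F.p_sub_one.mul_sub_mul F.θ_sub' F.p_bdd (UnifBdd.const θs)).mul_sub_mul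
    (F.comp_y_sub_one F.freq.contDiff_corrP) (F.p_bdd.mul F.θ_bdd) hb0).mul_sub_mul
    F.fastCos_sub ((F.p_bdd.mul F.θ_bdd).mul hb) (fastCos_bdd _)
  exact ((F.resY_resP G).2.sub (d.eps_mul 2)).congr fun ε _ t _ => by ring

lemma φ_expansion (F : IsFamily ω a ε₀ T E θs φ θ y p φ₀ y₀ p₀)
    (G : IsCorrection ω a T θs y₀ p₀ φb θb yb pb) :
    UnifO ε₀ T 3 (fun ε t => φ ε t - φ₀ t
      - ε ^ 2 * (φb t - p₀ t * corrY ω a (y₀ t) * fastCos (fun _ => φ₀) ε t)) := by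
  have hα := F.comp_y_bdd F.freq.contDiff_corrY.continuous
  have hα0 := F.comp_y₀_bdd F.freq.contDiff_corrY.continuous
  have d := (F.p_sub_one.mul_sub_mul (F.comp_y_sub_one F.freq.contDiff_corrY) F.p_bdd
    hα0).mul_sub_mul F.fastCos_sub (F.p_bdd.mul hα) (fastCos_bdd _)
  exact ((F.resφ G).sub (d.eps_mul 2)).congr fun ε _ t _ => by ring

/-- First-order expansion of the action. -/
lemma θ_expansion_one (F : IsFamily ω a ε₀ T E θs φ θ y p φ₀ y₀ p₀) :
    UnifO ε₀ T 2 (fun ε t => θ ε t - θs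
      + ε * (2 * θs * p₀ t * corrY ω a (y₀ t) * fastSin (fun _ => φ₀) ε t)) := by
  have hf := F.freq
  have hp := F.p_bdd
  have hp0 := F.p₀_bdd
  have hθ := F.θ_bdd
  have ha := F.comp_y_bdd hf.contDiff_log.continuous
  have ha0 := F.comp_y₀_bdd hf.contDiff_log.continuous
  have hS : UnifBdd ε₀ T (fastSin φ) := fastSin_bdd _
  have hw0 := F.comp_y₀_bdd hf.contDiff_inv.continuous
  -- The energy difference is solved for `ω(y₀) (θ - θs)`. Only `-ε p θ a sin/2` is of first order;
  -- `d₂` replaces its factors by their leading parts, while `d₁`, `d₃`, `d₄` are `O(ε²)`.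
  have d₁ := UnifO.bdd_mul ((hp.add hp0).div_const 2) F.y_p_sub.2
  have d₂ := (((F.p_sub_one.mul_sub_mul F.θ_sub' hp (UnifBdd.const θs)).mul_sub_mul
    (F.comp_y_sub_one hf.contDiff_log) (hp.mul hθ) ha0).mul_sub_mul F.fastSin_sub
    ((hp.mul hθ).mul ha) (fastSin_bdd _)).eps_mul 1
  have d₃ := UnifO.bdd_mul hθ (F.comp_y_sub hf.contDiff)
  have d₄ : UnifBdd ε₀ T (fun ε t => θ ε t ^ 2 * a (y ε t) ^ 2 * fastSin φ ε t ^ 2 / 8) := by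
    repeat' with_reducible first
      | assumption | apply UnifBdd.mul | apply UnifBdd.pow | apply UnifBdd.div_const
  refine (UnifO.bdd_mul hw0 (((d₁.add (UnifO.bdd_mul (UnifBdd.const (1 / 2)) d₂)).add d₃).add
    (d₄.unifO.eps_mul 2)).neg).congr fun ε hε t ht => ?_
  have e1 := F.energy ε hε t ht
  have e2 := F.energy₀ t ht
  have e3 := hf.inv_mul (y₀ t)
  have e4 := hf.corrY_mul (y₀ t)
  linear_combination (ω (y₀ t))⁻¹ * (e1 - e2) - (θ ε t - θs
    + ε * (2 * θs * p₀ t * corrY ω a (y₀ t) * fastSin (fun _ => φ₀) ε t)) * e3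
    + (ω (y₀ t))⁻¹ * ε * θs * p₀ t * fastSin (fun _ => φ₀) ε t / 2 * e4

/-- Second-order expansion of the action. -/
lemma θ_expansion_two (F : IsFamily ω a ε₀ T E θs φ θ y p φ₀ y₀ p₀)
    (G : IsCorrection ω a T θs y₀ p₀ φb θb yb pb) :
    UnifO ε₀ T 3 (fun ε t => θ ε t - θs
      + ε * (2 * θs * p₀ t * corrY ω a (y₀ t) * fastSin (fun _ => φ₀) ε t)
      - ε ^ 2 * (θb t + θs ^ 2 * a (y₀ t) * corrY ω a (y₀ t) * fastCos (fun _ => φ₀) ε t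
        + θs * p₀ t ^ 2 * corrP ω a (y₀ t) * (ω (y₀ t))⁻¹ * fastCos (fun _ => φ₀) ε t
        + θs ^ 2 * a (y₀ t) * corrY ω a (y₀ t) / 4 *
          (fastCos (fun _ => φ₀) ε t ^ 2 - fastSin (fun _ => φ₀) ε t ^ 2)
        - 4 * θs * p₀ t * corrY ω a (y₀ t) * φb t * fastCos (fun _ => φ₀) ε t)) := by
  have hf := F.freq
  have hp := F.p_bdd
  have hp0 := F.p₀_bdd
  have hθ := F.θ_bdd
  have ha := F.comp_y_bdd hf.contDiff_log.continuous
  have ha0 := F.comp_y₀_bdd hf.contDiff_log.continuous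
  have hα0 := F.comp_y₀_bdd hf.contDiff_corrY.continuous
  have hω0 := F.comp_y₀_bdd hf.contDiff.continuous
  have hS : UnifBdd ε₀ T (fastSin φ) := fastSin_bdd _
  have hS0 : UnifBdd ε₀ T (fastSin (fun _ => φ₀)) := fastSin_bdd _
  have hC0 : UnifBdd ε₀ T (fastCos (fun _ => φ₀)) := fastCos_bdd _
  have hw0 := F.comp_y₀_bdd hf.contDiff_inv.continuous
  have hyb := (F.yb_C1 G).1
  have hφb : UnifBdd ε₀ T (fun _ t => φb t) :=
    UnifBdd.of_continuousOn fun t ht => (G.φ_deriv t ht).continuousWithinAt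
  have hθs : UnifBdd ε₀ T (fun _ _ => θs) := UnifBdd.const θs
  obtain ⟨q, r, Φ, hq, -, hΦ, h⟩ := F.fast_taylor
  obtain ⟨P, hP, hPe⟩ := F.y_p_sub.2.exists_eq_mul
  obtain ⟨Y₃, hY₃, hY₃e⟩ := (F.y_expansion G).exists_eq_mul
  obtain ⟨P₃, hP₃, hP₃e⟩ := (F.p_expansion G).exists_eq_mul
  obtain ⟨Φ₃, hΦ₃, hΦ₃e⟩ := (F.φ_expansion G).exists_eq_mul
  obtain ⟨W, hW, hWe⟩ := F.comp_y_taylor hf.contDiff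
  have dθ : UnifO ε₀ T 2 (fun ε t => θ ε t -
      (θs - ε * (2 * θs * p₀ t * corrY ω a (y₀ t) * fastSin (fun _ => φ₀) ε t))) :=
    F.θ_expansion_one.congr fun ε _ t _ => by ring
  -- The phase expansion is inserted into the sine. The resulting `2 ε φb cos` is the source of the
  -- `φb` term in `[θ₂]`.
  have dS : UnifO ε₀ T 2 (fun ε t => fastSin φ ε t - (fastSin (fun _ => φ₀) ε t
      + 2 * ε * (φb t - p₀ t * corrY ω a (y₀ t) * fastCos (fun _ => φ₀) ε t)
        * fastCos (fun _ => φ₀) ε t)) := by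
    refine UnifO.of_eq_mul (g := fun ε t => q ε t + 2 * Φ₃ ε t * fastCos (fun _ => φ₀) ε t)
      (hq.add (((UnifBdd.const 2).mul hΦ₃).mul hC0)) fun ε hε t ht => ?_
    obtain ⟨e1, e2, -⟩ := h ε hε t ht
    have e3 := hΦ₃e ε hε t ht
    have e4 : Φ ε t = φb t - p₀ t * corrY ω a (y₀ t) * fastCos (fun _ => φ₀) ε t
        + ε * Φ₃ ε t := by
      have hε2 : ε ^ 2 ≠ 0 := pow_ne_zero 2 hε.1.ne'
      refine mul_left_cancel₀ hε2 ?_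
      linear_combination e3 - e1
    linear_combination e2 + 2 * ε * fastCos (fun _ => φ₀) ε t * e4
  have hM : UnifBdd ε₀ T (fun ε t => fastSin (fun _ => φ₀) ε t
      + 2 * ε * (φb t - p₀ t * corrY ω a (y₀ t) * fastCos (fun _ => φ₀) ε t)
        * fastCos (fun _ => φ₀) ε t) := by
    repeat' with_reducible first
      | assumption | apply UnifBdd.const | apply UnifBdd.eps | apply UnifBdd.add
      | apply UnifBdd.sub | apply UnifBdd.mul
  have hN : UnifBdd ε₀ T (fun ε t =>
      θs - ε * (2 * θs * p₀ t * corrY ω a (y₀ t) * fastSin (fun _ => φ₀) ε t)) := by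
    repeat' with_reducible first
      | assumption | apply UnifBdd.const | apply UnifBdd.eps | apply UnifBdd.add
      | apply UnifBdd.sub | apply UnifBdd.mul
  have dp : UnifO ε₀ T 2 (fun ε t => p ε t - (fun _ t => p₀ t) ε t) := F.y_p_sub.2
  have da : UnifO ε₀ T 2 (fun ε t => (fun ε t => a (y ε t)) ε t - (fun _ t => a (y₀ t)) ε t) :=
    F.comp_y_sub hf.contDiff_log
  -- `x₂` and `x₃` expand the terms `ε p θ a sin` and `ε² (θ a sin)²` of the energy, with error
  -- `O(ε³)` each.
  have x₂ := (((dp.mul_sub_mul dθ hp hN).mul_sub_mul da (hp.mul hθ) ha0).mul_sub_mul dS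
    ((hp.mul hθ).mul ha) hM).eps_mul 1
  have dz := (F.θ_sub'.mul_sub_mul (F.comp_y_sub_one hf.contDiff_log) hθ ha0).mul_sub_mul
    F.fastSin_sub (hθ.mul ha) hS0
  have x₃ := (dz.mul_sub_mul dz ((hθ.mul ha).mul hS) ((hθs.mul ha0).mul hS0)).eps_mul 2
  obtain ⟨Θ, hΘ, hΘe⟩ := F.θ_sub.exists_eq_mul
  have rem : UnifBdd ε₀ T (fun ε t => -(p₀ t * P₃ ε t) - ε * P ε t ^ 2 / 2
      - θ ε t * (ω (y₀ t) * a (y₀ t) * Y₃ ε t + ε * W ε t)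
      - ω (y₀ t) * a (y₀ t) * (yb t - θs * corrY ω a (y₀ t) * fastCos (fun _ => φ₀) ε t) * Θ ε t
      + 2 * p₀ t ^ 2 * a (y₀ t) * θs * corrY ω a (y₀ t) * fastSin (fun _ => φ₀) ε t *
        (φb t - p₀ t * corrY ω a (y₀ t) * fastCos (fun _ => φ₀) ε t)
        * fastCos (fun _ => φ₀) ε t) := by
    repeat' with_reducible first
      | assumption | apply UnifBdd.const | apply UnifBdd.eps | apply UnifBdd.add
      | apply UnifBdd.sub | apply UnifBdd.neg | apply UnifBdd.mul | apply UnifBdd.pow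
      | apply UnifBdd.div_const
  refine (UnifO.bdd_mul hw0 (((UnifO.bdd_mul (UnifBdd.const (-1 / 2)) x₂).add
    (UnifO.bdd_mul (UnifBdd.const (-1 / 8)) x₃)).add (rem.unifO.eps_mul 3))).congr
    fun ε hε t ht => ?_
  have e1 := F.energy ε hε t ht
  have e2 := F.energy₀ t ht
  have e3 := hf.inv_mul (y₀ t)
  have e4 := hf.corrY_mul (y₀ t)
  -- The second-order balance is where `θb` enters, in exchange for `yb` and `pb`.
  have e5 := F.correction_energy G t ht
  have e6 := fastSin_sq_add (fun _ => φ₀) ε t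
  have f1 := hPe ε hε t ht
  have f2 := hY₃e ε hε t ht
  have f3 := hP₃e ε hε t ht
  have f4 := hWe ε hε t ht
  have f5 := hΘe ε hε t ht
  rw [hf.deriv_eq] at f4
  have hw := hf.pos (y₀ t)
  rw [eq_comm, inv_mul_eq_iff_eq_mul₀ hw.ne']
  linear_combination (-1) * (e1 - e2 - p₀ t * f3 - (p ε t - p₀ t + ε ^ 2 * P ε t) / 2 * f1
    - θ ε t * f4 - θ ε t * ω (y₀ t) * a (y₀ t) * f2
    - ω (y₀ t) * a (y₀ t) * ε ^ 2
      * (yb t - θs * corrY ω a (y₀ t) * fastCos (fun _ => φ₀) ε t) * f5 - ε ^ 2 * e5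
    - ε ^ 2 * θs * p₀ t ^ 2 * corrP ω a (y₀ t) * fastCos (fun _ => φ₀) ε t * e3
    + (ε * θs * p₀ t * fastSin (fun _ => φ₀) ε t / 2
      + ε ^ 2 * θs * p₀ t * φb t * fastCos (fun _ => φ₀) ε t
      - ε ^ 2 * θs ^ 2 * a (y₀ t) / 16 *
        (fastCos (fun _ => φ₀) ε t ^ 2 - fastSin (fun _ => φ₀) ε t ^ 2)) * e4
    + ε ^ 2 * (p₀ t ^ 2 * a (y₀ t) * θs * corrY ω a (y₀ t) - θs ^ 2 * a (y₀ t) ^ 2 / 16) * e6)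

end IsFamily

end FastSlow

namespace FastSlow

namespace IsFamily

variable {ε₀ T : ℝ} {ω a : ℝ → ℝ} {E θs : ℝ} {φ θ y p : ℝ → ℝ → ℝ}
  {φ₀ y₀ p₀ : ℝ → ℝ}

/-! ### Derivatives of the rescaled residuals -/

/-- The derivative of the corrector has size `1/ε` and cancels the leading oscillation of `θ'/ε`.
Weak* convergence needs no more than the boundedness of what is left; the residuals of `φ`, `y`, `p`
behave alike. -/
lemma exists_deriv_θ_residual (F : IsFamily ω a ε₀ T E θs φ θ y p φ₀ y₀ p₀) :
    ∃ d, UnifBdd ε₀ T d ∧ ∀ ε ∈ Ioo 0 ε₀, ∀ t ∈ Icc 0 T, HasDerivWithinAt (fun t =>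
      (θ ε t - θs) / ε + 2 * θs * p₀ t * corrY ω a (y₀ t) * fastSin (fun _ => φ₀) ε t)
      (d ε t) (Icc 0 T) t := by
  have hf := F.freq
  have hp := F.p_bdd
  have hp0 := F.p₀_bdd
  have hθ := F.θ_bdd
  have ha := F.comp_y_bdd hf.contDiff_log.continuous
  have ha0 := F.comp_y₀_bdd hf.contDiff_log.continuous
  have hω0 := F.comp_y₀_bdd hf.contDiff.continuous
  have hα0 := F.comp_y₀_bdd hf.contDiff_corrY.continuous
  have hb0 := F.comp_y₀_bdd hf.contDiff_corrP.continuous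
  have hS : UnifBdd ε₀ T (fastSin φ) := fastSin_bdd _
  have hC : UnifBdd ε₀ T (fastCos φ) := fastCos_bdd _
  have hS0 : UnifBdd ε₀ T (fastSin (fun _ => φ₀)) := fastSin_bdd _
  obtain ⟨Z, hZ, hZe⟩ := (((F.θ_sub'.mul_sub_mul F.p_sub_one hθ hp0).mul_sub_mul
    (F.comp_y_sub_one hf.contDiff_log) (hθ.mul hp) ha0).mul_sub_mul F.fastCos_sub
    ((hθ.mul hp).mul ha) (fastCos_bdd _)).exists_eq_mul
  refine ⟨fun ε t => -Z ε t - θ ε t ^ 2 * a (y ε t) ^ 2 / 2 * fastSin φ ε t * fastCos φ ε t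
    + 2 * θs * (-(θs * ω (y₀ t) * a (y₀ t)) * corrY ω a (y₀ t)
      - p₀ t ^ 2 * corrP ω a (y₀ t)) * fastSin (fun _ => φ₀) ε t, ?_, fun ε hε t ht => ?_⟩
  · repeat' with_reducible first
      | assumption | apply UnifBdd.const | apply UnifBdd.add
      | apply UnifBdd.sub | apply UnifBdd.neg | apply UnifBdd.mul | apply UnifBdd.pow
      | apply UnifBdd.div_const
  · have hα := (hf.hasDerivAt_corrY (y₀ t)).comp_hasDerivWithinAt t (F.y₀_deriv t ht)
    have hs := hasDerivWithinAt_fastSin (φ := fun _ => φ₀) (ε := ε) (F.φ₀_deriv t ht)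
    convert! (((F.θ_deriv ε hε t ht).sub_const θs).div_const ε).add
      ((((F.p₀_deriv t ht).const_mul (2 * θs)).mul hα).mul hs) using 1
    have e1 := hZe ε hε t ht
    have e2 := hf.corrY_mul (y₀ t)
    have hε0 := hε.1.ne'
    rw [show θ ε t * p ε t * a (y ε t) * fastCos φ ε t =
      θs * p₀ t * a (y₀ t) * fastCos (fun _ => φ₀) ε t + ε ^ 1 * Z ε t by linarith]
    simp only [Function.comp_apply, Pi.mul_apply]
    rw [← e2]
    field_simp
    ring

lemma exists_deriv_φ_residual (F : IsFamily ω a ε₀ T E θs φ θ y p φ₀ y₀ p₀) :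
    ∃ d, UnifBdd ε₀ T d ∧ ∀ ε ∈ Ioo 0 ε₀, ∀ t ∈ Icc 0 T, HasDerivWithinAt (fun t =>
      (φ ε t - φ₀ t) / ε ^ 2 + p₀ t * corrY ω a (y₀ t) * fastCos (fun _ => φ₀) ε t)
      (d ε t) (Icc 0 T) t := by
  have hf := F.freq
  have hp := F.p_bdd
  have hp0 := F.p₀_bdd
  have hθ := F.θ_bdd
  have ha := F.comp_y_bdd hf.contDiff_log.continuous
  have ha0 := F.comp_y₀_bdd hf.contDiff_log.continuous
  have hω0 := F.comp_y₀_bdd hf.contDiff.continuous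
  have hα0 := F.comp_y₀_bdd hf.contDiff_corrY.continuous
  have hb0 := F.comp_y₀_bdd hf.contDiff_corrP.continuous
  have hS : UnifBdd ε₀ T (fastSin φ) := fastSin_bdd _
  have hC0 : UnifBdd ε₀ T (fastCos (fun _ => φ₀)) := fastCos_bdd _
  obtain ⟨Z, hZ, hZe⟩ := ((F.p_sub_one.mul_sub_mul
    (F.comp_y_sub_one hf.contDiff_log) hp ha0).mul_sub_mul F.fastSin_sub
    (hp.mul ha) (fastSin_bdd _)).exists_eq_mul
  obtain ⟨W, hW, hWe⟩ := (F.comp_y_sub hf.contDiff).exists_eq_mul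
  refine ⟨fun ε t => W ε t + Z ε t / 2 + θ ε t * a (y ε t) ^ 2 / 4 * fastSin φ ε t ^ 2
    + (-(θs * ω (y₀ t) * a (y₀ t)) * corrY ω a (y₀ t)
      - p₀ t ^ 2 * corrP ω a (y₀ t)) * fastCos (fun _ => φ₀) ε t, ?_, fun ε hε t ht => ?_⟩
  · repeat' with_reducible first
      | assumption | apply UnifBdd.const | apply UnifBdd.add
      | apply UnifBdd.sub | apply UnifBdd.neg | apply UnifBdd.mul | apply UnifBdd.pow
      | apply UnifBdd.div_const
  · have hα := (hf.hasDerivAt_corrY (y₀ t)).comp_hasDerivWithinAt t (F.y₀_deriv t ht)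
    have hc := hasDerivWithinAt_fastCos (φ := fun _ => φ₀) (ε := ε) (F.φ₀_deriv t ht)
    convert! (((F.φ_deriv ε hε t ht).sub (F.φ₀_deriv t ht)).div_const (ε ^ 2)).add
      (((F.p₀_deriv t ht).mul hα).mul hc) using 1
    have e1 := hZe ε hε t ht
    have e2 := hf.corrY_mul (y₀ t)
    have e3 := hWe ε hε t ht
    have hε0 := hε.1.ne'
    rw [show p ε t * a (y ε t) / 2 * fastSin φ ε t =
      (p₀ t * a (y₀ t) * fastSin (fun _ => φ₀) ε t + ε ^ 1 * Z ε t) / 2 by linarith,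
      show ω (y ε t) = ω (y₀ t) + ε ^ 2 * W ε t by linarith]
    simp only [Function.comp_apply, Pi.mul_apply]
    rw [← e2]
    field_simp
    ring

lemma exists_deriv_y_residual (F : IsFamily ω a ε₀ T E θs φ θ y p φ₀ y₀ p₀) :
    ∃ d, UnifBdd ε₀ T d ∧ ∀ ε ∈ Ioo 0 ε₀, ∀ t ∈ Icc 0 T, HasDerivWithinAt (fun t =>
      (y ε t - y₀ t) / ε ^ 2 + θs * corrY ω a (y₀ t) * fastCos (fun _ => φ₀) ε t)
      (d ε t) (Icc 0 T) t := by
  have hf := F.freq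
  have hp0 := F.p₀_bdd
  have hθ := F.θ_bdd
  have ha := F.comp_y_bdd hf.contDiff_log.continuous
  have ha0 := F.comp_y₀_bdd hf.contDiff_log.continuous
  have hb0 := F.comp_y₀_bdd hf.contDiff_corrP.continuous
  have hC0 : UnifBdd ε₀ T (fastCos (fun _ => φ₀)) := fastCos_bdd _
  obtain ⟨Z, hZ, hZe⟩ := ((F.θ_sub'.mul_sub_mul
    (F.comp_y_sub_one hf.contDiff_log) hθ ha0).mul_sub_mul F.fastSin_sub
    (hθ.mul ha) (fastSin_bdd _)).exists_eq_mul
  obtain ⟨P, hP, hPe⟩ := F.y_p_sub.2.exists_eq_mul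
  refine ⟨fun ε t => P ε t + Z ε t / 2
    - θs * (p₀ t * corrP ω a (y₀ t)) * fastCos (fun _ => φ₀) ε t, ?_, fun ε hε t ht => ?_⟩
  · repeat' with_reducible first
      | assumption | apply UnifBdd.const | apply UnifBdd.add
      | apply UnifBdd.sub | apply UnifBdd.mul | apply UnifBdd.div_const
  · have hα := (hf.hasDerivAt_corrY (y₀ t)).comp_hasDerivWithinAt t (F.y₀_deriv t ht)
    have hc := hasDerivWithinAt_fastCos (φ := fun _ => φ₀) (ε := ε) (F.φ₀_deriv t ht)
    convert! (((F.y_deriv ε hε t ht).sub (F.y₀_deriv t ht)).div_const (ε ^ 2)).add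
      ((hα.const_mul θs).mul hc) using 1
    have e1 := hZe ε hε t ht
    have e2 := hf.corrY_mul (y₀ t)
    have e3 := hPe ε hε t ht
    have hε0 := hε.1.ne'
    rw [show θ ε t * a (y ε t) / 2 * fastSin φ ε t =
      (θs * a (y₀ t) * fastSin (fun _ => φ₀) ε t + ε ^ 1 * Z ε t) / 2 by linarith,
      show p ε t = p₀ t + ε ^ 2 * P ε t by linarith, ← e2]
    simp only [Function.comp_apply]
    field_simp
    ring

lemma exists_deriv_p_residual (F : IsFamily ω a ε₀ T E θs φ θ y p φ₀ y₀ p₀) :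
    ∃ d, UnifBdd ε₀ T d ∧ ∀ ε ∈ Ioo 0 ε₀, ∀ t ∈ Icc 0 T, HasDerivWithinAt (fun t =>
      (p ε t - p₀ t) / ε ^ 2 + p₀ t * θs * corrP ω a (y₀ t) * fastCos (fun _ => φ₀) ε t)
      (d ε t) (Icc 0 T) t := by
  have hf := F.freq
  have hp := F.p_bdd
  have hp0 := F.p₀_bdd
  have hθ := F.θ_bdd
  have hθs : UnifBdd ε₀ T (fun _ _ => θs) := UnifBdd.const θs
  have ha := F.comp_y_bdd hf.contDiff_log.continuous
  have ha1 := F.comp_y_bdd hf.contDiff_deriv.continuous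
  have ha0 := F.comp_y₀_bdd hf.contDiff_log.continuous
  have hω := F.comp_y_bdd hf.contDiff.continuous
  have hω0 := F.comp_y₀_bdd hf.contDiff.continuous
  have hb := F.comp_y_bdd hf.contDiff_corrP.continuous
  have hb0 := F.comp_y₀_bdd hf.contDiff_corrP.continuous
  have hb1 := F.comp_y₀_bdd (hf.contDiff_corrP.continuous_deriv (by simp))
  have hS : UnifBdd ε₀ T (fastSin φ) := fastSin_bdd _
  have hC0 : UnifBdd ε₀ T (fastCos (fun _ => φ₀)) := fastCos_bdd _
  obtain ⟨Z, hZ, hZe⟩ := ((((F.p_sub_one.mul_sub_mul F.θ_sub' hp hθs).mul_sub_mul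
    (F.comp_y_sub_one hf.contDiff_corrP) (hp.mul hθ) hb0).mul_sub_mul
    (F.comp_y_sub_one hf.contDiff) ((hp.mul hθ).mul hb) hω0).mul_sub_mul F.fastSin_sub
    (((hp.mul hθ).mul hb).mul hω) (fastSin_bdd _)).exists_eq_mul
  obtain ⟨P, hP, hPe⟩ := F.y_p_sub.2.exists_eq_mul
  obtain ⟨A, hA, hAe⟩ := (F.comp_y_sub hf.contDiff_log).exists_eq_mul
  refine ⟨fun ε t => -(A ε t * (E - p₀ t ^ 2 / 2)) + a (y ε t) * (p ε t + p₀ t) * P ε t / 2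
    + 2 * Z ε t + θ ε t ^ 2 * (a (y ε t) ^ 3 / 8 - a (y ε t) * deriv a (y ε t) / 4)
          * fastSin φ ε t ^ 2
    + θs * (-(θs * ω (y₀ t) * a (y₀ t)) * corrP ω a (y₀ t)
      + p₀ t * (deriv (corrP ω a) (y₀ t) * p₀ t)) * fastCos (fun _ => φ₀) ε t, ?_,
    fun ε hε t ht => ?_⟩
  · repeat' with_reducible first
      | assumption | apply UnifBdd.const | apply UnifBdd.add
      | apply UnifBdd.sub | apply UnifBdd.neg | apply UnifBdd.mul | apply UnifBdd.pow
      | apply UnifBdd.div_const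
  · have hb := (hf.hasDerivAt_corrP (y₀ t)).comp_hasDerivWithinAt t (F.y₀_deriv t ht)
    have hc := hasDerivWithinAt_fastCos (φ := fun _ => φ₀) (ε := ε) (F.φ₀_deriv t ht)
    convert! (((F.p_deriv ε hε t ht).sub (F.p₀_deriv t ht)).div_const (ε ^ 2)).add
      ((((F.p₀_deriv t ht).mul_const θs).mul hb).mul hc) using 1
    have e1 := hZe ε hε t ht
    have e2 := hf.corrP_mul (y ε t)
    have e3 := hPe ε hε t ht
    have e4 := hAe ε hε t ht
    have e5 := F.energy₀ t ht
    have hε0 := hε.1.ne'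
    -- Isolates the leading-order force and the order-`ε` sine in the form that the derivative of
    -- the corrector cancels; the rest is `O(ε²)`.
    have e6 : -(a (y ε t) * (E - p ε t ^ 2 / 2)) + ε * (p ε t * θ ε t * (a (y ε t) ^ 2
        - deriv a (y ε t)) / 2 * fastSin φ ε t) = -(θs * ω (y₀ t) * a (y₀ t))
        + ε ^ 2 * (-(A ε t * (E - p₀ t ^ 2 / 2)) + a (y ε t) * (p ε t + p₀ t) * P ε t / 2)
        + 2 * ε * (p₀ t * θs * corrP ω a (y₀ t) * ω (y₀ t) * fastSin (fun _ => φ₀) ε t)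
        + 2 * ε ^ 2 * Z ε t := by
      linear_combination 2 * ε * e1 - ε * p ε t * θ ε t * fastSin φ ε t / 2 * e2
        + a (y ε t) * (p ε t + p₀ t) / 2 * e3 - (E - p₀ t ^ 2 / 2) * e4 + a (y₀ t) * e5
    rw [e6]
    simp only [Function.comp_apply, Pi.mul_apply]
    field_simp
    ring

end IsFamily

end FastSlow

namespace FastSlow

namespace IsFamily

variable {ε₀ T : ℝ} {ω : ℝ → ℝ} {E θs : ℝ} {φ θ y p : ℝ → ℝ → ℝ}
  {φ₀ y₀ p₀ φb θb yb pb : ℝ → ℝ}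

/-! ### The correctors in reduced form -/

lemma DtL_eq (F : IsFamily ω (deriv (logFreq ω)) ε₀ T E θs φ θ y p φ₀ y₀ p₀) {t : ℝ}
    (ht : t ∈ Icc 0 T) : DtL ω T y₀ t = DyL ω y₀ t * p₀ t := by
  have hL : DifferentiableAt ℝ (logFreq ω) (y₀ t) :=
    ((F.freq.contDiff.differentiable (by simp)) (y₀ t)).log (F.freq.pos _).ne'
  exact ddt_eq F.T_pos ht (hL.hasDerivAt.comp_hasDerivWithinAt t (F.y₀_deriv t ht))

lemma DtDyL_eq (F : IsFamily ω (deriv (logFreq ω)) ε₀ T E θs φ θ y p φ₀ y₀ p₀) {t : ℝ}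
    (ht : t ∈ Icc 0 T) : DtDyL ω T y₀ t = DyyL ω y₀ t * p₀ t :=
  ddt_eq F.T_pos ht
    ((F.freq.hasDerivAt_log (y₀ t)).comp_hasDerivWithinAt t (F.y₀_deriv t ht))

lemma thetaOsc₁_eq (F : IsFamily ω (deriv (logFreq ω)) ε₀ T E θs φ θ y p φ₀ y₀ p₀) {t : ℝ}
    (ht : t ∈ Icc 0 T) (ε : ℝ) : thetaOsc₁ ω T θs φ₀ y₀ ε t =
      -(2 * θs * p₀ t * corrY ω (deriv (logFreq ω)) (y₀ t) * fastSin (fun _ => φ₀) ε t) := by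
  have := (F.freq.pos (y₀ t)).ne'
  rw [thetaOsc₁, F.DtL_eq ht, corrY, fastSin, DyL]
  field_simp
  ring

lemma phiOsc₂_eq (F : IsFamily ω (deriv (logFreq ω)) ε₀ T E θs φ θ y p φ₀ y₀ p₀) {t : ℝ}
    (ht : t ∈ Icc 0 T) (ε : ℝ) : phiOsc₂ ω T φ₀ y₀ ε t =
      -(p₀ t * corrY ω (deriv (logFreq ω)) (y₀ t) * fastCos (fun _ => φ₀) ε t) := by
  have := (F.freq.pos (y₀ t)).ne'
  rw [phiOsc₂, F.DtL_eq ht, corrY, fastCos, DyL]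
  field_simp

lemma yOsc₂_eq (F : IsFamily ω (deriv (logFreq ω)) ε₀ T E θs φ θ y p φ₀ y₀ p₀) (ε t : ℝ) :
    yOsc₂ ω θs φ₀ y₀ ε t =
      -(θs * corrY ω (deriv (logFreq ω)) (y₀ t) * fastCos (fun _ => φ₀) ε t) := by
  have := (F.freq.pos (y₀ t)).ne'
  rw [yOsc₂, corrY, fastCos, DyL]
  field_simp

lemma pOsc₂_eq (F : IsFamily ω (deriv (logFreq ω)) ε₀ T E θs φ θ y p φ₀ y₀ p₀) {t : ℝ}
    (ht : t ∈ Icc 0 T) (ε : ℝ) : pOsc₂ ω T θs φ₀ y₀ ε t =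
      -(p₀ t * θs * corrP ω (deriv (logFreq ω)) (y₀ t) * fastCos (fun _ => φ₀) ε t) := by
  have h1 : (fun s => θs * DyL ω y₀ s / (4 * ω (y₀ s))) =
      fun s => θs * corrY ω (deriv (logFreq ω)) (y₀ s) := by
    funext s
    have := (F.freq.pos (y₀ s)).ne'
    rw [corrY, DyL]
    field_simp
  have h2 := ddt_eq F.T_pos ht (((F.freq.hasDerivAt_corrY (y₀ t)).comp_hasDerivWithinAt t
    (F.y₀_deriv t ht)).const_mul θs)
  rw [pOsc₂, h1, fastCos]
  refine (congrArg (· * _) h2).trans ?_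
  ring

lemma thetaOsc₂_eq (F : IsFamily ω (deriv (logFreq ω)) ε₀ T E θs φ θ y p φ₀ y₀ p₀) {t : ℝ}
    (ht : t ∈ Icc 0 T) (ε : ℝ) : thetaOsc₂ ω T θs φ₀ y₀ p₀ φb ε t =
      θs ^ 2 * deriv (logFreq ω) (y₀ t) * corrY ω (deriv (logFreq ω)) (y₀ t)
          * fastCos (fun _ => φ₀) ε t
        + θs * p₀ t ^ 2 * corrP ω (deriv (logFreq ω)) (y₀ t) * (ω (y₀ t))⁻¹
          * fastCos (fun _ => φ₀) ε t
        + θs ^ 2 * deriv (logFreq ω) (y₀ t) * corrY ω (deriv (logFreq ω)) (y₀ t) / 4 *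
          (fastCos (fun _ => φ₀) ε t ^ 2 - fastSin (fun _ => φ₀) ε t ^ 2)
        - 4 * θs * p₀ t * corrY ω (deriv (logFreq ω)) (y₀ t) * φb t
          * fastCos (fun _ => φ₀) ε t := by
  have hc : Real.cos (4 * φ₀ t / ε) =
      fastCos (fun _ => φ₀) ε t ^ 2 - fastSin (fun _ => φ₀) ε t ^ 2 := by
    rw [show 4 * φ₀ t / ε = 2 * (2 * φ₀ t / ε) by ring, Real.cos_two_mul']
    rfl
  have hc' : Real.cos (2 * φ₀ t / ε) = fastCos (fun _ => φ₀) ε t := rfl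
  rw [thetaOsc₂, F.yOsc₂_eq, F.pOsc₂_eq ht, F.DtL_eq ht, hc, hc', corrY, DyL]
  have := (F.freq.pos (y₀ t)).ne'
  field_simp
  ring

/-- The averaged second-order problem in original and in reduced form. -/
lemma isSecondOrderSolution_iff (F : IsFamily ω (deriv (logFreq ω)) ε₀ T E θs φ θ y p φ₀ y₀ p₀) :
    IsSecondOrderSolution ω T θs φ₀ y₀ p₀ φb θb yb pb ↔
      IsCorrection ω (deriv (logFreq ω)) T θs y₀ p₀ φb θb yb pb := by
  have h0 : (0 : ℝ) ∈ Icc 0 T := ⟨le_rfl, F.T_pos.le⟩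
  -- As `φ₀ 0 = 0`, the oscillating factors at time zero do not depend on `ε`, and the conditions
  -- for all `ε` reduce to the one for `ε = 1`.
  have hC : ∀ ε, fastCos (fun _ => φ₀) ε 0 = 1 := fun ε => by simp [fastCos, F.φ₀_init]
  have hS : ∀ ε, fastSin (fun _ => φ₀) ε 0 = 0 := fun ε => by simp [fastSin, F.φ₀_init]
  have ω0 := (F.freq.pos (y₀ 0)).ne'
  have iφ : (∀ ε > (0 : ℝ), φb 0 = -phiOsc₂ ω T φ₀ y₀ ε 0) ↔
      φb 0 = p₀ 0 * corrY ω (deriv (logFreq ω)) (y₀ 0) := by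
    simp only [F.phiOsc₂_eq h0, hC, neg_neg, mul_one]
    exact ⟨fun h => h 1 one_pos, fun h _ _ => h⟩
  have iy : (∀ ε > (0 : ℝ), yb 0 = -yOsc₂ ω θs φ₀ y₀ ε 0) ↔
      yb 0 = θs * corrY ω (deriv (logFreq ω)) (y₀ 0) := by
    simp only [F.yOsc₂_eq, hC, neg_neg, mul_one]
    exact ⟨fun h => h 1 one_pos, fun h _ _ => h⟩
  have ip : (∀ ε > (0 : ℝ), pb 0 = -pOsc₂ ω T θs φ₀ y₀ ε 0) ↔
      pb 0 = p₀ 0 * θs * corrP ω (deriv (logFreq ω)) (y₀ 0) := by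
    simp only [F.pOsc₂_eq h0, hC, neg_neg, mul_one]
    exact ⟨fun h => h 1 one_pos, fun h _ _ => h⟩
  have iθ : φb 0 = p₀ 0 * corrY ω (deriv (logFreq ω)) (y₀ 0) →
      yb 0 = θs * corrY ω (deriv (logFreq ω)) (y₀ 0) →
      pb 0 = p₀ 0 * θs * corrP ω (deriv (logFreq ω)) (y₀ 0) →
      ((∀ ε > (0 : ℝ), θb 0 = -thetaOsc₂ ω T θs φ₀ y₀ p₀ φb ε 0) ↔
        ω (y₀ 0) * θb 0 + p₀ 0 * pb 0 + θs * ω (y₀ 0) * deriv (logFreq ω) (y₀ 0) * yb 0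
        + θs ^ 2 * deriv (logFreq ω) (y₀ 0) ^ 2 / 16
        - θs * p₀ 0 ^ 2 * deriv (logFreq ω) (y₀ 0) * corrY ω (deriv (logFreq ω)) (y₀ 0) = 0) := by
    intro e1 e2 e3
    simp only [F.thetaOsc₂_eq h0, hC, hS]
    have key : ∀ x : ℝ, (∀ ε > (0 : ℝ), θb 0 = x) ↔ θb 0 = x := fun x =>
      ⟨fun h => h 1 one_pos, fun h _ _ => h⟩
    rw [key, e1, e2, e3, ← sub_eq_zero, ← mul_right_inj' ω0, mul_zero]
    refine Eq.congr ?_ rfl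
    have e4 := F.freq.corrY_mul (y₀ 0)
    have e5 := F.freq.inv_mul (y₀ 0)
    linear_combination (θs ^ 2 * deriv (logFreq ω) (y₀ 0) / 16
      - θs * p₀ 0 ^ 2 * corrY ω (deriv (logFreq ω)) (y₀ 0)) * e4
      + θs * p₀ 0 ^ 2 * corrP ω (deriv (logFreq ω)) (y₀ 0) * e5
  have dφ : ∀ t ∈ Icc 0 T, deriv ω (y₀ t) * yb t + θs * DyL ω y₀ t ^ 2 / 8
      - DtL ω T y₀ t ^ 2 / (8 * ω (y₀ t)) =
      ω (y₀ t) * deriv (logFreq ω) (y₀ t) * yb t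
        + θs * deriv (logFreq ω) (y₀ t) ^ 2 / 8 - p₀ t ^ 2 * deriv (logFreq ω) (y₀ t)
          * corrY ω (deriv (logFreq ω)) (y₀ t) / 2 := fun t ht => by
    have := (F.freq.pos (y₀ t)).ne'
    rw [F.DtL_eq ht, F.freq.deriv_eq, corrY, DyL]
    field_simp
    ring
  have dy : ∀ t ∈ Icc 0 T, pb t - θs * DyL ω y₀ t * DtL ω T y₀ t / (4 * ω (y₀ t)) =
      pb t - θs * deriv (logFreq ω) (y₀ t) * p₀ t * corrY ω (deriv (logFreq ω)) (y₀ t) :=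
    fun t ht => by
      have := (F.freq.pos (y₀ t)).ne'
      rw [F.DtL_eq ht, corrY, DyL]
      field_simp
  have dp : ∀ t ∈ Icc 0 T, -(deriv ω (y₀ t) * θb t) - θs * deriv (deriv ω) (y₀ t) * yb t
      - θs ^ 2 * DyL ω y₀ t * DyyL ω y₀ t / 8
      + θs * DtL ω T y₀ t * DtDyL ω T y₀ t / (4 * ω (y₀ t)) =
      -(ω (y₀ t) * deriv (logFreq ω) (y₀ t) * θb t)
        - θs * ω (y₀ t) * (deriv (deriv (logFreq ω)) (y₀ t) + deriv (logFreq ω) (y₀ t) ^ 2) * yb t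
        - θs ^ 2 * deriv (logFreq ω) (y₀ t) * deriv (deriv (logFreq ω)) (y₀ t) / 8
        + θs * p₀ t ^ 2 * deriv (deriv (logFreq ω)) (y₀ t)
          * corrY ω (deriv (logFreq ω)) (y₀ t) := fun t ht => by
    have := (F.freq.pos (y₀ t)).ne'
    rw [F.DtL_eq ht, F.DtDyL_eq ht, F.freq.deriv_eq, F.freq.deriv_deriv_eq, corrY, DyL, DyyL]
    field_simp
  have dθ : ∀ t ∈ Icc 0 T, ddt T (fun s => θs * DtL ω T y₀ s ^ 2 / (8 * ω (y₀ s) ^ 2)) t =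
      4 * θs * p₀ t * corrY ω (deriv (logFreq ω)) (y₀ t) *
        (-(θs * ω (y₀ t) * deriv (logFreq ω) (y₀ t) * corrY ω (deriv (logFreq ω)) (y₀ t))
          - p₀ t ^ 2 * corrP ω (deriv (logFreq ω)) (y₀ t)) := fun t ht => by
    have hα := (F.freq.hasDerivAt_corrY (y₀ t)).comp_hasDerivWithinAt t (F.y₀_deriv t ht)
    have hd := (((F.p₀_deriv t ht).mul hα).pow 2).const_mul (2 * θs)
    -- In reduced form the differentiated function is `2 θs (p₀ corrY)²`.
    have hcongr : ∀ s ∈ Icc 0 T, θs * DtL ω T y₀ s ^ 2 / (8 * ω (y₀ s) ^ 2) =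
        2 * θs * (p₀ s * corrY ω (deriv (logFreq ω)) (y₀ s)) ^ 2 := fun s hs => by
      have := (F.freq.pos (y₀ s)).ne'
      rw [F.DtL_eq hs, corrY, DyL]
      field_simp
      ring
    rw [ddt_eq F.T_pos ht (hd.congr hcongr (hcongr t ht))]
    simp only [Function.comp_apply, Pi.mul_apply]
    ring
  constructor
  · intro h
    have e1 := iφ.1 h.phi_init
    have e2 := iy.1 h.y_init
    have e3 := ip.1 h.p_init
    exact ⟨e1, e2, e3, (iθ e1 e2 e3).1 h.theta_init,
      fun t ht => dφ t ht ▸ h.phi_eq t ht, fun t ht => dθ t ht ▸ h.theta_eq t ht,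
      fun t ht => dy t ht ▸ h.y_eq t ht, fun t ht => dp t ht ▸ h.p_eq t ht⟩
  · intro h
    exact ⟨iφ.2 h.φ_init, (iθ h.φ_init h.y_init h.p_init).2 h.θ_init, iy.2 h.y_init, ip.2 h.p_init,
      fun t ht => (dφ t ht).symm ▸ h.φ_deriv t ht, fun t ht => (dθ t ht).symm ▸ h.θ_deriv t ht,
      fun t ht => (dy t ht).symm ▸ h.y_deriv t ht, fun t ht => (dp t ht).symm ▸ h.p_deriv t ht⟩

/-! ### Existence and uniqueness of the averaged second-order motion -/

variable {a : ℝ → ℝ}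

/-- The system is triangular: `θb` is a primitive of a known function, `(yb, pb)` then solves a
planar linear system, and `φb` is again a primitive. -/
lemma exists_correction (F : IsFamily ω a ε₀ T E θs φ θ y p φ₀ y₀ p₀) :
    ∃ φb θb yb pb, IsCorrection ω a T θs y₀ p₀ φb θb yb pb := by
  have hf := F.freq
  have cp := F.continuousOn_p₀
  have cω := F.continuousOn_comp_y₀ hf.contDiff
  have ca := F.continuousOn_comp_y₀ hf.contDiff_log
  have ca1 := F.continuousOn_comp_y₀ hf.contDiff_deriv
  have cα := F.continuousOn_comp_y₀ hf.contDiff_corrY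
  have cb := F.continuousOn_comp_y₀ hf.contDiff_corrP
  have hT := F.T_pos.le
  set Y := θs * corrY ω a (y₀ 0)
  set P := p₀ 0 * θs * corrP ω a (y₀ 0)
  obtain ⟨θb, hθ0, hθ⟩ := exists_primitive hT (f := fun t => 4 * θs * p₀ t * corrY ω a (y₀ t) *
    (-(θs * ω (y₀ t) * a (y₀ t) * corrY ω a (y₀ t)) - p₀ t ^ 2 * corrP ω a (y₀ t)))
    (((continuousOn_const.mul cp).mul cα).mul
      ((((continuousOn_const.mul cω).mul ca).mul cα).neg.sub ((cp.pow 2).mul cb)))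
    (-(p₀ 0 * P + θs * ω (y₀ 0) * a (y₀ 0) * Y + θs ^ 2 * a (y₀ 0) ^ 2 / 16
      - θs * p₀ 0 ^ 2 * a (y₀ 0) * corrY ω a (y₀ 0)) / ω (y₀ 0))
  have cθ : ContinuousOn θb (Icc 0 T) := fun t ht => (hθ t ht).continuousWithinAt
  obtain ⟨yb, pb, hy0, hp0, hy, hp⟩ := exists_planar_linear_solution hT
    (c₁ := fun _ => 0) (c₂ := fun _ => 1)
    (c₃ := fun t => -(θs * ω (y₀ t) * (deriv a (y₀ t) + a (y₀ t) ^ 2))) (c₄ := fun _ => 0)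
    (f₁ := fun t => -(θs * a (y₀ t) * p₀ t * corrY ω a (y₀ t)))
    (f₂ := fun t => -(ω (y₀ t) * a (y₀ t) * θb t)
      - θs ^ 2 * a (y₀ t) * deriv a (y₀ t) / 8
      + θs * p₀ t ^ 2 * deriv a (y₀ t) * corrY ω a (y₀ t))
    continuousOn_const continuousOn_const
    ((continuousOn_const.mul cω).mul (ca1.add (ca.pow 2))).neg continuousOn_const
    (((continuousOn_const.mul ca).mul cp).mul cα).neg
    ((((cω.mul ca).mul cθ).neg.sub (((continuousOn_const.mul ca).mul ca1).div_const 8)).add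
      (((continuousOn_const.mul (cp.pow 2)).mul ca1).mul cα)) Y P
  have cy : ContinuousOn yb (Icc 0 T) := fun t ht => (hy t ht).continuousWithinAt
  obtain ⟨φb, hφ0, hφ⟩ := exists_primitive hT (f := fun t => ω (y₀ t) * a (y₀ t) * yb t
    + θs * a (y₀ t) ^ 2 / 8 - p₀ t ^ 2 * a (y₀ t) * corrY ω a (y₀ t) / 2)
    ((((cω.mul ca).mul cy).add ((continuousOn_const.mul (ca.pow 2)).div_const 8)).sub
      ((((cp.pow 2).mul ca).mul cα).div_const 2)) (p₀ 0 * corrY ω a (y₀ 0))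
  refine ⟨φb, θb, yb, pb, hφ0, hy0, hp0, ?_, hφ, hθ, fun t ht => ?_, fun t ht => ?_⟩
  · have := (hf.pos (y₀ 0)).ne'
    rw [hθ0, hy0, hp0]
    field_simp
    ring
  · convert! hy t ht using 1
    ring
  · convert! hp t ht using 1
    ring

/-- Same triangular order: once the actions agree, the differences of position and momentum solve a
homogeneous planar system with zero data, and Grönwall with `δ = 0` applies. -/
lemma correction_unique (F : IsFamily ω a ε₀ T E θs φ θ y p φ₀ y₀ p₀)
    {φb' θb' yb' pb' : ℝ → ℝ} (G : IsCorrection ω a T θs y₀ p₀ φb θb yb pb)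
    (G' : IsCorrection ω a T θs y₀ p₀ φb' θb' yb' pb') :
    EqOn φb' φb (Icc 0 T) ∧ EqOn θb' θb (Icc 0 T) ∧
      EqOn yb' yb (Icc 0 T) ∧ EqOn pb' pb (Icc 0 T) := by
  have hy0 : yb' 0 = yb 0 := G'.y_init.trans G.y_init.symm
  have hp0 : pb' 0 = pb 0 := G'.p_init.trans G.p_init.symm
  have hθ0 : θb' 0 = θb 0 := by
    have h1 := G.θ_init
    have h2 := G'.θ_init
    rw [hy0, hp0] at h2
    exact mul_left_cancel₀ (F.freq.pos (y₀ 0)).ne' (by linarith)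
  have hθ : EqOn θb' θb (Icc 0 T) := eqOn_of_deriv_eq G'.θ_deriv G.θ_deriv hθ0
  obtain ⟨K, hK⟩ := isCompact_Icc.exists_bound_of_continuousOn ((continuousOn_const (c := θs)).mul
    (F.continuousOn_comp_y₀ F.freq.contDiff) |>.mul
    ((F.continuousOn_comp_y₀ F.freq.contDiff_deriv).add
      ((F.continuousOn_comp_y₀ F.freq.contDiff_log).pow 2)))
  have key := abs_le_of_planar_deriv_le (K := |K| + 1) (δ := 0) (by positivity)
    (fun t ht => (G'.y_deriv t ht).sub (G.y_deriv t ht))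
    (fun t ht => (G'.p_deriv t ht).sub (G.p_deriv t ht))
    (by simp [hy0]) (by simp [hp0])
    (fun t ht => by
      simp only [Pi.sub_apply]
      rw [show pb' t - θs * a (y₀ t) * p₀ t * corrY ω a (y₀ t)
        - (pb t - θs * a (y₀ t) * p₀ t * corrY ω a (y₀ t)) = pb' t - pb t by ring]
      nlinarith [abs_nonneg K, abs_nonneg (yb' t - yb t), abs_nonneg (pb' t - pb t)])
    (fun t ht => by
      simp only [Pi.sub_apply]
      have h1 := hK t ht
      rw [Real.norm_eq_abs] at h1
      have h2 := h1.trans (le_abs_self K)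
      rw [hθ ht, show -(ω (y₀ t) * a (y₀ t) * θb t)
        - θs * ω (y₀ t) * (deriv a (y₀ t) + a (y₀ t) ^ 2) * yb' t
        - θs ^ 2 * a (y₀ t) * deriv a (y₀ t) / 8
        + θs * p₀ t ^ 2 * deriv a (y₀ t) * corrY ω a (y₀ t)
        - (-(ω (y₀ t) * a (y₀ t) * θb t)
        - θs * ω (y₀ t) * (deriv a (y₀ t) + a (y₀ t) ^ 2) * yb t
        - θs ^ 2 * a (y₀ t) * deriv a (y₀ t) / 8
        + θs * p₀ t ^ 2 * deriv a (y₀ t) * corrY ω a (y₀ t))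
        = -(θs * ω (y₀ t) * (deriv a (y₀ t) + a (y₀ t) ^ 2) * (yb' t - yb t)) by ring,
        abs_neg, abs_mul]
      have h3 : |θs * ω (y₀ t) * (deriv a (y₀ t) + a (y₀ t) ^ 2)| * |yb' t - yb t|
          ≤ |K| * |yb' t - yb t| := mul_le_mul_of_nonneg_right h2 (abs_nonneg _)
      nlinarith [abs_nonneg K, abs_nonneg (yb' t - yb t), abs_nonneg (pb' t - pb t)])
  simp only [mul_zero, abs_nonpos_iff, Pi.sub_apply, sub_eq_zero] at key
  have hy : EqOn yb' yb (Icc 0 T) := fun t ht => (key t ht).1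
  refine ⟨eqOn_of_deriv_eq (fun t ht => ?_) G.φ_deriv (G'.φ_init.trans G.φ_init.symm), hθ, hy,
    fun t ht => (key t ht).2⟩
  rw [← hy ht]
  exact G'.φ_deriv t ht

end IsFamily

end FastSlow

namespace FastSlow

/-! ### Convergence of the rescaled residuals -/

section Convergence

variable {ε₀ T : ℝ} {u w d : ℝ → ℝ → ℝ} {v v' : ℝ → ℝ}

/-- Uniform convergence and weak* convergence of derivatives for residuals which agree on `[0, T]`
with a family of known derivative. -/
lemma tendsto_of_residual (hT : 0 < T) (hε₀ : 0 < ε₀)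
    (huw : ∀ ε ∈ Ioo 0 ε₀, ∀ t ∈ Icc 0 T, u ε t = w ε t) (hd : UnifBdd ε₀ T d)
    (hw : ∀ ε ∈ Ioo 0 ε₀, ∀ t ∈ Icc 0 T, HasDerivWithinAt (w ε) (d ε t) (Icc 0 T) t)
    (hv : ∀ t ∈ Icc 0 T, HasDerivWithinAt v (v' t) (Icc 0 T) t)
    (hv' : ContinuousOn v' (Icc 0 T)) (hwv : UnifO ε₀ T 1 (fun ε t => w ε t - v t)) :
    TendstoInC T ε₀ u v ∧ DerivTendstoWeakStar T ε₀ u v := by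
  have hu : ∀ ε ∈ Ioo 0 ε₀, ∀ t ∈ Icc 0 T, HasDerivWithinAt (u ε) (d ε t) (Icc 0 T) t :=
    fun ε hε t ht => (hw ε hε t ht).congr (huw ε hε) (huw ε hε t ht)
  have huv : UnifO ε₀ T 1 (fun ε t => u ε t - v t) :=
    hwv.congr fun ε hε t ht => by rw [huw ε hε t ht]
  exact ⟨tendstoInC_of_unifO hε₀ (fun ε hε t ht => (hu ε hε t ht).continuousWithinAt)
    (fun t ht => (hv t ht).continuousWithinAt) huv,
    derivTendstoWeakStar_of_unifO hT hε₀ hu hv hd (UnifBdd.of_continuousOn hv') huv⟩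

/-- Supplies the `o(ε²)` remainders of the final expansions. -/
lemma TendstoInC.sub_limit (h : TendstoInC T ε₀ u v) :
    TendstoInC T ε₀ (fun ε t => u ε t - v t) (fun _ => 0) := by
  refine ⟨fun ε hε => (h.1 ε hε).sub h.2.1, continuousOn_const, ?_⟩
  have h3 := h.2.2
  rw [Metric.tendstoUniformlyOn_iff] at h3 ⊢
  intro η hη
  filter_upwards [h3 η hη] with ε hε t ht
  have := hε t ht
  rw [Real.dist_eq] at this ⊢
  rwa [zero_sub, neg_sub]

lemma UnifO.div_pow {k j : ℕ} {f : ℝ → ℝ → ℝ} (h : UnifO ε₀ T (j + k) f) :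
    UnifO ε₀ T k (fun ε t => f ε t / ε ^ j) := by
  obtain ⟨g, hg, hge⟩ := h.exists_eq_mul
  refine UnifO.of_eq_mul hg fun ε hε t ht => ?_
  have := hε.1.ne'
  rw [hge ε hε t ht]
  field_simp
  ring

end Convergence

namespace IsFamily

variable {ε₀ T : ℝ} {ω : ℝ → ℝ} {E θs : ℝ} {φ θ y p : ℝ → ℝ → ℝ}
  {φ₀ y₀ p₀ φb θb yb pb : ℝ → ℝ}

lemma tendsto_θ_one (F : IsFamily ω (deriv (logFreq ω)) ε₀ T E θs φ θ y p φ₀ y₀ p₀) :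
    TendstoInC T ε₀ (fun ε t => thetaRes₁ θs θ ε t - thetaOsc₁ ω T θs φ₀ y₀ ε t) (fun _ => 0) ∧
    DerivTendstoWeakStar T ε₀
      (fun ε t => thetaRes₁ θs θ ε t - thetaOsc₁ ω T θs φ₀ y₀ ε t) (fun _ => 0) := by
  obtain ⟨d, hd, hw⟩ := F.exists_deriv_θ_residual
  refine tendsto_of_residual F.T_pos F.ε₀_pos (fun ε _ t ht => ?_) hd hw
    (fun t _ => hasDerivWithinAt_const t _ 0) continuousOn_const ?_
  · rw [F.thetaOsc₁_eq ht, sub_neg_eq_add, thetaRes₁]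
  · refine (UnifO.div_pow (j := 1) (k := 1) F.θ_expansion_one).congr fun ε hε t ht => ?_
    have := hε.1.ne'
    field_simp
    ring

lemma tendsto_φ_two (F : IsFamily ω (deriv (logFreq ω)) ε₀ T E θs φ θ y p φ₀ y₀ p₀)
    (G : IsCorrection ω (deriv (logFreq ω)) T θs y₀ p₀ φb θb yb pb) :
    TendstoInC T ε₀ (fun ε t => res₂ φ φ₀ ε t - phiOsc₂ ω T φ₀ y₀ ε t) φb ∧
    DerivTendstoWeakStar T ε₀ (fun ε t => res₂ φ φ₀ ε t - phiOsc₂ ω T φ₀ y₀ ε t) φb := by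
  obtain ⟨d, hd, hw⟩ := F.exists_deriv_φ_residual
  have cω := F.continuousOn_comp_y₀ F.freq.contDiff
  have ca := F.continuousOn_comp_y₀ F.freq.contDiff_log
  have cα := F.continuousOn_comp_y₀ F.freq.contDiff_corrY
  have cy : ContinuousOn yb (Icc 0 T) := fun t ht => (G.y_deriv t ht).continuousWithinAt
  refine tendsto_of_residual F.T_pos F.ε₀_pos (fun ε _ t ht => ?_) hd hw G.φ_deriv
    ((((cω.mul ca).mul cy).add ((continuousOn_const.mul (ca.pow 2)).div_const 8)).sub
      (((((F.continuousOn_p₀).pow 2).mul ca).mul cα).div_const 2)) ?_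
  · rw [F.phiOsc₂_eq ht, sub_neg_eq_add, res₂]
  · refine (UnifO.div_pow (j := 2) (k := 1) (F.φ_expansion G)).congr fun ε hε t ht => ?_
    have := hε.1.ne'
    field_simp
    ring

lemma tendsto_y_two (F : IsFamily ω (deriv (logFreq ω)) ε₀ T E θs φ θ y p φ₀ y₀ p₀)
    (G : IsCorrection ω (deriv (logFreq ω)) T θs y₀ p₀ φb θb yb pb) :
    TendstoInC T ε₀ (fun ε t => res₂ y y₀ ε t - yOsc₂ ω θs φ₀ y₀ ε t) yb ∧
    DerivTendstoWeakStar T ε₀ (fun ε t => res₂ y y₀ ε t - yOsc₂ ω θs φ₀ y₀ ε t) yb := by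
  obtain ⟨d, hd, hw⟩ := F.exists_deriv_y_residual
  have ca := F.continuousOn_comp_y₀ F.freq.contDiff_log
  have cα := F.continuousOn_comp_y₀ F.freq.contDiff_corrY
  have cp : ContinuousOn pb (Icc 0 T) := fun t ht => (G.p_deriv t ht).continuousWithinAt
  refine tendsto_of_residual F.T_pos F.ε₀_pos (fun ε _ t ht => ?_) hd hw G.y_deriv
    (cp.sub (((continuousOn_const.mul ca).mul F.continuousOn_p₀).mul cα)) ?_
  · rw [F.yOsc₂_eq, sub_neg_eq_add, res₂]
  · refine (UnifO.div_pow (j := 2) (k := 1) (F.y_expansion G)).congr fun ε hε t ht => ?_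
    have := hε.1.ne'
    field_simp
    ring

lemma tendsto_p_two (F : IsFamily ω (deriv (logFreq ω)) ε₀ T E θs φ θ y p φ₀ y₀ p₀)
    (G : IsCorrection ω (deriv (logFreq ω)) T θs y₀ p₀ φb θb yb pb) :
    TendstoInC T ε₀ (fun ε t => res₂ p p₀ ε t - pOsc₂ ω T θs φ₀ y₀ ε t) pb ∧
    DerivTendstoWeakStar T ε₀ (fun ε t => res₂ p p₀ ε t - pOsc₂ ω T θs φ₀ y₀ ε t) pb := by
  obtain ⟨d, hd, hw⟩ := F.exists_deriv_p_residual
  have cω := F.continuousOn_comp_y₀ F.freq.contDiff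
  have ca := F.continuousOn_comp_y₀ F.freq.contDiff_log
  have ca1 := F.continuousOn_comp_y₀ F.freq.contDiff_deriv
  have cα := F.continuousOn_comp_y₀ F.freq.contDiff_corrY
  have cy : ContinuousOn yb (Icc 0 T) := fun t ht => (G.y_deriv t ht).continuousWithinAt
  have cθ : ContinuousOn θb (Icc 0 T) := fun t ht => (G.θ_deriv t ht).continuousWithinAt
  refine tendsto_of_residual F.T_pos F.ε₀_pos (fun ε _ t ht => ?_) hd hw G.p_deriv
    (((((cω.mul ca).mul cθ).neg.sub
      (((continuousOn_const.mul cω).mul (ca1.add (ca.pow 2))).mul cy)).sub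
      (((continuousOn_const.mul ca).mul ca1).div_const 8)).add
      (((continuousOn_const.mul (F.continuousOn_p₀.pow 2)).mul ca1).mul cα)) ?_
  · rw [F.pOsc₂_eq ht, sub_neg_eq_add, res₂]
  · refine (UnifO.div_pow (j := 2) (k := 1) (F.p_expansion G)).congr fun ε hε t ht => ?_
    have := hε.1.ne'
    field_simp
    ring

lemma tendsto_θ_two (F : IsFamily ω (deriv (logFreq ω)) ε₀ T E θs φ θ y p φ₀ y₀ p₀)
    (G : IsCorrection ω (deriv (logFreq ω)) T θs y₀ p₀ φb θb yb pb) :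
    TendstoInC T ε₀ (fun ε t => thetaRes₂ ω T θs φ₀ y₀ θ ε t
      - thetaOsc₂ ω T θs φ₀ y₀ p₀ φb ε t) θb := by
  have cw := F.continuousOn_comp_y₀ F.freq.contDiff_inv
  have ca := F.continuousOn_comp_y₀ F.freq.contDiff_log
  have cα := F.continuousOn_comp_y₀ F.freq.contDiff_corrY
  have cb := F.continuousOn_comp_y₀ F.freq.contDiff_corrP
  have cp := F.continuousOn_p₀
  have cφ : ContinuousOn φb (Icc 0 T) := fun t ht => (G.φ_deriv t ht).continuousWithinAt
  refine tendstoInC_of_unifO F.ε₀_pos (fun ε hε => ?_)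
    (fun t ht => (G.θ_deriv t ht).continuousWithinAt) ?_
  · have cS : ContinuousOn (fastSin (fun _ => φ₀) ε) (Icc 0 T) := fun t ht =>
      (hasDerivWithinAt_fastSin (φ := fun _ => φ₀) (ε := ε) (F.φ₀_deriv t ht)).continuousWithinAt
    have cC : ContinuousOn (fastCos (fun _ => φ₀) ε) (Icc 0 T) := fun t ht =>
      (hasDerivWithinAt_fastCos (φ := fun _ => φ₀) (ε := ε) (F.φ₀_deriv t ht)).continuousWithinAt
    have k : ∀ c : ℝ, ContinuousOn (fun _ : ℝ => c) (Icc 0 T) := fun c => continuousOn_const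
    refine ((F.tendsto_θ_one.1.1 ε hε).div_const ε).sub (ContinuousOn.congr
      (((((((k (θs ^ 2)).mul ca).mul cα).mul cC).add
        (((((k θs).mul (cp.pow 2)).mul cb).mul cw).mul cC)).add
        (((((k (θs ^ 2)).mul ca).mul cα).div_const 4).mul ((cC.pow 2).sub (cS.pow 2)))).sub
        (((((k (4 * θs)).mul cp).mul cα).mul cφ).mul cC)) fun t ht => F.thetaOsc₂_eq ht ε)
  · refine (UnifO.div_pow (j := 2) (k := 1) (F.θ_expansion_two G)).congr fun ε hε t ht => ?_
    have := hε.1.ne'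
    rw [thetaRes₂, thetaRes₁, F.thetaOsc₁_eq ht, F.thetaOsc₂_eq ht]
    -- Stated in free letters, so that denominators are cleared without opening the correctors.
    have h1 : ∀ A B X b : ℝ, ((A - θs) / ε - -B) / ε - X - b
        = (A - θs + ε * B - ε ^ 2 * (b + X)) / ε ^ 2 := fun A B X b => by
      field_simp
      ring
    rw [h1]
    ring

end IsFamily

end FastSlow

/-! ### The second-order expansion theorem -/

theorem theorem2
    (ω : ℝ → ℝ) (hω : ContDiff ℝ (⊤ : ℕ∞) ω)
    (ωstar : ℝ) (hωstar : 0 < ωstar) (hωpos : ∀ x, ωstar ≤ ω x)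
    (ystar pstar ustar : ℝ)
    (T : ℝ) (hT : 0 < T) (ε₀ : ℝ) (hε₀ : 0 < ε₀)
    (φ θ y p : ℝ → ℝ → ℝ)
    (hsol : ∀ ε ∈ Ioo 0 ε₀,
      IsActionAngleSolution ω T ystar pstar ustar ε (φ ε) (θ ε) (y ε) (p ε))
    (φ₀ y₀ p₀ : ℝ → ℝ)
    (hlead : IsLeadingOrder ω T ystar pstar ustar φ₀ y₀ p₀)
    (θs : ℝ) (hθs : θs = thetaStar ω ystar ustar) :
    ∃ φb θb yb pb : ℝ → ℝ,
      -- the averaged second-order motion is the unique solution of the linear problem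
      IsSecondOrderSolution ω T θs φ₀ y₀ p₀ φb θb yb pb ∧
      (∀ φb' θb' yb' pb' : ℝ → ℝ,
        IsSecondOrderSolution ω T θs φ₀ y₀ p₀ φb' θb' yb' pb' →
          EqOn φb' φb (Icc 0 T) ∧ EqOn θb' θb (Icc 0 T) ∧
          EqOn yb' yb (Icc 0 T) ∧ EqOn pb' pb (Icc 0 T)) ∧
      -- first-order residual of the action
      TendstoInC T ε₀
        (fun ε t => thetaRes₁ θs θ ε t - thetaOsc₁ ω T θs φ₀ y₀ ε t) (fun _ => 0) ∧
      DerivTendstoWeakStar T ε₀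
        (fun ε t => thetaRes₁ θs θ ε t - thetaOsc₁ ω T θs φ₀ y₀ ε t) (fun _ => 0) ∧
      -- second-order residual of the phase
      TendstoInC T ε₀ (fun ε t => res₂ φ φ₀ ε t - phiOsc₂ ω T φ₀ y₀ ε t) φb ∧
      DerivTendstoWeakStar T ε₀ (fun ε t => res₂ φ φ₀ ε t - phiOsc₂ ω T φ₀ y₀ ε t) φb ∧
      -- second-order residual of the slow position
      TendstoInC T ε₀ (fun ε t => res₂ y y₀ ε t - yOsc₂ ω θs φ₀ y₀ ε t) yb ∧
      DerivTendstoWeakStar T ε₀ (fun ε t => res₂ y y₀ ε t - yOsc₂ ω θs φ₀ y₀ ε t) yb ∧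
      -- second-order residual of the slow momentum
      TendstoInC T ε₀ (fun ε t => res₂ p p₀ ε t - pOsc₂ ω T θs φ₀ y₀ ε t) pb ∧
      DerivTendstoWeakStar T ε₀ (fun ε t => res₂ p p₀ ε t - pOsc₂ ω T θs φ₀ y₀ ε t) pb ∧
      -- second-order residual of the action
      TendstoInC T ε₀
        (fun ε t => thetaRes₂ ω T θs φ₀ y₀ θ ε t - thetaOsc₂ ω T θs φ₀ y₀ p₀ φb ε t) θb ∧
      -- the resulting second-order expansions, with remainders `o(ε²)` uniformly on `[0, T]`
      (∃ φ₃ θ₃ y₃ p₃ : ℝ → ℝ → ℝ,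
        TendstoInC T ε₀ φ₃ (fun _ => 0) ∧ TendstoInC T ε₀ θ₃ (fun _ => 0) ∧
        TendstoInC T ε₀ y₃ (fun _ => 0) ∧ TendstoInC T ε₀ p₃ (fun _ => 0) ∧
        ∀ ε ∈ Ioo 0 ε₀, ∀ t ∈ Icc 0 T,
          φ ε t = φ₀ t + ε ^ 2 * (φb t + phiOsc₂ ω T φ₀ y₀ ε t) + ε ^ 2 * φ₃ ε t ∧
          θ ε t = θs + ε * thetaOsc₁ ω T θs φ₀ y₀ ε t
            + ε ^ 2 * (θb t + thetaOsc₂ ω T θs φ₀ y₀ p₀ φb ε t) + ε ^ 2 * θ₃ ε t ∧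
          y ε t = y₀ t + ε ^ 2 * (yb t + yOsc₂ ω θs φ₀ y₀ ε t) + ε ^ 2 * y₃ ε t ∧
          p ε t = p₀ t + ε ^ 2 * (pb t + pOsc₂ ω T θs φ₀ y₀ ε t) + ε ^ 2 * p₃ ε t) := by
  have F := IsFamily.of_solutions (IsFrequency.of_contDiff hω fun x => hωstar.trans_le (hωpos x))
    hωstar hωpos hT hε₀ hsol hlead hθs
  obtain ⟨φb, θb, yb, pb, G⟩ := F.exists_correction
  have hφ := F.tendsto_φ_two G
  have hy := F.tendsto_y_two G
  have hp := F.tendsto_p_two G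
  have hθ := F.tendsto_θ_two G
  -- The four remainders are left to unification: each is a corrected residual minus its limit, so
  -- the expansions hold by clearing powers of `ε`.
  refine ⟨φb, θb, yb, pb, F.isSecondOrderSolution_iff.2 G,
    fun φb' θb' yb' pb' h => F.correction_unique G (F.isSecondOrderSolution_iff.1 h),
    F.tendsto_θ_one.1, F.tendsto_θ_one.2, hφ.1, hφ.2, hy.1, hy.2, hp.1, hp.2, hθ,
    _, _, _, _, hφ.1.sub_limit, hθ.sub_limit, hy.1.sub_limit, hp.1.sub_limit,
    fun ε hε t _ => ?_⟩
  have hε0 := hε.1.ne'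
  simp only [res₂, thetaRes₂, thetaRes₁]
  refine ⟨?_, ?_, ?_, ?_⟩
  all_goals
    field_simp
    ring
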